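/- Let $k\ge 2$ be an integer. A $k$-clause over the variables $x_1,\dots,x_N\in\{0,1\}$ is a set of $k$ literals on $k$ distinct variables. For $\alpha\ge 0$, a random $k$-SAT formula $F$ with $N$ variables and density $\alpha$ consists of $M=\lfloor\alpha N\rfloor$ clauses (so $M=\alpha N$ when this is an integer) chosen independently and uniformly among the $2^k\binom Nk$ possible $k$-clauses. For real $\zeta$ let $\Xi(\zeta,F)$ be the number of assignments $x\in\{0,1\}^N$ that violate at most $\zeta$ clauses of $F$. Let $\alpha_*(k)$ be the smallest positive root of $\kappa(\alpha)=1$, where $$\kappa(\alpha)=k(k-1)\,\alpha\,\bigl(1-\tfrac14e^{-k\alpha/2}\bigr)\bigl(1-\tfrac12e^{-k\alpha/2}\bigr)^{k-2}.$$ For $\beta\in\mathbb R$ define $\Phi(\beta,F)$ through belief propagation as follows. Let $\partial a$ be the set of variables of clause $a$; for $i\in\partial a$ let $\partial_+i(a)$ (respectively $\partial_-i(a)$) be the set of the clauses other than $a$ that contain $x_i$ as the same (respectively the opposite) literal as $a$ does. Put $h^{(0)}_{i\to a}=0$ and, for $t\ge 0$, $$u^{(t)}_{a\to i}=-\tfrac12\log\Bigl\{1-\tfrac{1-e^{-\beta}}{2^{k-1}}\prod_{j\in\partial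 a\setminus i}\bigl(1-\tanh h^{(t)}_{j\to a}\bigr)\Bigr\},\qquad h^{(t+1)}_{i\to a}=\sum_{b\in\partial_+i(a)}u^{(t)}_{b\to i}-\sum_{b\in\partial_-i(a)}u^{(t)}_{b\to i}.$$ Let $h_{i\to a}=h^{(t_{\max})}_{i\to a}$, where $t_{\max}$ is the diameter of the factor graph of $F$ (the bipartite graph joining each clause to its variables), that is, the largest distance between two nodes in the same component. Let $E_a(y)\in\{0,1\}$ indicate that $y\in\{0,1\}^{\partial a}$ violates clause $a$, let $\sigma_{ai}(y_i)=1$ if $y_i$ satisfies $a$ and $-1$ otherwise, and put $$\langle E\rangle_{\mathrm{BP},\beta}=\sum_{a}\frac{\sum_{y}E_a(y)\exp\{-\beta E_a(y)+\sum_{i\in\partial a}h_{i\to a}\sigma_{ai}(y_i)\}}{\sum_{y}\exp\{-\beta E_a(y)+\sum_{i\in\partial a}h_{i\to a}\sigma_{ai}(y_i)\}},\qquad \Phi(\beta,F)=N\log 2-\sum_{i=1}^{N^2-1}\frac{\beta}{N^2}\,\langle E\rangle_{\mathrm{BP},\,i\beta/N^2}.$$ **Theorem.** For every $k\ge2$ and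 $0\le\alpha<\alpha_*(k)$ there are constants $A,C,a>0$, depending only on $k$ and $\alpha$, such that for every $\varepsilon>0$, with $\beta=A\log(1/\varepsilon)$, the random $k$-SAT formula $F$ with $N$ variables and density $\alpha$ satisfies, with probability tending to $1$ as $N\to\infty$, $\Xi(N\varepsilon,F)\ge 1$ and $$\bigl|\log\Xi(N\varepsilon,F)-\Phi(\beta,F)\bigr|\le N\,C\,\varepsilon^{a}.$$ -/

import Mathlib

open Filter Topology

noncomputable section

/-! ### The threshold `α_*(k)` -/

/-- The contraction rate
`κ(α) = k (k-1) α (1 - e^{-kα/2}/4) (1 - e^{-kα/2}/2)^{k-2}`. -/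
def kappa (k : ℕ) (α : ℝ) : ℝ :=
  (k : ℝ) * ((k : ℝ) - 1) * α * (1 - 1 / 4 * Real.exp (-((k : ℝ) * α / 2))) *
    (1 - 1 / 2 * Real.exp (-((k : ℝ) * α / 2))) ^ (k - 2)

/-- `α_*(k)`: the smallest positive root of `κ(α) = 1`
(see `alphaStar_isLeast` for the fact that there is one). -/
def alphaStar (k : ℕ) : ℝ := sInf {α : ℝ | 0 < α ∧ kappa k α = 1}

theorem alphaStar_isLeast (k : ℕ) (hk : 2 ≤ k) :
    IsLeast {α : ℝ | 0 < α ∧ kappa k α = 1} (alphaStar k) := by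
  have hcont : Continuous (kappa k) := by unfold kappa; fun_prop
  have h0 : kappa k 0 = 0 := by simp [kappa]
  have hset : {α : ℝ | 0 < α ∧ kappa k α = 1} = Set.Ici 0 ∩ kappa k ⁻¹' {1} := by
    ext α
    simp only [Set.mem_ofPred_eq, Set.mem_inter_iff, Set.mem_Ici, Set.mem_preimage,
      Set.mem_singleton_iff]
    constructor
    · rintro ⟨h, h1⟩
      exact ⟨h.le, h1⟩
    · rintro ⟨h, h1⟩
      refine ⟨lt_of_le_of_ne h ?_, h1⟩
      rintro rfl
      rw [h0] at h1
      exact zero_ne_one h1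
  have hclosed : IsClosed {α : ℝ | 0 < α ∧ kappa k α = 1} := by
    rw [hset]
    exact isClosed_Ici.inter (isClosed_singleton.preimage hcont)
  have hbig : 1 ≤ kappa k (2 ^ (k - 2)) := by
    have hk2 : (2 : ℝ) ≤ k := by exact_mod_cast hk
    have hp : (0 : ℝ) < 2 ^ (k - 2) := by positivity
    unfold kappa
    set e : ℝ := Real.exp (-((k : ℝ) * 2 ^ (k - 2) / 2)) with he
    have he1 : e ≤ 1 := by
      rw [he]
      apply Real.exp_le_one_iff.mpr
      have : 0 ≤ (k : ℝ) * 2 ^ (k - 2) / 2 := by positivity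
      linarith
    have h1 : (1 / 2 : ℝ) ^ (k - 2) ≤ (1 - 1 / 2 * e) ^ (k - 2) :=
      pow_le_pow_left₀ (by norm_num) (by linarith) _
    have h2 : (2 : ℝ) ≤ (k : ℝ) * ((k : ℝ) - 1) := by nlinarith
    have h3 : (3 / 4 : ℝ) ≤ 1 - 1 / 4 * e := by linarith
    calc (1 : ℝ) ≤ 2 * 2 ^ (k - 2) * (3 / 4) * (1 / 2) ^ (k - 2) := by
          have : (2 : ℝ) ^ (k - 2) * (1 / 2) ^ (k - 2) = 1 := by
            rw [← mul_pow]; norm_num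
          nlinarith
      _ ≤ _ := by gcongr
  have hne : {α : ℝ | 0 < α ∧ kappa k α = 1}.Nonempty := by
    obtain ⟨α, hα, h1⟩ := intermediate_value_Icc (a := (0 : ℝ)) (b := 2 ^ (k - 2))
      (by positivity) hcont.continuousOn (show (1 : ℝ) ∈ Set.Icc _ _ from ⟨by rw [h0]; norm_num, hbig⟩)
    rw [hset]
    exact ⟨α, hα.1, h1⟩
  have hbdd : BddBelow {α : ℝ | 0 < α ∧ kappa k α = 1} := ⟨0, fun α h => h.1.le⟩
  exact ⟨hclosed.csInf_mem hne hbdd, fun α h => csInf_le hbdd h⟩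

/-! ### Formulas -/

/-- A literal over the variables `x_i`, `i : Fin N`: the pair `(i, true)` is `x_i` and
`(i, false)` is its negation. An assignment `x : Fin N → Bool` satisfies `(i, s)` iff `x i = s`. -/
abbrev SatLiteral (N : ℕ) : Type := Fin N × Bool

/-- The `k`-clauses over `N` variables: sets of `k` literals on `k` distinct variables.
There are `2 ^ k * N.choose k` of them. -/
abbrev SatClause (k N : ℕ) : Type :=
  {c : Finset (SatLiteral N) // c.card = k ∧ Set.InjOn Prod.fst (c : Set (SatLiteral N))}

/-- A formula: an ordered list of `M` clauses (repetitions allowed). -/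
abbrev SatFormula (k N M : ℕ) : Type := Fin M → SatClause k N

variable {k N M : ℕ}

/-- The number of clauses of `F` violated by the assignment `x`. -/
def violations (F : SatFormula k N M) (x : Fin N → Bool) : ℕ :=
  (Finset.univ.filter fun a : Fin M => ∀ l ∈ (F a).1, x l.1 ≠ l.2).card

/-- `Ξ(ζ, F)`: the number of assignments that violate at most `ζ` clauses. -/
def numAlmostSat (ζ : ℝ) (F : SatFormula k N M) : ℕ :=
  (Finset.univ.filter fun x : Fin N → Bool => (violations F x : ℝ) ≤ ζ).card

/-- The probability of the event `P` for the random formula `F` whose `M` clauses are independent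
and uniform among all `k`-clauses over `N` variables, that is, for `F` uniform on the finite set
of all formulas. -/
def formulaProb (k N M : ℕ) (P : SatFormula k N M → Prop) : ℝ :=
  (Nat.card {F : SatFormula k N M // P F} : ℝ) / (Nat.card (SatFormula k N M) : ℝ)

/-! ### Belief propagation -/

/-- The factor graph: variable nodes `inl i`, clause nodes `inr a`, and an edge between them when
`x_i` or its negation belongs to the clause `a`. -/
def factorGraph (F : SatFormula k N M) : SimpleGraph (Fin N ⊕ Fin M) :=
  SimpleGraph.fromRel fun p q =>
    ∃ (i : Fin N) (a : Fin M) (s : Bool), p = Sum.inl i ∧ q = Sum.inr a ∧ (i, s) ∈ (F a).1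

/-- The diameter of the factor graph: the largest distance between two nodes that are connected to
each other. (`SimpleGraph.dist` is `0` for nodes in different components, so that these do not
contribute; the factor graph is usually disconnected.) -/
def factorDiam (F : SatFormula k N M) : ℕ :=
  Finset.univ.sup fun p : (Fin N ⊕ Fin M) × (Fin N ⊕ Fin M) => (factorGraph F).dist p.1 p.2

/-- The message `u_{a → i} = f({h_{j → a} : j ∈ ∂a \ i})`, where
`f(x_1, …, x_{k-1}) = -(1/2) log (1 - (1 - e^{-β}) / 2^{k-1} * ∏ (1 - tanh x_j))`.
The variable `i` is given by its literal `l = (i, s)` in the clause `a`, and `h a l` stands for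
the message `h_{i → a}`; both are meaningful for `l ∈ F a` only. -/
def bpClauseMsg (β : ℝ) (F : SatFormula k N M) (h : Fin M → SatLiteral N → ℝ)
    (a : Fin M) (l : SatLiteral N) : ℝ :=
  -(1 / 2) * Real.log (1 - (1 - Real.exp (-β)) / 2 ^ (k - 1) *
    ∏ j ∈ (F a).1.erase l, (1 - Real.tanh (h a j)))

/-- One update of the messages from variables to clauses: if `x_i` occurs in the clause `a` as the
literal `l`, the new `h_{i → a}` is the sum of `u_{b → i}` over the clauses `b ≠ a` in which `x_i`
occurs as `l`, minus the sum over the clauses in which it occurs as the opposite literal. -/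
def bpStep (β : ℝ) (F : SatFormula k N M) (h : Fin M → SatLiteral N → ℝ) :
    Fin M → SatLiteral N → ℝ := fun a l =>
  (∑ b ∈ Finset.univ.filter (fun b : Fin M => b ≠ a ∧ l ∈ (F b).1), bpClauseMsg β F h b l) -
    ∑ b ∈ Finset.univ.filter (fun b : Fin M => b ≠ a ∧ (l.1, !l.2) ∈ (F b).1),
      bpClauseMsg β F h b (l.1, !l.2)

/-- The messages `h_{i → a}` after `t` iterations, from the initial condition `0`. -/
def bpMsg (β : ℝ) (F : SatFormula k N M) : ℕ → Fin M → SatLiteral N → ℝ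
  | 0 => fun _ _ => 0
  | t + 1 => bpStep β F (bpMsg β F t)

/-- For an assignment `y` of the variables of a clause `c` (`y l` is the value of the variable of
the literal `l ∈ c`): `1` if `y` violates `c`, else `0`. -/
def localViolation (c : SatClause k N) (y : {l // l ∈ c.1} → Bool) : ℝ :=
  if ∀ l : {l // l ∈ c.1}, y l ≠ l.1.2 then 1 else 0

/-- The local weight `exp (-β E_a(y) + ∑_{i ∈ ∂a} h_i σ_{ai}(y_i))`, where `σ_{ai}(y_i)` is `1` if
`y_i` satisfies the clause and `-1` otherwise. -/
def localWeight (β : ℝ) (c : SatClause k N) (h : SatLiteral N → ℝ)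
    (y : {l // l ∈ c.1} → Bool) : ℝ :=
  Real.exp (-β * localViolation c y +
    ∑ l : {l // l ∈ c.1}, h l.1 * (if y l = l.1.2 then 1 else -1))

/-- The belief propagation estimate of the Gibbs probability, at inverse temperature `β`, that the
clause `a` is violated; the messages are those of iteration `factorDiam F`. -/
def bpViolation (β : ℝ) (F : SatFormula k N M) (a : Fin M) : ℝ :=
  (∑ y : {l // l ∈ (F a).1} → Bool,
      localViolation (F a) y * localWeight β (F a) (bpMsg β F (factorDiam F) a) y) /
    ∑ y : {l // l ∈ (F a).1} → Bool, localWeight β (F a) (bpMsg β F (factorDiam F) a) y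

/-- The belief propagation estimate of the Gibbs average of the number of violated clauses. -/
def bpEnergy (β : ℝ) (F : SatFormula k N M) : ℝ := ∑ a : Fin M, bpViolation β F a

/-- The output `Φ(β, F)` of the counting algorithm: with `n = N ^ 2`, `Δ = β / n`, `β_i = i Δ`,
`Φ(β, F) = N log 2 - ∑_{i=1}^{n-1} Δ * bpEnergy β_i F`. -/
def bpLogPartition (β : ℝ) (F : SatFormula k N M) : ℝ :=
  (N : ℝ) * Real.log 2 -
    ∑ i ∈ Finset.Ico 1 (N ^ 2), β / (N : ℝ) ^ 2 * bpEnergy ((i : ℝ) * β / (N : ℝ) ^ 2) F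

end

/-! Let Z(β), in Lean `gibbsZ`, be the partition function in which each violated clause costs a
factor e^{-β}. The theorem joins two comparisons, both valid with high probability: Φ(β,F) agrees
with log Z(β) up to o(N) for fixed β, and log Z(β) agrees with log Ξ(Nε,F) up to N times a power of
ε when β = A log(1/ε) and ε is small. For ε bounded below, all quantities are O(N) up to the factor
|log ε|, and the bound is crude.

Belief propagation. The derivative of -log Z is the mean number of violated clauses, and log Z is
convex, so a sum over N² temperatures recovers log Z up to βM/N² (`abs_log_gibbsZ_sub_sum_le`). It
remains to estimate the probability that a given clause is violated. The exact Gibbs messages obey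
the same recursion as belief propagation wherever the neighbourhood is tree-like ("loose"), except
that the conditioning and the set of clauses present vary from step to step. Running both recursions
in parallel, `msgComparison` bounds the error by β/2 times a sum over nonbacktracking walks of
products of contraction factors. The factor of a clause is a product of bounds on the probabilities
that its other literals are false (`abs_clauseMsg_sub_le`). Such a bound is 1/2 if the negation of
the literal does not occur in the formula, since both fields are then nonnegative, and 1 otherwise.

The negation of a literal is absent with probability about e^{-kα/2}, which makes the mean factor ρ
= 1 - e^{-kα/2}/2. A walk leaves a clause through one of k-1 literals l. It meets on average kα/2
clauses containing l, which leave the factor of l random, and as many containing the negation, which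
force that factor to be 1. One step thus multiplies the expected weight by (k-1)(kα/2)ρ^{k-2}(1+ρ) =
κ(α), and this is less than 1 below the threshold (`looseWeightBound`, `kappa_lt_one`). Non-loose
neighbourhoods have probability O(1/N) (`iidExpect_not_isLooseAt_le`). Stopping at the diameter is
harmless: if it is smaller than the depth considered, all walks have died out and belief propagation
is exact at that clause (`abs_gibbsViolation_sub_bpViolation_le`).

Counting. Trivially Ξ(ζ)e^{-βζ} ≤ Z(β). For the converse, suppose that every clause of a subformula
has an autarky of at most s literals: a consistent set of literals satisfying that clause and every
clause of the subformula in which one of them occurs negated. Making those literals true repairs the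
clause without damaging another, is at most 2^s to one, and saves e^{-β}; hence Z ≤ (1 + 2^s
e^{-β})^M Ξ (`IsRepairable.gibbsZ_le`). Autarkies are found by an exploration that tries the
literals of a clause in turn and keeps the last one regardless. It behaves like a branching process
with mean offspring a constant multiple of μ(1-e^{-μ})^{k-2}, μ = kα/2, with the criterion of
`exists_failWeight_le` implied by κ(α) < 1. The expected fraction of clauses without an autarky of
size n therefore decays exponentially (`exists_iidExpect_defect_le`), and bounded differences turn
the expectation into a high probability bound. Taking s of order β/2 makes both the number of
deleted clauses and 2^s e^{-β} small. -/

/-! ### Independent uniform samples: revealing coordinates, variance and Markov bounds -/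

section FiniteAverages
open Finset BigOperators

variable {ι Ω : Type*} [Fintype ι] [DecidableEq ι]

/-- The expectation of `φ G` for `G : ι → Ω` with independent entries, uniform in `A`. -/
noncomputable def iidExpect (A : Finset Ω) (φ : (ι → Ω) → ℝ) : ℝ :=
  𝔼 G ∈ Fintype.piFinset (fun _ : ι => A), φ G

theorem iidExpect_mono {A : Finset Ω} {φ ψ : (ι → Ω) → ℝ}
    (h : ∀ G, (∀ i, G i ∈ A) → φ G ≤ ψ G) : iidExpect A φ ≤ iidExpect A ψ :=
  expect_le_expect fun G hG => h G (by simpa using hG)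

theorem iidExpect_congr {A : Finset Ω} {φ ψ : (ι → Ω) → ℝ}
    (h : ∀ G, (∀ i, G i ∈ A) → φ G = ψ G) : iidExpect A φ = iidExpect A ψ :=
  expect_congr rfl fun G hG => h G (by simpa using hG)

theorem piFinset_const_nonempty {A : Finset Ω} (hA : A.Nonempty) :
    (Fintype.piFinset (fun _ : ι => A)).Nonempty := by
  simpa using fun _ => hA

theorem iidExpect_const {A : Finset Ω} (hA : A.Nonempty) (c : ℝ) :
    iidExpect A (fun _ : ι → Ω => c) = c :=
  expect_const (piFinset_const_nonempty hA) c

theorem iidExpect_le_const {A : Finset Ω} (hA : A.Nonempty) {φ : (ι → Ω) → ℝ} {c : ℝ}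
    (h : ∀ G, (∀ i, G i ∈ A) → φ G ≤ c) : iidExpect A φ ≤ c :=
  expect_le (piFinset_const_nonempty hA) fun G hG => h G (by simpa using hG)

theorem iidExpect_add (A : Finset Ω) (φ ψ : (ι → Ω) → ℝ) :
    iidExpect A (fun G => φ G + ψ G) = iidExpect A φ + iidExpect A ψ :=
  expect_add_distrib _ _ _

theorem iidExpect_sum {κ : Type*} (s : Finset κ) (A : Finset Ω) (φ : κ → (ι → Ω) → ℝ) :
    iidExpect A (fun G => ∑ j ∈ s, φ j G) = ∑ j ∈ s, iidExpect A (φ j) :=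
  expect_sum_comm _ _ _

theorem iidExpect_const_mul (A : Finset Ω) (c : ℝ) (φ : (ι → Ω) → ℝ) :
    iidExpect A (fun G => c * φ G) = c * iidExpect A φ :=
  (mul_expect _ _ _).symm

theorem iidExpect_comm (A B : Finset Ω) (φ : (ι → Ω) → (ι → Ω) → ℝ) :
    iidExpect A (fun G => iidExpect B (fun G' => φ G G')) =
      iidExpect B (fun G' => iidExpect A (fun G => φ G G')) :=
  expect_comm _ _ _

theorem iidExpect_prod (A : Finset Ω) (ψ : ι → Ω → ℝ) :
    iidExpect A (fun G => ∏ i, ψ i (G i)) = ∏ i, 𝔼 c ∈ A, ψ i c := by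
  unfold iidExpect
  simp only [expect_eq_sum_div_card]
  rw [← prod_univ_sum, Fintype.card_piFinset, prod_div_distrib]
  push_cast
  rfl

/-- Expanding an arbitrary function into products of one-coordinate functions lets `iidExpect_prod`
reduce an identity of joint laws to the coordinates separately. -/
theorem eq_sum_mul_prod_indicator [Fintype Ω] [DecidableEq Ω] (ψ : (ι → Ω) → ℝ) (G : ι → Ω) :
    ψ G = ∑ F : ι → Ω, ψ F * ∏ i, (if G i = F i then (1 : ℝ) else 0) := by
  rw [Finset.sum_eq_single G]
  · simp
  · intro F _ hF
    obtain ⟨i, hi⟩ := Function.ne_iff.mp hF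
    rw [Finset.prod_eq_zero (mem_univ i) (by simp [hi.symm]), mul_zero]
  · simp

/-- Coordinatewise resampling: if replacing each coordinate of a sample from `A` by a function of
it and of a sample from `B` preserves the one-coordinate law, it preserves the joint law. -/
theorem iidExpect_mix [Fintype Ω] (A B : Finset Ω) (mix : ι → Ω → Ω → Ω)
    (hmix : ∀ i, ∀ g : Ω → ℝ, 𝔼 c ∈ A, 𝔼 c' ∈ B, g (mix i c c') = 𝔼 c ∈ A, g c)
    (ψ : (ι → Ω) → ℝ) :
    iidExpect A (fun G => iidExpect B (fun G' => ψ fun i => mix i (G i) (G' i))) =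
      iidExpect A ψ := by
  classical
  have key : ∀ F : ι → Ω,
      iidExpect A (fun G => iidExpect B (fun G' =>
        ∏ i, (if mix i (G i) (G' i) = F i then (1 : ℝ) else 0))) =
      iidExpect A (fun G => ∏ i, (if G i = F i then (1 : ℝ) else 0)) := by
    intro F
    have h1 : ∀ G : ι → Ω, iidExpect B (fun G' =>
        ∏ i, (if mix i (G i) (G' i) = F i then (1 : ℝ) else 0)) =
        ∏ i, 𝔼 c' ∈ B, (if mix i (G i) c' = F i then (1 : ℝ) else 0) := fun G =>
      iidExpect_prod B (fun i c' => if mix i (G i) c' = F i then (1 : ℝ) else 0)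
    simp only [h1]
    rw [iidExpect_prod A (fun i c => 𝔼 c' ∈ B, (if mix i c c' = F i then (1 : ℝ) else 0)),
      iidExpect_prod A (fun i c => (if c = F i then (1 : ℝ) else 0))]
    exact prod_congr rfl fun i _ => hmix i (fun c => if c = F i then (1 : ℝ) else 0)
  have h2 : ∀ G G' : ι → Ω, ψ (fun i => mix i (G i) (G' i)) =
      ∑ F : ι → Ω, ψ F * ∏ i, (if mix i (G i) (G' i) = F i then (1 : ℝ) else 0) := fun G G' =>
    eq_sum_mul_prod_indicator ψ _
  simp only [h2, iidExpect_sum, iidExpect_const_mul, key]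
  simp only [← iidExpect_const_mul, ← iidExpect_sum]
  exact iidExpect_congr fun G _ => (eq_sum_mul_prod_indicator ψ G).symm

theorem iidExpect_coord (A : Finset Ω) (hA : A.Nonempty) (b : ι) (g : Ω → ℝ) :
    iidExpect A (fun G : ι → Ω => g (G b)) = 𝔼 c ∈ A, g c := by
  have h := iidExpect_prod A (fun i c => if i = b then g c else (1 : ℝ))
  simp only [Finset.prod_ite_eq', mem_univ, if_true] at h
  rw [h]
  rw [Finset.prod_eq_single b]
  · simp
  · intro i _ hi
    simp [hi, expect_const hA]
  · simp

/-- Revealing the coordinate `b`. -/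
theorem iidExpect_update [Fintype Ω] (A : Finset Ω) (hA : A.Nonempty) (b : ι)
    (ψ : (ι → Ω) → ℝ) :
    iidExpect A ψ = 𝔼 c ∈ A, iidExpect A (fun G => ψ (Function.update G b c)) := by
  -- Only the coordinate `b` is resampled, from an independent copy; exchanging the two averages
  -- then isolates it.
  have h := iidExpect_mix A A (fun i c c' => if i = b then c' else c) ?_ ψ
  · rw [← h, iidExpect_comm, ← iidExpect_coord A hA b
      (fun c => iidExpect A (fun G => ψ (Function.update G b c)))]
    refine iidExpect_congr fun G' _ => iidExpect_congr fun G _ => congrArg ψ ?_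
    ext i
    by_cases hi : i = b
    · subst hi; simp
    · simp [hi]
  · intro i g
    by_cases hi : i = b
    · simp [hi, expect_const hA]
    · simp [hi, expect_const hA]

/-- Revealing the coordinate `b` when the coordinates in `τ` are known. -/
theorem iidExpect_piecewise_reveal [Fintype Ω] (A : Finset Ω) (hA : A.Nonempty) {τ : Finset ι}
    {b : ι} (hb : b ∉ τ) (f : ι → Ω) (φ : (ι → Ω) → ℝ) :
    iidExpect A (fun G => φ (τ.piecewise f G)) =
      𝔼 c ∈ A, iidExpect A (fun G => φ ((insert b τ).piecewise (Function.update f b c) G)) := by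
  rw [iidExpect_update A hA b]
  refine expect_congr rfl fun c _ => iidExpect_congr fun G _ => congrArg φ ?_
  ext i
  by_cases hi : i = b
  · subst hi; simp [hb]
  · by_cases hτ : i ∈ τ <;> simp [hi, hτ, Finset.piecewise]

/-- Revealing all the coordinates, outside of the known set `τ`, that satisfy `p`: the other ones
become uniform on the elements that do not satisfy `p`. -/
theorem iidExpect_piecewise_reveal_pred [Fintype Ω] (A : Finset Ω) (p : Ω → Prop)
    [DecidablePred p] (hA : (A.filter fun c => ¬ p c).Nonempty) (τ : Finset ι) (f : ι → Ω)
    (φ : (ι → Ω) → ℝ) :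
    iidExpect A (fun G => φ (τ.piecewise f G)) =
      iidExpect A (fun G => iidExpect (A.filter fun c => ¬ p c) (fun G' =>
        φ ((τ ∪ univ.filter (fun b => b ∉ τ ∧ p (G b))).piecewise (τ.piecewise f G) G'))) := by
  -- A sample that satisfies `p` is kept, any other one is replaced by a fresh sample conditioned
  -- not to satisfy `p`. This preserves the one-coordinate law.
  rw [← iidExpect_mix A (A.filter fun c => ¬ p c) (fun _ c c' => if p c then c else c') ?_]
  · refine iidExpect_congr fun G _ => iidExpect_congr fun G' _ => congrArg φ ?_
    ext i
    by_cases hτ : i ∈ τ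
    · simp [hτ, Finset.piecewise]
    · by_cases hp : p (G i) <;> simp [hτ, hp, Finset.piecewise]
  · intro _ g
    have hA' : (0 : ℝ) < (A.filter fun c => ¬ p c).card := by exact_mod_cast hA.card_pos
    have h1 : ∀ c, 𝔼 c' ∈ A.filter (fun c => ¬ p c), g (if p c then c else c') =
        if p c then g c else 𝔼 c' ∈ A.filter (fun c => ¬ p c), g c' := by
      intro c
      by_cases hc : p c
      · simp [hc, expect_const hA]
      · simp [hc]
    simp only [h1]
    rw [expect_eq_sum_div_card, expect_eq_sum_div_card A]
    congr 1
    rw [sum_ite, ← sum_filter_add_sum_filter_not A p g]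
    congr 1
    rw [sum_const, nsmul_eq_mul, expect_eq_sum_div_card]
    field_simp

theorem iidExpect_univ_fin_succ [Fintype Ω] {n : ℕ} (f : (Fin (n + 1) → Ω) → ℝ) :
    𝔼 F, f F = 𝔼 c, 𝔼 G : Fin n → Ω, f (Fin.cons c G) := by
  rw [← expect_product' (univ : Finset Ω) (univ : Finset (Fin n → Ω))
    (fun c G => f (Fin.cons c G)), univ_product_univ]
  exact (Fintype.expect_equiv (Fin.consEquiv fun _ => Ω) _ _ (fun p => by rfl)).symm

/-- The Efron–Stein bound for functions with differences bounded by one. -/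
theorem variance_le_of_bounded_differences [Fintype Ω] [Nonempty Ω] {n : ℕ}
    (f : (Fin n → Ω) → ℝ) (hf : ∀ F b c, |f (Function.update F b c) - f F| ≤ 1) :
    𝔼 F, (f F - 𝔼 G, f G) ^ 2 ≤ (n : ℝ) := by
  induction n with
  | zero =>
    simp [Subsingleton.elim _ (default : Fin 0 → Ω)]
  | succ n ih =>
    set e : ℝ := 𝔼 G, f G with he
    set d : Ω → ℝ := fun c => 𝔼 G : Fin n → Ω, f (Fin.cons c G) with hd
    have hed : e = 𝔼 c, d c := iidExpect_univ_fin_succ f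
    have hdd : ∀ c c', |d c - d c'| ≤ 1 := by
      intro c c'
      rw [hd, ← expect_sub_distrib]
      refine (abs_expect_le _ _).trans (expect_le univ_nonempty fun G _ => ?_)
      have := hf (Fin.cons c' G) 0 c
      simpa using this
    have hde : ∀ c, (d c - e) ^ 2 ≤ 1 := by
      intro c
      rw [sq_le_one_iff_abs_le_one, hed,
        show d c = 𝔼 _c' : Ω, d c from (Fintype.expect_const _).symm, ← expect_sub_distrib]
      exact (abs_expect_le _ _).trans (expect_le univ_nonempty fun c' _ => by simpa using hdd c c')
    rw [iidExpect_univ_fin_succ]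
    have hin : ∀ c, 𝔼 G : Fin n → Ω, (f (Fin.cons c G) - e) ^ 2 ≤ n + 1 := by
      intro c
      -- Conditional variance plus the squared deviation of the conditional mean `d c`; the cross
      -- term averages to zero. The first part is at most n by induction, the second at most 1.
      have h1 : ∀ G : Fin n → Ω, (f (Fin.cons c G) - e) ^ 2 =
          (f (Fin.cons c G) - d c) ^ 2 + ((2 * (d c - e)) * (f (Fin.cons c G) - d c)
            + (d c - e) ^ 2) := fun G => by ring
      have h2 : 𝔼 G : Fin n → Ω, (f (Fin.cons c G) - d c) = 0 := by
        rw [expect_sub_distrib, Fintype.expect_const, hd, sub_self]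
      simp only [h1]
      rw [expect_add_distrib, expect_add_distrib, ← mul_expect, h2, mul_zero, zero_add,
        Fintype.expect_const]
      refine add_le_add (ih (fun G => f (Fin.cons c G)) fun F b c' => ?_) (hde c)
      have := hf (Fin.cons c F) b.succ c'
      rwa [← Fin.cons_update] at this
    push_cast
    exact expect_le univ_nonempty fun c _ => hin c

theorem markov_expect {α : Type*} [Fintype α] (f : α → ℝ) (hf : ∀ x, 0 ≤ f x)
    {t : ℝ} (ht : 0 < t) [DecidablePred fun x => t ≤ f x] :
    ((univ.filter fun x => t ≤ f x).card : ℝ) / Fintype.card α ≤ (𝔼 x, f x) / t := by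
  rw [Fintype.expect_eq_sum_div_card, div_right_comm]
  refine div_le_div_of_nonneg_right ?_ (by positivity)
  rw [le_div_iff₀ ht, ← nsmul_eq_mul, ← sum_const]
  exact (sum_le_sum fun x hx => (mem_filter.mp hx).2).trans
    (sum_le_sum_of_subset_of_nonneg (filter_subset _ _) fun x _ _ => hf x)

end FiniteAverages

/-! ### Symmetries of the set of clauses, and how often literals occur -/

section Clauses
open Finset BigOperators

/-- The opposite literal. -/
def negLit {N : ℕ} (l : SatLiteral N) : SatLiteral N := (l.1, !l.2)

@[simp] theorem negLit_fst {N : ℕ} (l : SatLiteral N) : (negLit l).1 = l.1 := rfl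

@[simp] theorem negLit_negLit {N : ℕ} (l : SatLiteral N) : negLit (negLit l) = l := by
  simp [negLit]

theorem negLit_ne {N : ℕ} (l : SatLiteral N) : negLit l ≠ l := by
  intro h
  have := congrArg Prod.snd h
  simp [negLit] at this

theorem eq_or_eq_negLit {N : ℕ} {l m : SatLiteral N} (h : m.1 = l.1) : m = l ∨ m = negLit l := by
  obtain ⟨i, s⟩ := l
  obtain ⟨j, t⟩ := m
  simp only at h
  subst h
  cases s <;> cases t <;> simp [negLit]

theorem ne_snd_iff_eq_negLit_snd {N : ℕ} (x : Fin N → Bool) (l : SatLiteral N) :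
    x l.1 ≠ l.2 ↔ x (negLit l).1 = (negLit l).2 := by
  simp only [negLit]
  cases x l.1 <;> cases l.2 <;> simp

noncomputable instance satClauseFintype (k N : ℕ) : Fintype (SatClause k N) := Fintype.ofFinite _

variable {k N : ℕ}

theorem SatClause.eq_of_fst_eq (c : SatClause k N) {l l' : SatLiteral N} (hl : l ∈ c.1)
    (hl' : l' ∈ c.1) (h : l.1 = l'.1) : l = l' := c.2.2 hl hl' h

theorem SatClause.negLit_notMem (c : SatClause k N) {l : SatLiteral N} (hl : l ∈ c.1) :
    negLit l ∉ c.1 := fun h => negLit_ne l (c.eq_of_fst_eq h hl rfl)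

/-- The variables of a clause. -/
def clauseVars (c : SatClause k N) : Finset (Fin N) := c.1.image Prod.fst

theorem mem_clauseVars {c : SatClause k N} {i : Fin N} :
    i ∈ clauseVars c ↔ ∃ l ∈ c.1, l.1 = i := by simp [clauseVars]

theorem fst_mem_clauseVars {c : SatClause k N} {l : SatLiteral N} (h : l ∈ c.1) :
    l.1 ∈ clauseVars c := mem_clauseVars.mpr ⟨l, h, rfl⟩

theorem card_clauseVars (c : SatClause k N) : (clauseVars c).card = k := by
  rw [clauseVars, card_image_of_injOn c.2.2, c.2.1]

/-- The symmetry of the set of literals that permutes variables by `π` and flips signs by `s`. -/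
def litPerm (π : Equiv.Perm (Fin N)) (s : Fin N → Bool) : Equiv.Perm (SatLiteral N) where
  toFun l := (π l.1, xor l.2 (s l.1))
  invFun l := (π.symm l.1, xor l.2 (s (π.symm l.1)))
  left_inv l := by simp
  right_inv l := by simp

/-- The symmetry of the set of clauses induced by a symmetry of the set of literals. -/
def clausePerm (π : Equiv.Perm (Fin N)) (s : Fin N → Bool) (c : SatClause k N) : SatClause k N :=
  ⟨c.1.map (litPerm π s).toEmbedding, by
    refine ⟨by rw [card_map, c.2.1], ?_⟩
    rintro _ h1 _ h2 h
    simp only [coe_map, Set.mem_image, mem_coe] at h1 h2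
    obtain ⟨l, hl, rfl⟩ := h1
    obtain ⟨l', hl', rfl⟩ := h2
    have : l.1 = l'.1 := π.injective h
    rw [c.eq_of_fst_eq hl hl' this]⟩

theorem clausePerm_injective (π : Equiv.Perm (Fin N)) (s : Fin N → Bool) :
    Function.Injective (clausePerm (k := k) π s) := by
  intro c c' h
  have := congrArg Subtype.val h
  exact Subtype.ext (Finset.map_injective _ this)

theorem mem_clausePerm {π : Equiv.Perm (Fin N)} {s : Fin N → Bool} {c : SatClause k N}
    {l : SatLiteral N} (h : l ∈ c.1) : (π l.1, xor l.2 (s l.1)) ∈ (clausePerm π s c).1 :=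
  mem_map_of_mem (litPerm π s).toEmbedding h

/-- A symmetry carrying `l` to `l'` injects one set of clauses into the other. Used in both
directions, this gives equality of the counts. -/
theorem card_filter_mem_le (l l' : SatLiteral N) :
    (univ.filter fun c : SatClause k N => l ∈ c.1).card ≤
      (univ.filter fun c : SatClause k N => l' ∈ c.1).card := by
  refine card_le_card_of_injOn (clausePerm (Equiv.swap l.1 l'.1) fun _ => xor l.2 l'.2) ?_
    (clausePerm_injective _ _).injOn
  intro c hc
  have := mem_clausePerm (π := Equiv.swap l.1 l'.1) (s := fun _ => xor l.2 l'.2)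
    (mem_filter.mp hc).2
  simpa using this

theorem card_filter_mem (l : SatLiteral N) :
    2 * N * (univ.filter fun c : SatClause k N => l ∈ c.1).card =
      k * Fintype.card (SatClause k N) := by
  have h1 : ∑ l' : SatLiteral N, (univ.filter fun c : SatClause k N => l' ∈ c.1).card =
      ∑ c : SatClause k N, c.1.card := by
    simp_rw [card_filter]
    rw [sum_comm]
    simp
  have h2 : ∀ l', (univ.filter fun c : SatClause k N => l' ∈ c.1).card =
      (univ.filter fun c : SatClause k N => l ∈ c.1).card := fun l' =>
    le_antisymm (card_filter_mem_le l' l) (card_filter_mem_le l l')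
  rw [sum_congr rfl fun l' _ => h2 l', sum_const, sum_congr rfl fun c _ => c.2.1, sum_const] at h1
  simp only [card_univ, Fintype.card_prod, Fintype.card_fin, Fintype.card_bool,
    smul_eq_mul] at h1
  linarith

theorem card_filter_mem_pair_le {l l₁ l₂ : SatLiteral N} (h₁ : l₁.1 ≠ l.1) (h₂ : l₂.1 ≠ l.1) :
    (univ.filter fun c : SatClause k N => l ∈ c.1 ∧ l₁ ∈ c.1).card ≤
      (univ.filter fun c : SatClause k N => l ∈ c.1 ∧ l₂ ∈ c.1).card := by
  set s : Fin N → Bool := fun i => if i = l.1 then false else xor l₁.2 l₂.2 with hs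
  refine card_le_card_of_injOn (clausePerm (Equiv.swap l₁.1 l₂.1) s) ?_
    (clausePerm_injective _ _).injOn
  intro c hc
  obtain ⟨hc1, hc2⟩ := (mem_filter.mp hc).2
  have e1 := mem_clausePerm (π := Equiv.swap l₁.1 l₂.1) (s := s) hc1
  have e2 := mem_clausePerm (π := Equiv.swap l₁.1 l₂.1) (s := s) hc2
  rw [Equiv.swap_apply_of_ne_of_ne h₁.symm h₂.symm] at e1
  simp only [hs, if_true, Bool.xor_false] at e1
  simp only [hs, h₁, if_false, Equiv.swap_apply_left] at e2
  simp only [mem_coe, mem_filter, mem_univ, true_and]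
  refine ⟨e1, ?_⟩
  have e3 : (l₂.1, xor l₁.2 (xor l₁.2 l₂.2)) = l₂ := by simp
  rwa [e3] at e2

/-- Double counting of pairs (clause through `l`, literal in it). All literals on other variables
contribute at least as much as one another by symmetry, and `l` itself is counted on the right,
which is why `k` appears and not `k - 1`. -/
theorem card_filter_mem_pair {l l₁ : SatLiteral N} (h₁ : l₁.1 ≠ l.1) :
    2 * (N - 1) * (univ.filter fun c : SatClause k N => l ∈ c.1 ∧ l₁ ∈ c.1).card ≤
      k * (univ.filter fun c : SatClause k N => l ∈ c.1).card := by
  have h1 : ∑ l' : SatLiteral N, (univ.filter fun c : SatClause k N => l ∈ c.1 ∧ l' ∈ c.1).card =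
      ∑ c ∈ univ.filter (fun c : SatClause k N => l ∈ c.1), c.1.card := by
    simp_rw [card_filter]
    rw [sum_comm, sum_filter]
    refine sum_congr rfl fun c _ => ?_
    by_cases hc : l ∈ c.1 <;> simp [hc]
  have h2 : ((univ.erase l.1 ×ˢ univ : Finset (SatLiteral N))).card *
      (univ.filter fun c : SatClause k N => l ∈ c.1 ∧ l₁ ∈ c.1).card ≤
      ∑ l' ∈ (univ.erase l.1 ×ˢ univ : Finset (SatLiteral N)),
        (univ.filter fun c : SatClause k N => l ∈ c.1 ∧ l' ∈ c.1).card := by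
    rw [← smul_eq_mul]
    refine card_nsmul_le_sum _ _ _ fun l' hl' => ?_
    simp only [mem_product, mem_erase, mem_univ, and_true] at hl'
    exact card_filter_mem_pair_le h₁ hl'
  have h3 := h2.trans (sum_le_sum_of_subset (subset_univ _))
  rw [h1, sum_congr rfl fun c _ => c.2.1, sum_const, card_product, card_erase_of_mem (mem_univ _)]
    at h3
  simp only [card_univ, Fintype.card_fin, Fintype.card_bool, smul_eq_mul] at h3
  linarith

theorem expect_mem (hN : 0 < N) [Nonempty (SatClause k N)] (l : SatLiteral N) :
    𝔼 c : SatClause k N, (if l ∈ c.1 then (1 : ℝ) else 0) = k / (2 * N) := by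
  have h : (2 * N * (univ.filter fun c : SatClause k N => l ∈ c.1).card : ℝ) =
      k * Fintype.card (SatClause k N) := by exact_mod_cast card_filter_mem l
  have hΩ : (0 : ℝ) < Fintype.card (SatClause k N) := by exact_mod_cast Fintype.card_pos
  have hN' : (0 : ℝ) < N := by exact_mod_cast hN
  rw [Fintype.expect_eq_sum_div_card, sum_boole]
  field_simp
  linarith

theorem expect_mem_pair (hN : 2 ≤ N) [Nonempty (SatClause k N)] {l l' : SatLiteral N}
    (h : l'.1 ≠ l.1) :
    𝔼 c : SatClause k N, (if l ∈ c.1 ∧ l' ∈ c.1 then (1 : ℝ) else 0) ≤ k ^ 2 / (2 * N ^ 2) := by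
  have h0 : (2 * N * (univ.filter fun c : SatClause k N => l ∈ c.1).card : ℝ) =
      k * Fintype.card (SatClause k N) := by exact_mod_cast card_filter_mem l
  have h1 : ((2 * (N - 1 : ℕ) * (univ.filter fun c : SatClause k N => l ∈ c.1 ∧ l' ∈ c.1).card
      : ℕ) : ℝ) ≤ ((k * (univ.filter fun c : SatClause k N => l ∈ c.1).card : ℕ) : ℝ) := by
    exact_mod_cast card_filter_mem_pair h
  push_cast [Nat.cast_sub (show 1 ≤ N by omega)] at h1
  have hΩ : (0 : ℝ) < Fintype.card (SatClause k N) := by exact_mod_cast Fintype.card_pos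
  have hN' : (2 : ℝ) ≤ N := by exact_mod_cast hN
  rw [Fintype.expect_eq_sum_div_card, sum_boole, div_le_div_iff₀ hΩ (by positivity)]
  set p : ℝ := ((univ.filter fun c : SatClause k N => l ∈ c.1 ∧ l' ∈ c.1).card : ℝ)
  set q : ℝ := ((univ.filter fun c : SatClause k N => l ∈ c.1).card : ℝ)
  set w : ℝ := (Fintype.card (SatClause k N) : ℝ)
  have hp : 0 ≤ p := Nat.cast_nonneg _
  -- Here N ≤ 2(N - 1), because N ≥ 2.
  have h2 : N * p ≤ k * q := by nlinarith
  have hN0 : (0 : ℝ) ≤ N := by linarith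
  have hk0 : (0 : ℝ) ≤ k := Nat.cast_nonneg _
  have h3 : 2 * N * (N * p) ≤ 2 * N * (k * q) := mul_le_mul_of_nonneg_left h2 (by linarith)
  have h4 : 2 * N * (k * q) = k * (k * w) := by rw [← h0]; ring
  nlinarith

theorem satClause_nonempty (h : k ≤ N) : Nonempty (SatClause k N) := by
  obtain ⟨s, hs⟩ := exists_subset_card_eq (s := (univ : Finset (Fin N))) (n := k) (by simpa using h)
  refine ⟨⟨s ×ˢ {true}, by simp [hs.2], ?_⟩⟩
  rintro ⟨i, b⟩ h1 ⟨j, b'⟩ h2 h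
  simp only [coe_product, coe_singleton, Set.mem_prod, Set.mem_singleton_iff] at h1 h2
  simp_all

end Clauses

/-! ### Poisson limits for absent literals, and the expected product of purity weights -/

section AvoidanceProbabilities
open Finset BigOperators

variable {k N : ℕ}

/-- The indicator that the clause `c` contains none of the literals in `S`. -/
def avoids (S : Finset (SatLiteral N)) (c : SatClause k N) : ℝ :=
  if ∀ l ∈ S, l ∉ c.1 then 1 else 0

theorem le_expect_avoids (hN : 0 < N) [Nonempty (SatClause k N)] (S : Finset (SatLiteral N)) :
    1 - S.card * (k / (2 * N)) ≤ 𝔼 c : SatClause k N, avoids S c := by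
  have h : ∀ c : SatClause k N, 1 - ∑ l ∈ S, (if l ∈ c.1 then (1 : ℝ) else 0) ≤ avoids S c := by
    intro c
    unfold avoids
    split_ifs with h
    · linarith [sum_nonneg fun l (_ : l ∈ S) => (by split_ifs <;> norm_num :
        (0 : ℝ) ≤ if l ∈ c.1 then (1 : ℝ) else 0)]
    · push Not at h
      obtain ⟨l, hl, hlc⟩ := h
      have := single_le_sum (f := fun l => if l ∈ c.1 then (1 : ℝ) else 0)
        (fun l _ => by split_ifs <;> norm_num) hl
      simp only [hlc, if_true] at this
      linarith
  refine le_trans ?_ (expect_le_expect fun c _ => h c)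
  rw [expect_sub_distrib, Fintype.expect_const, expect_sum_comm, sum_congr rfl fun l _ =>
    expect_mem hN l, sum_const, nsmul_eq_mul]

/-- Second-order Bonferroni inequality, with ordered pairs. Distinct literals in `S` lie on distinct
variables, so that a pair occurs in one clause with probability O(1/N²). -/
theorem expect_avoids_le (hN : 2 ≤ N) [Nonempty (SatClause k N)] (S : Finset (SatLiteral N))
    (hS : Set.InjOn Prod.fst (S : Set (SatLiteral N))) :
    𝔼 c : SatClause k N, avoids S c ≤
      1 - S.card * (k / (2 * N)) + S.card ^ 2 * (k ^ 2 / (2 * N ^ 2)) := by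
  have h : ∀ c : SatClause k N, avoids S c ≤ 1 - ∑ l ∈ S, (if l ∈ c.1 then (1 : ℝ) else 0) +
      ∑ p ∈ S.offDiag, (if p.1 ∈ c.1 ∧ p.2 ∈ c.1 then (1 : ℝ) else 0) := by
    intro c
    set T := S.filter fun l => l ∈ c.1 with hT
    have h1 : ∑ l ∈ S, (if l ∈ c.1 then (1 : ℝ) else 0) = T.card := by rw [sum_boole]
    have h2 : ∑ p ∈ S.offDiag, (if p.1 ∈ c.1 ∧ p.2 ∈ c.1 then (1 : ℝ) else 0) =
        T.offDiag.card := by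
      rw [sum_boole]
      congr 2
      ext p
      simp only [hT, mem_filter, mem_offDiag]
      tauto
    rw [h1, h2, offDiag_card]
    have h3 : T.card ≤ T.card * T.card := Nat.le_mul_self _
    rw [Nat.cast_sub h3]
    push_cast
    unfold avoids
    split_ifs with ha
    · have : T = ∅ := filter_eq_empty_iff.mpr fun l hl => ha l hl
      simp [this]
    -- With t literals of `S` in the clause, the right-hand side is 1 - t + t(t - 1) = (t - 1)².
    · nlinarith [sq_nonneg ((T.card : ℝ) - 1)]
  refine (expect_le_expect fun c _ => h c).trans ?_
  rw [expect_add_distrib, expect_sub_distrib, Fintype.expect_const, expect_sum_comm,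
    expect_sum_comm, sum_congr rfl fun l _ => expect_mem (by omega) l, sum_const, nsmul_eq_mul]
  gcongr
  have hoff : ∀ p ∈ S.offDiag, 𝔼 c : SatClause k N,
      (if p.1 ∈ c.1 ∧ p.2 ∈ c.1 then (1 : ℝ) else 0) ≤ k ^ 2 / (2 * N ^ 2) := by
    intro p hp
    rw [mem_offDiag] at hp
    exact expect_mem_pair hN fun h => hp.2.2 (hS hp.1 hp.2.1 h.symm)
  refine (sum_le_sum hoff).trans ?_
  rw [sum_const, nsmul_eq_mul, offDiag_card]
  gcongr
  rw [sq]
  exact_mod_cast Nat.sub_le _ _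

theorem avoids_nonneg (S : Finset (SatLiteral N)) (c : SatClause k N) : 0 ≤ avoids S c := by
  unfold avoids; split_ifs <;> norm_num

/-- Both Bonferroni bounds depend on `S` through its cardinality only, which gives uniformity over
the sets of at most `K` literals. The exponent may fall short of αN by `K`, to allow for clauses
that have been revealed. -/
theorem eventually_expect_avoids_pow (k : ℕ) (α : ℝ) (K : ℕ) {δ : ℝ} (hδ : 0 < δ) :
    ∀ᶠ N : ℕ in atTop, ∀ S : Finset (SatLiteral N), Set.InjOn Prod.fst (S : Set (SatLiteral N)) →
      S.card ≤ K → ∀ m : ℕ, α * N - K ≤ m → (m : ℝ) ≤ α * N →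
        |(𝔼 c : SatClause k N, avoids S c) ^ m - Real.exp (-(k * α / 2)) ^ S.card| ≤ δ := by
  have hlow : ∀ s ∈ range (K + 1), ∀ᶠ N : ℕ in atTop,
      Real.exp (-(k * α / 2)) ^ s - δ ≤
        Real.exp (-(α * N * (s * (k / (2 * N)) / (1 - s * (k / (2 * N)))))) := by
    intro s _
    have h0 : Tendsto (fun N : ℕ => (s : ℝ) * (k / (2 * N))) atTop (𝓝 0) := by
      have : Tendsto (fun N : ℕ => (s : ℝ) * k / 2 / N) atTop (𝓝 0) :=
        tendsto_const_div_atTop_nhds_zero_nat _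
      refine this.congr fun N => by ring
    have h1 : Tendsto (fun N : ℕ => -(α * s * k / 2 / (1 - (s : ℝ) * (k / (2 * N))))) atTop
        (𝓝 (-(α * s * k / 2 / (1 - 0)))) :=
      (tendsto_const_nhds.div (tendsto_const_nhds.sub h0) (by norm_num)).neg
    have h2 := (Real.continuous_exp.tendsto _).comp h1
    have h3 : Real.exp (-(k * α / 2)) ^ s - δ < Real.exp (-(α * s * k / 2 / (1 - 0))) := by
      rw [← Real.exp_nat_mul, show (s : ℝ) * -(k * α / 2) = -(α * s * k / 2 / (1 - 0)) by ring]
      linarith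
    filter_upwards [h2.eventually_const_lt h3, eventually_gt_atTop 0] with N hN hN0
    have hN0' : (N : ℝ) ≠ 0 := by positivity
    refine hN.le.trans (le_of_eq ?_)
    simp only [Function.comp]
    congr 2
    rw [← mul_div_assoc]
    field_simp
  have hup : ∀ s ∈ range (K + 1), ∀ᶠ N : ℕ in atTop,
      Real.exp (-((α * N - K) * (s * (k / (2 * N)) - s ^ 2 * (k ^ 2 / (2 * N ^ 2))))) ≤
        Real.exp (-(k * α / 2)) ^ s + δ := by
    intro s _
    have h0 : Tendsto (fun N : ℕ => (1 : ℝ) / N) atTop (𝓝 0) :=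
      tendsto_const_div_atTop_nhds_zero_nat _
    have h1 : Tendsto (fun N : ℕ => -((α - K * (1 / (N : ℝ))) *
        (s * (k / 2) - s ^ 2 * (k ^ 2 / 2) * (1 / (N : ℝ))))) atTop
        (𝓝 (-((α - K * 0) * (s * (k / 2) - s ^ 2 * (k ^ 2 / 2) * 0)))) :=
      ((tendsto_const_nhds.sub (tendsto_const_nhds.mul h0)).mul
        (tendsto_const_nhds.sub (tendsto_const_nhds.mul h0))).neg
    have h2 := (Real.continuous_exp.tendsto _).comp h1
    have h3 : Real.exp (-((α - K * 0) * (s * (k / 2) - s ^ 2 * (k ^ 2 / 2) * 0))) <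
        Real.exp (-(k * α / 2)) ^ s + δ := by
      rw [← Real.exp_nat_mul, show (s : ℝ) * -(k * α / 2) =
        -((α - K * 0) * (s * (k / 2) - s ^ 2 * (k ^ 2 / 2) * 0)) by ring]
      linarith
    filter_upwards [h2.eventually_lt_const h3, eventually_gt_atTop 0] with N hN hN0
    have hN0' : (N : ℝ) ≠ 0 := by positivity
    refine le_trans (le_of_eq ?_) hN.le
    simp only [Function.comp]
    congr 2
    field_simp
  have hbig : ∀ᶠ N : ℕ in atTop, K * k + k + 2 ≤ N := eventually_ge_atTop _
  filter_upwards [(eventually_all_finset _).mpr hlow, (eventually_all_finset _).mpr hup, hbig]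
    with N h1 h2 h3 S hS hSK m hm1 hm2
  have hN2 : 2 ≤ N := by omega
  have hN0 : (0 : ℝ) < N := by exact_mod_cast (by omega : 0 < N)
  have : Nonempty (SatClause k N) := satClause_nonempty (by nlinarith)
  have hr1 := le_expect_avoids (k := k) (by omega : 0 < N) S
  have hr2 := expect_avoids_le (k := k) hN2 S hS
  have hs := mem_range.mpr (Nat.lt_succ_of_le hSK)
  have h1 := h1 _ hs
  have h2 := h2 _ hs
  set r := 𝔼 c : SatClause k N, avoids S c
  set s : ℝ := (S.card : ℝ)
  set y : ℝ := s * (k / (2 * N)) with hy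
  have hs0 : 0 ≤ s := Nat.cast_nonneg _
  have hy0 : 0 ≤ y := by positivity
  have hsk : s * k + 2 ≤ N := by
    have : S.card * k + 2 ≤ N := by nlinarith [Nat.mul_le_mul_right k hSK]
    have h' : ((S.card * k + 2 : ℕ) : ℝ) ≤ N := Nat.cast_le.mpr this
    push_cast at h'
    exact h'
  have hy1 : y ≤ 1 / 2 := by
    rw [hy, ← mul_div_assoc, div_le_iff₀ (by positivity)]
    linarith
  have hr0 : 0 ≤ r := expect_nonneg fun c _ => avoids_nonneg S c
  rw [abs_le]
  constructor
  · have e1 : Real.exp (-(m * (y / (1 - y)))) ≤ (1 - y) ^ m := by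
      rw [← Real.exp_log (show 0 < 1 - y by linarith), ← Real.exp_nat_mul, Real.exp_log
        (show 0 < 1 - y by linarith)]
      refine Real.exp_le_exp.mpr ?_
      have := Real.one_sub_inv_le_log_of_pos (show 0 < 1 - y by linarith)
      have e2 : 1 - (1 - y)⁻¹ = -(y / (1 - y)) := by
        field_simp [show 1 - y ≠ 0 by linarith]
        ring
      rw [e2] at this
      have := mul_le_mul_of_nonneg_left this (Nat.cast_nonneg m : (0 : ℝ) ≤ m)
      linarith
    have e3 : Real.exp (-(α * N * (y / (1 - y)))) ≤ Real.exp (-(m * (y / (1 - y)))) := by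
      refine Real.exp_le_exp.mpr (neg_le_neg ?_)
      exact mul_le_mul_of_nonneg_right hm2 (div_nonneg hy0 (by linarith))
    have e4 : (1 - y) ^ m ≤ r ^ m := pow_le_pow_left₀ (by linarith) hr1 _
    linarith
  · set z : ℝ := s ^ 2 * (k ^ 2 / (2 * N ^ 2)) with hz
    have hzy : z ≤ y := by
      have : z = y * (s * k / N) := by rw [hz, hy]; field_simp
      rw [this]
      refine mul_le_of_le_one_right hy0 ?_
      rw [div_le_one hN0]
      linarith
    have e1 : r ^ m ≤ Real.exp (-(y - z)) ^ m := by
      refine pow_le_pow_left₀ hr0 ?_ _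
      have := Real.add_one_le_exp (-(y - z))
      linarith
    have e2 : Real.exp (-(y - z)) ^ m ≤ Real.exp (-((α * N - K) * (y - z))) := by
      rw [← Real.exp_nat_mul]
      refine Real.exp_le_exp.mpr ?_
      have := mul_le_mul_of_nonneg_right hm1 (sub_nonneg.mpr hzy)
      linarith
    linarith

/-- The bound `1/2` or `1` on the probability that the literal `l` is false in the absence of one
of its clauses: it is `1/2` if the opposite literal does not occur in the formula. -/
noncomputable def purityWeight {M : ℕ} (F : SatFormula k N M) (l : SatLiteral N) : ℝ :=
  open Classical in if ∃ b, negLit l ∈ (F b).1 then 1 else 1 / 2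

theorem purityWeight_nonneg {M : ℕ} (F : SatFormula k N M) (l : SatLiteral N) :
    0 ≤ purityWeight F l := by
  unfold purityWeight; split_ifs <;> norm_num

theorem purityWeight_le_one {M : ℕ} (F : SatFormula k N M) (l : SatLiteral N) :
    purityWeight F l ≤ 1 := by
  unfold purityWeight; split_ifs <;> norm_num

/-- This form is affine in a product over independent clauses, so that products of purity weights
have computable expectations. -/
theorem purityWeight_eq {M : ℕ} (F : SatFormula k N M) (l : SatLiteral N) :
    purityWeight F l = 1 + -(1 / 2) * ∏ b, avoids {negLit l} (F b) := by
  unfold purityWeight avoids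
  split_ifs with h
  · obtain ⟨b, hb⟩ := h
    rw [prod_eq_zero (mem_univ b) (by simp [hb])]
    ring
  · push Not at h
    rw [prod_eq_one (fun b _ => by simp [h b])]
    norm_num

theorem prod_purityWeight {M : ℕ} (F : SatFormula k N M) (J : Finset (SatLiteral N)) :
    ∏ l ∈ J, purityWeight F l =
      ∑ S ∈ J.powerset, (-(1 / 2) : ℝ) ^ S.card * ∏ b, avoids (S.image negLit) (F b) := by
  simp only [purityWeight_eq]
  rw [prod_one_add]
  refine sum_congr rfl fun S _ => ?_
  rw [prod_mul_distrib, prod_const, Finset.prod_comm]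
  congr 1
  refine prod_congr rfl fun b _ => ?_
  unfold avoids
  by_cases h : ∀ l ∈ S, negLit l ∉ (F b).1
  · rw [prod_eq_one (fun l hl => by simp [h l hl])]
    simp only [mem_image, forall_exists_index, and_imp, forall_apply_eq_imp_iff₂]
    rw [if_pos h]
  · simp only [mem_image, forall_exists_index, and_imp, forall_apply_eq_imp_iff₂]
    rw [if_neg h]
    push Not at h
    obtain ⟨l, hl, hlb⟩ := h
    rw [prod_eq_zero hl (by simp [hlb])]

/-- The revealed clauses contain no negation of a literal in `J`, hence they contribute a factor one
to every term of the expansion; the other clauses are independent. -/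
theorem iidExpect_prod_purityWeight {M : ℕ} [Nonempty (SatClause k N)] (τ : Finset (Fin M))
    (f : SatFormula k N M) (J : Finset (SatLiteral N))
    (hJ : ∀ b ∈ τ, ∀ l ∈ J, negLit l ∉ (f b).1) :
    iidExpect univ (fun G => ∏ l ∈ J, purityWeight (τ.piecewise f G) l) =
      ∑ S ∈ J.powerset, (-(1 / 2) : ℝ) ^ S.card *
        (𝔼 c : SatClause k N, avoids (S.image negLit) c) ^ (M - τ.card) := by
  simp only [prod_purityWeight, iidExpect_sum, iidExpect_const_mul]
  refine sum_congr rfl fun S hS => ?_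
  congr 1
  rw [mem_powerset] at hS
  have h1 : ∀ G : Fin M → SatClause k N,
      ∏ b, avoids (S.image negLit) (τ.piecewise f G b) =
        ∏ b, (if b ∈ τ then 1 else avoids (S.image negLit) (G b)) := by
    intro G
    refine prod_congr rfl fun b _ => ?_
    by_cases hb : b ∈ τ
    · simp only [hb, piecewise_eq_of_mem, if_true]
      unfold avoids
      rw [if_pos]
      intro l hl
      obtain ⟨l', hl', rfl⟩ := mem_image.mp hl
      exact hJ b hb l' (hS hl')
    · simp [hb]
  simp only [h1]
  rw [iidExpect_prod univ (fun b c => if b ∈ τ then 1 else avoids (S.image negLit) c)]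
  have h2 : ∀ b : Fin M, 𝔼 c : SatClause k N,
      (if b ∈ τ then 1 else avoids (S.image negLit) c) =
        if b ∈ τ then 1 else 𝔼 c : SatClause k N, avoids (S.image negLit) c := by
    intro b
    by_cases hb : b ∈ τ <;> simp [hb]
  simp only [h2]
  rw [prod_ite, prod_const_one, one_mul, prod_const]
  congr 1
  rw [filter_not, card_sdiff_of_subset (filter_subset _ _)]
  simp

theorem negLit_injective : Function.Injective (negLit (N := N)) :=
  Function.LeftInverse.injective negLit_negLit

theorem eventually_iidExpect_prod_purityWeight_le (k : ℕ) {α : ℝ} (hα : 0 ≤ α) (K : ℕ) {δ : ℝ}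
    (hδ : 0 < δ) :
    ∀ᶠ N : ℕ in atTop, ∀ (τ : Finset (Fin ⌊α * N⌋₊)) (f : SatFormula k N ⌊α * N⌋₊)
      (J : Finset (SatLiteral N)), τ.card ≤ K → J.card ≤ K →
      Set.InjOn Prod.fst (J : Set (SatLiteral N)) → (∀ b ∈ τ, ∀ l ∈ J, negLit l ∉ (f b).1) →
      iidExpect univ (fun G => ∏ l ∈ J, purityWeight (τ.piecewise f G) l) ≤
        (1 - 1 / 2 * Real.exp (-(k * α / 2))) ^ J.card + δ := by
  -- The extra unit in `K + 1` pays for the rounding in ⌊αN⌋, and the error is shared among the at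
  -- most 2^K subsets of `J`.
  filter_upwards [eventually_expect_avoids_pow k α (K + 1) (δ := δ / 2 ^ K) (by positivity),
    eventually_ge_atTop k] with N hN hkN τ f J hτ hJ hinj hav
  have : Nonempty (SatClause k N) := satClause_nonempty hkN
  rw [iidExpect_prod_purityWeight τ f J hav]
  set e := Real.exp (-(k * α / 2)) with he
  have hτM : τ.card ≤ ⌊α * N⌋₊ := by simpa using card_le_univ τ
  have hterm : ∀ S ∈ J.powerset, (-(1 / 2) : ℝ) ^ S.card *
      (𝔼 c : SatClause k N, avoids (S.image negLit) c) ^ (⌊α * N⌋₊ - τ.card) ≤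
      (-(1 / 2 * e)) ^ S.card + δ / 2 ^ K := by
    intro S hS
    rw [mem_powerset] at hS
    have hcard : (S.image negLit).card = S.card := card_image_of_injective _ negLit_injective
    have h1 : α * N - (K + 1 : ℕ) ≤ ((⌊α * N⌋₊ - τ.card : ℕ) : ℝ) := by
      rw [Nat.cast_sub hτM]
      have := (Nat.lt_floor_add_one (α * N)).le
      have h3 : (τ.card : ℝ) ≤ K := by exact_mod_cast hτ
      push_cast
      linarith
    have h2 : ((⌊α * N⌋₊ - τ.card : ℕ) : ℝ) ≤ α * N :=
      (Nat.cast_le.mpr (Nat.sub_le _ _)).trans (Nat.floor_le (by positivity))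
    have h3 := hN (S.image negLit) (by
        intro l hl l' hl' h
        rw [coe_image] at hl hl'
        obtain ⟨m, hm, rfl⟩ := hl
        obtain ⟨m', hm', rfl⟩ := hl'
        rw [hinj (hS hm) (hS hm') h])
      (by rw [hcard]; exact (card_le_card hS).trans (hJ.trans (Nat.le_succ _))) _ h1 h2
    rw [hcard] at h3
    set r := (𝔼 c : SatClause k N, avoids (S.image negLit) c) ^ (⌊α * N⌋₊ - τ.card)
    have h4 : (-(1 / 2) : ℝ) ^ S.card * (r - e ^ S.card) ≤ δ / 2 ^ K := by
      refine (le_abs_self _).trans ?_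
      rw [abs_mul, abs_pow, abs_neg, abs_of_pos (by norm_num : (0 : ℝ) < 1 / 2)]
      refine (mul_le_of_le_one_left (abs_nonneg _) ?_).trans h3
      exact pow_le_one₀ (by norm_num) (by norm_num)
    have h5 : (-(1 / 2 * e)) ^ S.card = (-(1 / 2) : ℝ) ^ S.card * e ^ S.card := by
      rw [← mul_pow]; ring
    rw [h5]
    linarith
  refine (sum_le_sum hterm).trans ?_
  rw [sum_add_distrib, sum_const, card_powerset, nsmul_eq_mul]
  have h6 : ∑ S ∈ J.powerset, (-(1 / 2 * e)) ^ S.card = (1 - 1 / 2 * e) ^ J.card := by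
    have := prod_one_add (f := fun _ : SatLiteral N => -(1 / 2 * e)) J
    simp only [prod_const] at this
    rw [← this]
    ring
  rw [h6]
  have h7 : (2 : ℝ) ^ J.card ≤ 2 ^ K := pow_le_pow_right₀ (by norm_num) hJ
  have : ((2 ^ J.card : ℕ) : ℝ) * (δ / 2 ^ K) ≤ δ := by
    push_cast
    rw [← mul_div_assoc, div_le_iff₀ (by positivity)]
    nlinarith
  linarith

end AvoidanceProbabilities

/-! ### Expected weight of loose nonbacktracking walks -/

section Walks
open Finset BigOperators

variable {k N M : ℕ}

/-- The literals of the clause `c` on the variable `i` (there is at most one). -/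
def litsOn (c : SatClause k N) (i : Fin N) : Finset (SatLiteral N) := c.1.filter fun m => m.1 = i

theorem mem_litsOn {c : SatClause k N} {i : Fin N} {m : SatLiteral N} :
    m ∈ litsOn c i ↔ m ∈ c.1 ∧ m.1 = i := mem_filter

/-- All nonbacktracking walks of at most `n` further clauses from the clause `b`, entered through
the literal `m` after a walk that has used the variables in `V`, meet the variables used before
only where they have to. -/
def IsLoose (F : SatFormula k N M) : ℕ → Finset (Fin N) → Fin M → SatLiteral N → Prop
  | 0, V, b, m => ∀ l ∈ (F b).1, l.1 ∈ V → l = m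
  | n + 1, V, b, m => (∀ l ∈ (F b).1, l.1 ∈ V → l = m) ∧
      ∀ l ∈ (F b).1, l ≠ m → ∀ b', b' ≠ b → ∀ m' ∈ (F b').1, m'.1 = l.1 →
        IsLoose F n (V ∪ clauseVars (F b)) b' m'

theorem IsLoose.entry {F : SatFormula k N M} {n : ℕ} {V : Finset (Fin N)} {b : Fin M}
    {m : SatLiteral N} (h : IsLoose F n V b m) : ∀ l ∈ (F b).1, l.1 ∈ V → l = m := by
  cases n with
  | zero => exact h
  | succ n => exact h.1

/-- All nonbacktracking walks of at most `n + 1` clauses after the clause `a` are loose. -/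
def IsLooseAt (F : SatFormula k N M) (n : ℕ) (a : Fin M) : Prop :=
  ∀ l ∈ (F a).1, ∀ b, b ≠ a → ∀ m ∈ (F b).1, m.1 = l.1 → IsLoose F n (clauseVars (F a)) b m

/-- The total weight of the nonbacktracking walks of `n` further clauses from the clause `b`,
entered through `m`: the weight of a walk is the product, over its clauses but the last, of the
purity weights of the literals other than the one through which the clause is entered. -/
noncomputable def walkWeight (F : SatFormula k N M) : ℕ → Fin M → SatLiteral N → ℝ
  | 0, _, _ => 1
  | n + 1, b, m => ∑ l ∈ (F b).1.erase m, ∑ b' ∈ univ.erase b,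
      ∑ m' ∈ litsOn (F b') l.1,
        (∏ l' ∈ (F b).1.erase m, purityWeight F l') * walkWeight F n b' m'

/-- The total weight of the nonbacktracking walks of `n + 1` clauses after the clause `a`. -/
noncomputable def walkWeightAt (F : SatFormula k N M) (n : ℕ) (a : Fin M) : ℝ :=
  ∑ l ∈ (F a).1, ∑ b ∈ univ.erase a, ∑ m ∈ litsOn (F b) l.1, walkWeight F n b m

theorem walkWeight_nonneg (F : SatFormula k N M) (n : ℕ) (b : Fin M) (m : SatLiteral N) :
    0 ≤ walkWeight F n b m := by
  induction n generalizing b m with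
  | zero => exact zero_le_one
  | succ n ih =>
    exact sum_nonneg fun l _ => sum_nonneg fun b' _ => sum_nonneg fun m' _ =>
      mul_nonneg (prod_nonneg fun l' _ => purityWeight_nonneg F l') (ih b' m')

theorem walkWeightAt_nonneg (F : SatFormula k N M) (n : ℕ) (a : Fin M) :
    0 ≤ walkWeightAt F n a :=
  sum_nonneg fun _ _ => sum_nonneg fun _ _ => sum_nonneg fun _ _ => walkWeight_nonneg F n _ _

open Classical in
/-- The weight of the walks, counted only if all the walks are loose. -/
noncomputable def looseWeight (F : SatFormula k N M) (n : ℕ) (V : Finset (Fin N)) (b : Fin M)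
    (m : SatLiteral N) : ℝ := if IsLoose F n V b m then walkWeight F n b m else 0

theorem looseWeight_nonneg (F : SatFormula k N M) (n : ℕ) (V : Finset (Fin N)) (b : Fin M)
    (m : SatLiteral N) : 0 ≤ looseWeight F n V b m := by
  unfold looseWeight; split_ifs
  exacts [walkWeight_nonneg F n b m, le_rfl]

/-- The loose weight of the continuations, through the literals in `L`, of a walk ending at `b`. -/
noncomputable def looseWeightCont (F : SatFormula k N M) (n : ℕ) (V : Finset (Fin N)) (b : Fin M)
    (L : Finset (SatLiteral N)) : ℝ :=
  ∑ l ∈ L, ∑ b' ∈ univ.erase b, ∑ m' ∈ litsOn (F b') l.1,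
    looseWeight F n V b' m'

/-- Looseness passes to the continuations of a walk. Dropping the requirement that all of them be
loose at once only increases the sum, which then can be averaged term by term. -/
theorem looseWeight_succ_le (F : SatFormula k N M) (n : ℕ) (V : Finset (Fin N)) (b : Fin M)
    (m : SatLiteral N) :
    looseWeight F (n + 1) V b m ≤ (∏ l' ∈ (F b).1.erase m, purityWeight F l') *
      looseWeightCont F n (V ∪ clauseVars (F b)) b ((F b).1.erase m) := by
  unfold looseWeightCont
  have hp : 0 ≤ ∏ l' ∈ (F b).1.erase m, purityWeight F l' :=
    prod_nonneg fun l' _ => purityWeight_nonneg F l'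
  by_cases h : IsLoose F (n + 1) V b m
  · rw [looseWeight, if_pos h, walkWeight]
    simp only [mul_sum]
    refine le_of_eq (sum_congr rfl fun l hl => sum_congr rfl fun b' hb' => sum_congr rfl
      fun m' hm' => ?_)
    rw [mem_erase] at hl hb'
    rw [mem_litsOn] at hm'
    rw [looseWeight, if_pos (h.2 l hl.2 hl.1 b' hb'.1 m' hm'.1 hm'.2)]
  · rw [looseWeight, if_neg h]
    exact mul_nonneg hp (sum_nonneg fun _ _ => sum_nonneg fun _ _ => sum_nonneg fun _ _ =>
      looseWeight_nonneg _ _ _ _ _)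

/-- A sum over the occurrences of the variable of `l` in a formula with partially known clauses. -/
theorem iidExpect_sum_continuations_le [Nonempty (SatClause k N)] (τ : Finset (Fin M))
    (f : SatFormula k N M) (b : Fin M) (l : SatLiteral N)
    (hl : ∀ b' ∈ τ, b' ≠ b → l.1 ∉ clauseVars (f b'))
    (φ : SatFormula k N M → Fin M → SatLiteral N → ℝ)
    (B : SatLiteral N → SatClause k N → ℝ) (hB : ∀ m c, 0 ≤ B m c)
    (h : ∀ b' ∉ τ, ∀ c : SatClause k N, ∀ m ∈ c.1, m.1 = l.1 →
      iidExpect univ (fun G => φ ((insert b' τ).piecewise (Function.update f b' c) G) b' m) ≤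
        B m c) :
    iidExpect univ (fun G => ∑ b' ∈ univ.erase b,
      ∑ m ∈ litsOn ((τ.piecewise f G) b') l.1, φ (τ.piecewise f G) b' m) ≤
    M * ((𝔼 c : SatClause k N, if l ∈ c.1 then B l c else 0) +
      𝔼 c : SatClause k N, if negLit l ∈ c.1 then B (negLit l) c else 0) := by
  rw [← expect_add_distrib]
  set R := 𝔼 c : SatClause k N, ((if l ∈ c.1 then B l c else 0) +
    if negLit l ∈ c.1 then B (negLit l) c else 0) with hR
  have hR0 : 0 ≤ R := expect_nonneg fun c _ => by
    have := hB l c; have := hB (negLit l) c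
    split_ifs <;> linarith
  rw [iidExpect_sum]
  have hterm : ∀ b' ∈ univ.erase b, iidExpect univ (fun G =>
      ∑ m ∈ litsOn ((τ.piecewise f G) b') l.1, φ (τ.piecewise f G) b' m) ≤
      R := by
    intro b' hb'
    rw [mem_erase] at hb'
    by_cases hτ : b' ∈ τ
    · refine le_trans (le_of_eq ?_) hR0
      refine (iidExpect_congr fun G _ => ?_).trans (iidExpect_const univ_nonempty 0)
      refine sum_eq_zero fun m hm => absurd ?_ (hl b' hτ hb'.1)
      rw [mem_litsOn, piecewise_eq_of_mem _ _ _ hτ] at hm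
      rw [← hm.2]
      exact fst_mem_clauseVars hm.1
    · rw [iidExpect_piecewise_reveal univ univ_nonempty hτ f (fun F =>
        ∑ m ∈ litsOn (F b') l.1, φ F b' m)]
      refine expect_le_expect fun c _ => ?_
      simp only [piecewise_eq_of_mem _ _ _ (mem_insert_self b' τ), Function.update_self]
      rw [iidExpect_sum]
      have h1 : ∑ m ∈ litsOn c l.1, iidExpect univ (fun G =>
          φ ((insert b' τ).piecewise (Function.update f b' c) G) b' m) ≤
          ∑ m ∈ litsOn c l.1, B m c :=
        sum_le_sum fun m hm => h b' hτ c m (mem_litsOn.mp hm).1 (mem_litsOn.mp hm).2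
      refine h1.trans ?_
      have h2 : litsOn c l.1 ⊆
          ({l, negLit l} : Finset (SatLiteral N)).filter (fun m => m ∈ c.1) := by
        intro m hm
        rw [mem_litsOn] at hm
        simp only [mem_filter, mem_insert, mem_singleton]
        exact ⟨eq_or_eq_negLit hm.2, hm.1⟩
      refine (sum_le_sum_of_subset_of_nonneg h2 fun m _ _ => hB m c).trans (le_of_eq ?_)
      rw [sum_filter, sum_pair (negLit_ne l).symm]
  refine (sum_le_sum hterm).trans ?_
  rw [sum_const, nsmul_eq_mul]
  refine mul_le_mul_of_nonneg_right ?_ hR0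
  exact_mod_cast (card_le_univ _).trans (by simp)

/-- The bound on expected weights of loose walks. -/
noncomputable def walkBound (k : ℕ) (μ ρ δ : ℝ) (n q : ℕ) : ℝ :=
  ρ ^ q * (μ * (k - 1) * ρ ^ (k - 2) * (1 + ρ)) ^ n + δ * (2 * μ * (k - 1)) ^ n

/-- The bound `walkBound` on the expected loose weight of the walks of `n` further clauses, given
that at most `K` clauses and purity weights are involved. -/
def LooseWeightBound (k N M K : ℕ) (μ ρ δ : ℝ) (n : ℕ) : Prop :=
  ∀ (τ : Finset (Fin M)) (f : SatFormula k N M) (J : Finset (SatLiteral N))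
    (V : Finset (Fin N)) (b : Fin M) (m : SatLiteral N), τ.card + n ≤ K → J.card + n * k ≤ K →
    b ∈ τ → (∀ b' ∈ τ, b' ≠ b → clauseVars (f b') ⊆ V) → (∀ l ∈ J, l.1 ∈ V) → m ∈ (f b).1 →
    Set.InjOn Prod.fst (J : Set (SatLiteral N)) → (∀ b ∈ τ, ∀ l ∈ J, negLit l ∉ (f b).1) →
    iidExpect univ (fun G => (∏ l ∈ J, purityWeight (τ.piecewise f G) l) *
      looseWeight (τ.piecewise f G) n V b m) ≤ walkBound k μ ρ δ n J.card

theorem walkBound_nonneg (hk : 2 ≤ k) {μ ρ δ : ℝ} (hμ : 0 ≤ μ) (hρ : 0 ≤ ρ) (hδ : 0 ≤ δ)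
    (n q : ℕ) : 0 ≤ walkBound k μ ρ δ n q := by
  have hk1 : (0 : ℝ) ≤ k - 1 := by
    have : (2 : ℝ) ≤ k := by exact_mod_cast hk
    linarith
  unfold walkBound
  positivity

/-- The origin of the factor 1 + ρ. If the next clause contains `l` itself, the purity of `l` is
still undecided and its weight stays in the product. If it contains the negation, `l` is no longer
pure and its weight is bounded by one, so `l` leaves `J`. The mean number of clauses is at most `μ`
in either case. -/
theorem LooseWeightBound.cont (hk : 2 ≤ k) [Nonempty (SatClause k N)] (hN : 0 < N) {K n : ℕ}
    {μ ρ δ : ℝ} (hμ : M * (k / (2 * N) : ℝ) ≤ μ) (hρ : 0 ≤ ρ) (hδ : 0 ≤ δ)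
    (ih : LooseWeightBound k N M K μ ρ δ n)
    (τ : Finset (Fin M)) (f : SatFormula k N M) (J L : Finset (SatLiteral N))
    (V : Finset (Fin N)) (b : Fin M) (hτK : τ.card + (n + 1) ≤ K) (hJK : J.card + n * k ≤ K)
    (hτV : ∀ b' ∈ τ, clauseVars (f b') ⊆ V) (hJV : ∀ l ∈ J, l.1 ∈ V)
    (hJinj : Set.InjOn Prod.fst (J : Set (SatLiteral N)))
    (hJτ : ∀ b ∈ τ, ∀ l ∈ J, negLit l ∉ (f b).1) (hLJ : ∀ l ∈ L, negLit l ∉ J)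
    (hLτ : ∀ b' ∈ τ, b' ≠ b → ∀ l ∈ L, l.1 ∉ clauseVars (f b')) :
    iidExpect univ (fun G => (∏ l ∈ J, purityWeight (τ.piecewise f G) l) *
      looseWeightCont (τ.piecewise f G) n V b L) ≤
      ∑ l ∈ L, μ * (walkBound k μ ρ δ n J.card + walkBound k μ ρ δ n (J.erase l).card) := by
  have hμ0 : 0 ≤ μ := le_trans (by positivity) hμ
  have hB0 : ∀ q, 0 ≤ walkBound k μ ρ δ n q := fun q => walkBound_nonneg hk hμ0 hρ hδ n q
  simp only [looseWeightCont, mul_sum]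
  rw [iidExpect_sum]
  refine sum_le_sum fun l hl => ?_
  refine (iidExpect_sum_continuations_le τ f b l (fun b' hb' hne => hLτ b' hb' hne l hl)
    (fun F b' m' => (∏ l ∈ J, purityWeight F l) * looseWeight F n V b' m')
    (fun m _ => if m = l then walkBound k μ ρ δ n J.card else
      walkBound k μ ρ δ n (J.erase l).card) (fun m _ => by split_ifs <;> exact hB0 _)
    ?_).trans ?_
  · intro b' hb' c m' hm' hml
    set f' := Function.update f b' c with hf'
    have hfb' : f' b' = c := Function.update_self ..
    have hfne : ∀ b'' ∈ τ, f' b'' = f b'' := fun b'' h =>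
      Function.update_of_ne (by rintro rfl; exact hb' h) _ _
    have hR0 : 0 ≤ (if m' = l then walkBound k μ ρ δ n J.card else
      walkBound k μ ρ δ n (J.erase l).card) := by split_ifs <;> exact hB0 _
    by_cases hent : ∀ l' ∈ c.1, l'.1 ∈ V → l' = m'
    · have hsub : ∀ J' ⊆ J, negLit m' ∉ J' →
          iidExpect univ (fun G => (∏ l ∈ J', purityWeight ((insert b' τ).piecewise f' G) l) *
            looseWeight ((insert b' τ).piecewise f' G) n V b' m') ≤
            walkBound k μ ρ δ n J'.card := by
        intro J' hJ' hmJ'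
        refine ih (insert b' τ) f' J' V b' m' ?_ ?_ (mem_insert_self _ _) ?_
          (fun l hl => hJV l (hJ' hl)) (by rwa [hfb']) (hJinj.mono hJ') ?_
        · have := card_insert_le b' τ
          omega
        · have := card_le_card hJ'
          omega
        · intro b'' hb'' hne
          have := mem_of_mem_insert_of_ne hb'' hne
          rw [hfne _ this]
          exact hτV _ this
        · intro b'' hb'' l'' hl''
          rcases mem_insert.mp hb'' with rfl | h
          · rw [hfb']
            intro hneg
            have := hent _ hneg (hJV l'' (hJ' hl''))
            apply hmJ'
            rw [← this, negLit_negLit]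
            exact hl''
          · rw [hfne _ h]
            exact hJτ _ h _ (hJ' hl'')
      split_ifs with hml'
      · subst hml'
        exact hsub J Subset.rfl (hLJ m' hl)
      · have hm'l : m' = negLit l := (eq_or_eq_negLit hml).resolve_left hml'
        refine le_trans (iidExpect_mono fun G _ => ?_) (hsub (J.erase l) (erase_subset _ _)
          (by rw [hm'l, negLit_negLit]; exact notMem_erase _ _))
        refine mul_le_mul_of_nonneg_right ?_ (looseWeight_nonneg _ _ _ _ _)
        by_cases hlJ : l ∈ J
        · rw [← mul_prod_erase J _ hlJ]
          exact mul_le_of_le_one_left (prod_nonneg fun l' _ => purityWeight_nonneg _ l')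
            (purityWeight_le_one _ _)
        · rw [erase_eq_of_notMem hlJ]
    · refine le_trans (le_of_eq ?_) hR0
      refine (iidExpect_congr fun G _ => ?_).trans (iidExpect_const univ_nonempty 0)
      rw [looseWeight, if_neg, mul_zero]
      intro hL
      apply hent
      have := hL.entry
      rwa [piecewise_eq_of_mem _ _ _ (mem_insert_self b' τ), hfb'] at this
  · have e : ∀ (l : SatLiteral N) (x : ℝ), 𝔼 c : SatClause k N, (if l ∈ c.1 then x else 0) =
        k / (2 * N) * x := fun l x => by
      rw [← expect_mem hN l, expect_mul]
      simp
    simp only [if_true, negLit_ne, if_false]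
    rw [e, e, ← mul_add, ← mul_assoc]
    exact mul_le_mul_of_nonneg_right hμ (add_nonneg (hB0 _) (hB0 _))

/-- The clauses of a walk are revealed one by one, and their purity weights are collected in `J`
without being evaluated. Looseness ensures that the literals of `J` lie on distinct variables and
that no revealed clause contains the negation of one that is kept, so `hω` can evaluate the whole
product when the walk ends. -/
theorem looseWeightBound (hk : 2 ≤ k) [Nonempty (SatClause k N)] (hN : 0 < N) {K : ℕ}
    {μ ρ δ : ℝ} (hμ : M * (k / (2 * N) : ℝ) ≤ μ) (hρ : 0 ≤ ρ) (hδ : 0 ≤ δ)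
    (hω : ∀ (τ : Finset (Fin M)) (f : SatFormula k N M) (J : Finset (SatLiteral N)),
      τ.card ≤ K → J.card ≤ K → Set.InjOn Prod.fst (J : Set (SatLiteral N)) →
      (∀ b ∈ τ, ∀ l ∈ J, negLit l ∉ (f b).1) →
      iidExpect univ (fun G => ∏ l ∈ J, purityWeight (τ.piecewise f G) l) ≤ ρ ^ J.card + δ)
    (n : ℕ) : LooseWeightBound k N M K μ ρ δ n := by
  have hμ0 : 0 ≤ μ := le_trans (by positivity) hμ
  induction n with
  | zero =>
    intro τ f J V b m hτK hJK hb hτV hJV hm hJinj hJτ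
    refine le_trans (iidExpect_mono fun G _ => ?_)
      ((hω τ f J (by omega) (by omega) hJinj hJτ).trans (le_of_eq (by simp [walkBound])))
    refine mul_le_of_le_one_right (prod_nonneg fun l _ => purityWeight_nonneg _ l) ?_
    unfold looseWeight
    split_ifs
    · exact le_rfl
    · norm_num
  | succ n ih =>
    intro τ f J V b m hτK hJK hb hτV hJV hm hJinj hJτ
    -- Otherwise the revealed clause `b` already returns to the used variables, and the loose weight
    -- vanishes.
    by_cases hent : ∀ l' ∈ (f b).1, l'.1 ∈ V → l' = m
    · have hFb : ∀ G, τ.piecewise f G b = f b := fun G => piecewise_eq_of_mem _ _ _ hb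
      set L := (f b).1.erase m with hL
      have hLV : ∀ l ∈ L, l.1 ∉ V := fun l hl h =>
        (mem_erase.mp hl).1 (hent l (mem_erase.mp hl).2 h)
      have hdisj : Disjoint J L := disjoint_left.mpr fun l hlJ hlL => hLV l hlL (hJV l hlJ)
      have hLcard : L.card = k - 1 := by rw [hL, card_erase_of_mem hm, (f b).2.1]
      have hunion : (J ∪ L).card = J.card + (k - 1) := by rw [card_union_of_disjoint hdisj, hLcard]
      have hk' : n * k + k = (n + 1) * k := by ring
      have hstep := LooseWeightBound.cont hk hN hμ hρ hδ ih τ f (J ∪ L) L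
        (V ∪ clauseVars (f b)) b (by omega) (by omega) ?_ ?_ ?_ ?_ ?_ ?_
      · refine le_trans (iidExpect_mono fun G _ => ?_) (hstep.trans ?_)
        · rw [prod_union hdisj, mul_assoc]
          refine mul_le_mul_of_nonneg_left ?_ (prod_nonneg fun l _ => purityWeight_nonneg _ l)
          have := looseWeight_succ_le (τ.piecewise f G) n V b m
          rwa [hFb] at this
        · have he : ∀ l ∈ L, ((J ∪ L).erase l).card = J.card + (k - 2) := by
            intro l hl
            rw [card_erase_of_mem (mem_union_right _ hl), hunion]
            omega
          rw [sum_congr rfl fun l hl => by rw [he l hl], sum_const, hLcard, hunion, nsmul_eq_mul,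
            Nat.cast_sub (by omega)]
          obtain ⟨j, rfl⟩ := Nat.exists_eq_add_of_le hk
          simp only [walkBound, show 2 + j - 1 = j + 1 by omega, show 2 + j - 2 = j by omega]
          refine le_of_eq ?_
          push_cast
          ring
      · intro b' hb'
        by_cases hne : b' = b
        · subst hne
          exact subset_union_right
        · exact (hτV b' hb' hne).trans subset_union_left
      · intro l hl
        rcases mem_union.mp hl with h | h
        · exact mem_union_left _ (hJV l h)
        · exact mem_union_right _ (fst_mem_clauseVars (mem_erase.mp h).2)
      · intro l hl l' hl' h
        rw [mem_coe, mem_union] at hl hl'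
        rcases hl with h1 | h1 <;> rcases hl' with h2 | h2
        · exact hJinj h1 h2 h
        · exact absurd (h ▸ hJV l h1) (hLV l' h2)
        · exact absurd (h.symm ▸ hJV l' h2) (hLV l h1)
        · exact (f b).eq_of_fst_eq (mem_erase.mp h1).2 (mem_erase.mp h2).2 h
      · intro b' hb' l hl
        rcases mem_union.mp hl with h | h
        · exact hJτ b' hb' l h
        · by_cases hne : b' = b
          · subst hne
            exact (f b').negLit_notMem (mem_erase.mp h).2
          · exact fun hc => hLV l h (hτV b' hb' hne (mem_clauseVars.mpr ⟨_, hc, rfl⟩))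
      · intro l hl h
        rcases mem_union.mp h with h | h
        · exact hLV l hl (by simpa using hJV _ h)
        · exact (f b).negLit_notMem (mem_erase.mp hl).2 (mem_erase.mp h).2
      · intro b' hb' hne l hl h
        exact hLV l hl (hτV b' hb' hne h)
    · refine le_trans (le_of_eq ?_) (walkBound_nonneg hk hμ0 hρ hδ _ _)
      refine (iidExpect_congr fun G _ => ?_).trans (iidExpect_const univ_nonempty 0)
      rw [looseWeight, if_neg, mul_zero]
      intro hL
      apply hent
      have := hL.entry
      rwa [piecewise_eq_of_mem _ _ _ hb] at this

open Classical in
theorem iidExpect_looseWeightAt_le (hk : 2 ≤ k) [Nonempty (SatClause k N)] (hN : 0 < N) {K n : ℕ}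
    {μ ρ δ : ℝ} (hμ : M * (k / (2 * N) : ℝ) ≤ μ) (hρ : 0 ≤ ρ) (hδ : 0 ≤ δ)
    (ih : LooseWeightBound k N M K μ ρ δ n) (hK : n + 2 ≤ K) (hK' : n * k ≤ K) (a : Fin M) :
    iidExpect univ (fun F : SatFormula k N M =>
      if IsLooseAt F n a then walkWeightAt F n a else 0) ≤
      2 * k * μ * walkBound k μ ρ δ n 0 := by
  obtain ⟨f⟩ : Nonempty (SatFormula k N M) := inferInstance
  have h := iidExpect_piecewise_reveal univ univ_nonempty (notMem_empty a) f
    (fun F : SatFormula k N M => if IsLooseAt F n a then walkWeightAt F n a else 0)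
  simp only [piecewise_empty] at h
  rw [h]
  refine expect_le univ_nonempty fun c _ => ?_
  have hfa : ∀ G, (insert a ∅ : Finset (Fin M)).piecewise (Function.update f a c) G a = c :=
    fun G => by simp
  -- The root clause carries no purity weight of its own, so `J` starts empty, and all of its `k`
  -- literals may be left through.
  have hstep := LooseWeightBound.cont hk hN hμ hρ hδ ih (insert a ∅) (Function.update f a c) ∅
    c.1 (clauseVars c) a (by simp; omega) (by simpa using hK') (by simp) (by simp)
    (by simp) (by simp) (by simp) (by simp)
  refine le_trans (iidExpect_mono fun G _ => ?_) (hstep.trans ?_)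
  · simp only [prod_empty, one_mul]
    split_ifs with hl
    · unfold walkWeightAt looseWeightCont
      rw [hfa G]
      refine le_of_eq (sum_congr rfl fun l hl' => sum_congr rfl fun b' hb' => sum_congr rfl
        fun m' hm' => ?_)
      rw [mem_litsOn] at hm'
      have := hl l (by rwa [hfa G]) b' (mem_erase.mp hb').1 m' hm'.1 hm'.2
      rw [hfa G] at this
      rw [looseWeight, if_pos this]
    · exact sum_nonneg fun _ _ => sum_nonneg fun _ _ => sum_nonneg fun _ _ =>
        looseWeight_nonneg _ _ _ _ _
  · simp only [erase_empty, card_empty]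
    rw [sum_const, c.2.1, nsmul_eq_mul]
    refine le_of_eq ?_
    ring

end Walks

/-! ### Neighbourhoods that are not loose have probability O(1/N) -/

section NonLoose
open Finset BigOperators

variable {k N M : ℕ}

open Classical in
/-- The indicator that some walk is not loose. -/
noncomputable def nonLoose (F : SatFormula k N M) (n : ℕ) (V : Finset (Fin N)) (b : Fin M)
    (m : SatLiteral N) : ℝ := if IsLoose F n V b m then 0 else 1

theorem nonLoose_nonneg (F : SatFormula k N M) (n : ℕ) (V : Finset (Fin N)) (b : Fin M)
    (m : SatLiteral N) : 0 ≤ nonLoose F n V b m := by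
  unfold nonLoose; split_ifs <;> norm_num

theorem nonLoose_le_one (F : SatFormula k N M) (n : ℕ) (V : Finset (Fin N)) (b : Fin M)
    (m : SatLiteral N) : nonLoose F n V b m ≤ 1 := by
  unfold nonLoose; split_ifs <;> norm_num

/-- The number of continuations through `L`, of a walk ending at `b`, that are not loose. -/
noncomputable def nonLooseCont (F : SatFormula k N M) (n : ℕ) (V : Finset (Fin N)) (b : Fin M)
    (L : Finset (SatLiteral N)) : ℝ :=
  ∑ l ∈ L, ∑ b' ∈ univ.erase b, ∑ m' ∈ litsOn (F b') l.1, nonLoose F n V b' m'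

theorem nonLooseCont_nonneg (F : SatFormula k N M) (n : ℕ) (V : Finset (Fin N)) (b : Fin M)
    (L : Finset (SatLiteral N)) : 0 ≤ nonLooseCont F n V b L :=
  sum_nonneg fun _ _ => sum_nonneg fun _ _ => sum_nonneg fun _ _ => nonLoose_nonneg _ _ _ _ _

theorem le_sum_of_le {κ : Type*} {s : Finset κ} {g : κ → ℝ} (hg : ∀ i, 0 ≤ g i) {i : κ}
    (hi : i ∈ s) {x : ℝ} (hx : x ≤ g i) : x ≤ ∑ j ∈ s, g j :=
  hx.trans (single_le_sum (fun j _ => hg j) hi)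

theorem one_le_nonLooseCont (F : SatFormula k N M) {n : ℕ} {V : Finset (Fin N)} {b : Fin M}
    {L : Finset (SatLiteral N)} {l : SatLiteral N} (hl : l ∈ L) {b' : Fin M} (hb' : b' ≠ b)
    {m : SatLiteral N} (hm : m ∈ (F b').1) (hml : m.1 = l.1) (h : ¬ IsLoose F n V b' m) :
    1 ≤ nonLooseCont F n V b L := by
  have h1 : nonLoose F n V b' m = 1 := by rw [nonLoose, if_neg h]
  unfold nonLooseCont
  refine le_sum_of_le (fun _ => sum_nonneg fun _ _ => sum_nonneg fun _ _ =>
    nonLoose_nonneg _ _ _ _ _) hl ?_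
  refine le_sum_of_le (fun _ => sum_nonneg fun _ _ => nonLoose_nonneg _ _ _ _ _)
    (mem_erase.mpr ⟨hb', mem_univ b'⟩) ?_
  exact le_sum_of_le (fun _ => nonLoose_nonneg _ _ _ _ _) (mem_litsOn.mpr ⟨hm, hml⟩) h1.ge

/-- `N` times a bound on the probability that a walk has a continuation that is not loose. -/
def nonLooseBound (k : ℕ) (α : ℝ) : ℕ → ℕ → ℝ
  | 0, _ => 0
  | n + 1, v => k * α * (2 * (v + k) * k ^ 2 + k * nonLooseBound k α n (v + k))

theorem nonLooseBound_nonneg {α : ℝ} (hα : 0 ≤ α) (n v : ℕ) : 0 ≤ nonLooseBound k α n v := by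
  induction n generalizing v with
  | zero => exact le_rfl
  | succ n ih =>
    have := ih (v + k)
    unfold nonLooseBound
    positivity

-- A clause through `l` that also meets another variable of `W` has two prescribed variables, which
-- costs k²/N² for each element of `W` (two literals of probability at most k²/(2N²) each). The
-- constant `D` stands for what can go wrong later, and needs only that the clause contains `l`.
open Classical in
theorem expect_mem_and_entry_le (hN : 2 ≤ N) [Nonempty (SatClause k N)] (W : Finset (Fin N))
    (l : SatLiteral N) {D : ℝ} :
    𝔼 c : SatClause k N, (if l ∈ c.1 then
      (if ∀ l' ∈ c.1, l'.1 ∈ W → l' = l then 0 else 1) + D else 0) ≤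
    W.card * (k ^ 2 / N ^ 2) + k / (2 * N) * D := by
  have h : ∀ c : SatClause k N, (if l ∈ c.1 then
      (if ∀ l' ∈ c.1, l'.1 ∈ W → l' = l then 0 else 1) + D else 0) ≤
      (∑ l' ∈ W.erase l.1 ×ˢ univ, if l ∈ c.1 ∧ l' ∈ c.1 then (1 : ℝ) else 0) +
        (if l ∈ c.1 then (1 : ℝ) else 0) * D := by
    intro c
    have hs : (0 : ℝ) ≤ ∑ l' ∈ W.erase l.1 ×ˢ univ, if l ∈ c.1 ∧ l' ∈ c.1 then (1 : ℝ) else 0 :=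
      sum_nonneg fun _ _ => by split_ifs <;> norm_num
    split_ifs with h1 h2
    · rw [one_mul]
      linarith
    · rw [one_mul]
      refine add_le_add_left ?_ D
      push Not at h2
      obtain ⟨l', hl', hW, hne⟩ := h2
      have := single_le_sum (f := fun l' => if l ∈ c.1 ∧ l' ∈ c.1 then (1 : ℝ) else 0)
        (fun _ _ => by split_ifs <;> norm_num)
        (show l' ∈ W.erase l.1 ×ˢ univ from mem_product.mpr ⟨mem_erase.mpr
          ⟨fun h => hne (c.eq_of_fst_eq hl' h1 h), hW⟩, mem_univ _⟩)
      simp only [h1, hl', true_and, if_true] at this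
      simpa [h1] using this
    · linarith
  refine (expect_le_expect fun c _ => h c).trans ?_
  rw [expect_add_distrib, expect_sum_comm, ← expect_mul, expect_mem (by omega)]
  gcongr
  have hp : ∀ l' ∈ W.erase l.1 ×ˢ (univ : Finset Bool), 𝔼 c : SatClause k N,
      (if l ∈ c.1 ∧ l' ∈ c.1 then (1 : ℝ) else 0) ≤ k ^ 2 / (2 * N ^ 2) := fun l' hl' =>
    expect_mem_pair hN (mem_erase.mp (mem_product.mp hl').1).1
  refine (sum_le_sum hp).trans ?_
  rw [sum_const, card_product, nsmul_eq_mul]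
  have hc : ((W.erase l.1).card : ℝ) ≤ W.card := by exact_mod_cast card_erase_le
  have hN0 : (0 : ℝ) < N := by exact_mod_cast (by omega : 0 < N)
  simp only [card_univ, Fintype.card_bool]
  push_cast
  calc ((W.erase l.1).card : ℝ) * 2 * (k ^ 2 / (2 * N ^ 2)) =
        (W.erase l.1).card * (k ^ 2 / N ^ 2) := by field_simp
    _ ≤ _ := by gcongr

/-- The bound on the probability that some walk is not loose. -/
def NonLooseBound (k N M : ℕ) (α : ℝ) (n : ℕ) : Prop :=
  ∀ (τ : Finset (Fin M)) (f : SatFormula k N M) (V : Finset (Fin N)) (b : Fin M)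
    (m : SatLiteral N), b ∈ τ → (∀ b' ∈ τ, b' ≠ b → clauseVars (f b') ⊆ V) →
    (∀ l ∈ (f b).1, l.1 ∈ V → l = m) →
    iidExpect univ (fun G => nonLoose (τ.piecewise f G) n V b m) ≤ nonLooseBound k α n V.card / N

theorem nonLooseBound_mono {α : ℝ} (hα : 0 ≤ α) (n : ℕ) {v w : ℕ} (h : v ≤ w) :
    nonLooseBound k α n v ≤ nonLooseBound k α n w := by
  induction n generalizing v w with
  | zero => exact le_rfl
  | succ n ih =>
    have := ih (Nat.add_le_add_right h k)
    unfold nonLooseBound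
    gcongr

/-- There are at most αN candidates for the next clause. It either returns at once to the used
variables, with probability O(1/N²), or, with probability O(1/N), it is entered properly and
looseness fails afterwards, which by induction has conditional probability O(1/N). Both
contributions sum to O(1/N). -/
theorem NonLooseBound.cont (hN : 2 ≤ N) [Nonempty (SatClause k N)] {α : ℝ} (hα : 0 ≤ α)
    (hM : (M : ℝ) ≤ α * N) {n : ℕ} (ih : NonLooseBound k N M α n)
    (τ : Finset (Fin M)) (f : SatFormula k N M) (L : Finset (SatLiteral N))
    (V : Finset (Fin N)) (b : Fin M) (hLk : L.card ≤ k) {v : ℕ} (hV : V.card ≤ v + k)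
    (hτV : ∀ b' ∈ τ, clauseVars (f b') ⊆ V)
    (hLτ : ∀ b' ∈ τ, b' ≠ b → ∀ l ∈ L, l.1 ∉ clauseVars (f b')) :
    iidExpect univ (fun G => nonLooseCont (τ.piecewise f G) n V b L) ≤
      nonLooseBound k α (n + 1) v / N := by
  classical
  have hN0 : (0 : ℝ) < N := by exact_mod_cast (by omega : 0 < N)
  set D : ℝ := nonLooseBound k α n V.card / N with hD
  have hD0 : 0 ≤ D := div_nonneg (nonLooseBound_nonneg hα _ _) hN0.le
  have hD1 : D ≤ nonLooseBound k α n (v + k) / N := by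
    rw [hD]
    gcongr
    exact nonLooseBound_mono hα n hV
  have hterm : ∀ l ∈ L, iidExpect univ (fun G => ∑ b' ∈ univ.erase b,
      ∑ m' ∈ litsOn (τ.piecewise f G b') l.1,
        nonLoose (τ.piecewise f G) n V b' m') ≤
      M * (2 * ((v + k : ℕ) * (k ^ 2 / N ^ 2) + k / (2 * N) * D)) := by
    intro l hl
    refine (iidExpect_sum_continuations_le τ f b l (fun b' hb' hne => hLτ b' hb' hne l hl)
      (fun F b' m' => nonLoose F n V b' m')
      (fun m c => (if ∀ l' ∈ c.1, l'.1 ∈ V → l' = m then 0 else 1) + D)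
      (fun m c => by split_ifs <;> linarith) ?_).trans ?_
    · intro b' hb' c m' hm' hml
      split_ifs with hent
      · rw [zero_add]
        refine ih (insert b' τ) (Function.update f b' c) V b' m' (mem_insert_self _ _) ?_
          (by rwa [Function.update_self])
        intro b'' hb'' hne
        have := mem_of_mem_insert_of_ne hb'' hne
        rw [Function.update_of_ne hne]
        exact hτV _ this
      · refine (iidExpect_le_const univ_nonempty (fun G _ => nonLoose_le_one _ _ _ _ _)).trans ?_
        linarith
    · refine mul_le_mul_of_nonneg_left ?_ (Nat.cast_nonneg M)
      have hc : (V.card : ℝ) * (k ^ 2 / N ^ 2) ≤ (v + k : ℕ) * (k ^ 2 / N ^ 2) :=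
        mul_le_mul_of_nonneg_right (by exact_mod_cast hV) (by positivity)
      have h1 := expect_mem_and_entry_le hN V l (D := D) (k := k)
      have h2 := expect_mem_and_entry_le hN V (negLit l) (D := D) (k := k)
      linarith
  unfold nonLooseCont
  rw [iidExpect_sum]
  refine (sum_le_sum hterm).trans ?_
  rw [sum_const, nsmul_eq_mul]
  have hDN : N * D ≤ nonLooseBound k α n (v + k) := by
    rwa [le_div_iff₀ hN0, mul_comm] at hD1
  rw [nonLooseBound, le_div_iff₀ hN0]
  have hE0 : (0 : ℝ) ≤ 2 * ((v + k : ℕ) * (k ^ 2 / N ^ 2) + k / (2 * N) * D) := by positivity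
  calc (L.card : ℝ) * (M * (2 * ((v + k : ℕ) * (k ^ 2 / N ^ 2) + k / (2 * N) * D))) * N
      ≤ k * (α * N * (2 * ((v + k : ℕ) * (k ^ 2 / N ^ 2) + k / (2 * N) * D))) * N := by
        gcongr
    _ = k * α * (2 * (v + k) * k ^ 2 + k * (N * D)) := by
        push_cast
        field_simp
    _ ≤ _ := by gcongr

theorem nonLooseBound_holds (hN : 2 ≤ N) [Nonempty (SatClause k N)] {α : ℝ} (hα : 0 ≤ α)
    (hM : (M : ℝ) ≤ α * N) (n : ℕ) : NonLooseBound k N M α n := by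
  induction n with
  | zero =>
    intro τ f V b m hb hτV hent
    refine le_trans (le_of_eq ?_) (div_nonneg (nonLooseBound_nonneg hα _ _) (Nat.cast_nonneg N))
    refine (iidExpect_congr fun G _ => ?_).trans (iidExpect_const univ_nonempty 0)
    rw [nonLoose, if_pos]
    rw [IsLoose, piecewise_eq_of_mem _ _ _ hb]
    exact hent
  | succ n ih =>
    intro τ f V b m hb hτV hent
    have hFb : ∀ G, τ.piecewise f G b = f b := fun G => piecewise_eq_of_mem _ _ _ hb
    refine le_trans (iidExpect_mono fun G _ => ?_)
      (NonLooseBound.cont hN hα hM ih τ f ((f b).1.erase m) (V ∪ clauseVars (f b)) b ?_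
        (v := V.card) ?_ ?_ ?_)
    · unfold nonLoose
      split_ifs with h
      · exact nonLooseCont_nonneg _ _ _ _ _
      · rw [IsLoose, hFb] at h
        push Not at h
        obtain ⟨l, hl, hne, b', hb', m', hm', hml, hbad⟩ := h hent
        exact one_le_nonLooseCont _ (mem_erase.mpr ⟨hne, hl⟩) hb' hm' hml hbad
    · exact (card_erase_le).trans (f b).2.1.le
    · exact (card_union_le _ _).trans (by rw [card_clauseVars])
    · intro b' hb'
      by_cases hne : b' = b
      · subst hne
        exact subset_union_right
      · exact (hτV b' hb' hne).trans subset_union_left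
    · intro b' hb' hne l hl h
      exact (mem_erase.mp hl).1 (hent l (mem_erase.mp hl).2 (hτV b' hb' hne h))

open Classical in
theorem iidExpect_not_isLooseAt_le (hN : 2 ≤ N) [Nonempty (SatClause k N)] {α : ℝ} (hα : 0 ≤ α)
    (hM : (M : ℝ) ≤ α * N) (n : ℕ) (a : Fin M) :
    iidExpect univ (fun F : SatFormula k N M => if IsLooseAt F n a then (0 : ℝ) else 1) ≤
      nonLooseBound k α (n + 1) 0 / N := by
  obtain ⟨f⟩ : Nonempty (SatFormula k N M) := inferInstance
  have h := iidExpect_piecewise_reveal univ univ_nonempty (notMem_empty a) f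
    (fun F : SatFormula k N M => if IsLooseAt F n a then (0 : ℝ) else 1)
  simp only [piecewise_empty] at h
  rw [h]
  refine expect_le univ_nonempty fun c _ => ?_
  have hfa : ∀ G, (insert a ∅ : Finset (Fin M)).piecewise (Function.update f a c) G a = c :=
    fun G => by simp
  refine le_trans (iidExpect_mono fun G _ => ?_)
    (NonLooseBound.cont hN hα hM (nonLooseBound_holds hN hα hM n) (insert a ∅)
      (Function.update f a c) c.1 (clauseVars c) a c.2.1.le (v := 0)
      (by rw [card_clauseVars, zero_add]) (by simp) (by simp))
  split_ifs with hl
  · exact nonLooseCont_nonneg _ _ _ _ _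
  · unfold IsLooseAt at hl
    rw [hfa G] at hl
    push Not at hl
    obtain ⟨l, hl, b', hb', m', hm', hml, hbad⟩ := hl
    exact one_le_nonLooseCont _ hl hb' hm' hml hbad

end NonLoose

/-! ### Contraction of the clause update -/

section LogisticBounds

/-- The probability that a variable with log-likelihood field `x` violates its clause. -/
noncomputable def violProb (x : ℝ) : ℝ := (1 - Real.tanh x) / 2

theorem violProb_eq (x : ℝ) : violProb x = 1 / (1 + Real.exp (2 * x)) := by
  have h : Real.exp (2 * x) = Real.exp x * Real.exp x := by rw [← Real.exp_add]; ring_nf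
  have hx := Real.exp_pos x
  rw [violProb, Real.tanh_eq_sinh_div_cosh, Real.sinh_eq, Real.cosh_eq, Real.exp_neg, h]
  field_simp
  ring

theorem violProb_pos (x : ℝ) : 0 < violProb x := by rw [violProb_eq]; positivity

theorem violProb_le_one (x : ℝ) : violProb x ≤ 1 := by
  rw [violProb_eq, div_le_one (by positivity)]
  linarith [Real.exp_pos (2 * x)]

theorem violProb_antitone {x y : ℝ} (h : x ≤ y) : violProb y ≤ violProb x := by
  rw [violProb_eq, violProb_eq]
  gcongr

theorem violProb_le_half {x : ℝ} (h : 0 ≤ x) : violProb x ≤ 1 / 2 := by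
  rw [violProb_eq]
  have : 1 ≤ Real.exp (2 * x) := Real.one_le_exp (by linarith)
  gcongr
  linarith

theorem hasDerivAt_violProb (x : ℝ) :
    HasDerivAt violProb (-(2 * violProb x * (1 - violProb x))) x := by
  have h1 : HasDerivAt (fun x : ℝ => 1 + Real.exp (2 * x)) (Real.exp (2 * x) * (2 * 1)) x :=
    (((hasDerivAt_id x).const_mul 2).exp).const_add 1
  have h2 := h1.fun_inv (by positivity)
  have h3 : violProb = fun x : ℝ => (1 + Real.exp (2 * x))⁻¹ := by
    ext y; rw [violProb_eq, one_div]
  have h4 : HasDerivAt violProb (-(Real.exp (2 * x) * (2 * 1)) / (1 + Real.exp (2 * x)) ^ 2) x :=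
    h3 ▸ h2
  convert h4 using 1
  rw [violProb_eq]
  field_simp
  ring

/-- With p = `violProb z`, the derivative is -Qp(1 - p)/(1 - Qp), and (1 - p)/(1 - Qp) ≤ 1 since Q <
1. Monotonicity of `violProb` carries the bound `c` from the endpoints to the segment between them.
-/
theorem abs_clauseMsg_sub_le_one {Q c x y : ℝ} (hQ0 : 0 ≤ Q) (hQ1 : Q < 1)
    (hx : violProb x ≤ c) (hy : violProb y ≤ c) :
    |-(1 / 2) * Real.log (1 - Q * violProb x) - -(1 / 2) * Real.log (1 - Q * violProb y)| ≤
      Q * c * |x - y| := by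
  have hpos : ∀ z, 0 < 1 - Q * violProb z := fun z => by
    have := violProb_le_one z
    have := (violProb_pos z).le
    nlinarith
  have hder : ∀ z ∈ Set.uIcc y x, HasDerivWithinAt
      (fun z => -(1 / 2) * Real.log (1 - Q * violProb z))
      (-(1 / 2) * (-(Q * -(2 * violProb z * (1 - violProb z))) / (1 - Q * violProb z)))
      (Set.uIcc y x) z := fun z _ =>
    ((((hasDerivAt_violProb z).const_mul Q).const_sub 1).log (hpos z).ne').const_mul
      (-(1 / 2)) |>.hasDerivWithinAt
  have hbound : ∀ z ∈ Set.uIcc y x,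
      ‖-(1 / 2) * (-(Q * -(2 * violProb z * (1 - violProb z))) / (1 - Q * violProb z))‖ ≤
        Q * c := by
    intro z hz
    have hp0 := (violProb_pos z).le
    have hp1 := violProb_le_one z
    have hzc : violProb z ≤ c := by
      rcases le_total x y with h | h
      · rw [Set.uIcc_of_ge h] at hz
        exact (violProb_antitone hz.1).trans hx
      · rw [Set.uIcc_of_le h] at hz
        exact (violProb_antitone hz.1).trans hy
    have e : -(1 / 2) * (-(Q * -(2 * violProb z * (1 - violProb z))) / (1 - Q * violProb z)) =
        -(Q * violProb z * ((1 - violProb z) / (1 - Q * violProb z))) := by ring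
    rw [e, norm_neg, Real.norm_eq_abs, abs_of_nonneg (by
      have := (hpos z).le
      have : 0 ≤ 1 - violProb z := by linarith
      positivity)]
    have h1 : (1 - violProb z) / (1 - Q * violProb z) ≤ 1 := by
      rw [div_le_one (hpos z)]
      nlinarith
    calc Q * violProb z * ((1 - violProb z) / (1 - Q * violProb z)) ≤ Q * violProb z * 1 := by
          gcongr
      _ ≤ Q * c := by rw [mul_one]; gcongr
  have := (convex_uIcc y x).norm_image_sub_le_of_norm_hasDerivWithin_le hder hbound
    Set.left_mem_uIcc Set.right_mem_uIcc
  simpa [Real.norm_eq_abs] using this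

/-- The clause message as a function of its arguments contracts with the product of bounds on the
probabilities of violation. -/
theorem abs_clauseMsg_sub_le {κ : Type*} (L : Finset κ) (c x y : κ → ℝ)
    (hx : ∀ l ∈ L, violProb (x l) ≤ c l) (hy : ∀ l ∈ L, violProb (y l) ≤ c l) {q : ℝ}
    (hq0 : 0 ≤ q) (hq1 : q < 1) :
    |-(1 / 2) * Real.log (1 - q * ∏ l ∈ L, violProb (x l)) -
      -(1 / 2) * Real.log (1 - q * ∏ l ∈ L, violProb (y l))| ≤
      q * (∏ l ∈ L, c l) * ∑ l ∈ L, |x l - y l| := by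
  classical
  induction L using Finset.induction_on generalizing q with
  | empty => simp
  | insert l L hl ih =>
    have hx' : ∀ l ∈ L, violProb (x l) ≤ c l := fun j hj => hx j (Finset.mem_insert_of_mem hj)
    have hy' : ∀ l ∈ L, violProb (y l) ≤ c l := fun j hj => hy j (Finset.mem_insert_of_mem hj)
    have hxl := hx l (Finset.mem_insert_self _ _)
    have hyl := hy l (Finset.mem_insert_self _ _)
    have hc : 0 ≤ c l := (violProb_pos _).le.trans hxl
    have hc' : 0 ≤ ∏ j ∈ L, c j :=
      Finset.prod_nonneg fun j hj => (violProb_pos _).le.trans (hx' j hj)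
    rw [Finset.prod_insert hl, Finset.prod_insert hl, Finset.prod_insert hl, Finset.sum_insert hl]
    have hp0 := (violProb_pos (x l)).le
    have hp1 := violProb_le_one (x l)
    -- The arguments in `L` are changed first, with `violProb (x l)` absorbed into `q`, and then the
    -- argument `l`, with the others absorbed. This is why the induction generalizes `q`.
    have h1 := ih hx' hy' (q := q * violProb (x l)) (mul_nonneg hq0 hp0)
      ((mul_le_of_le_one_right hq0 hp1).trans_lt hq1)
    set Y := ∏ j ∈ L, violProb (y j) with hY
    have hY0 : 0 ≤ Y := Finset.prod_nonneg fun j _ => (violProb_pos _).le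
    have hY1 : Y ≤ 1 := Finset.prod_le_one (fun j _ => (violProb_pos _).le)
      fun j _ => violProb_le_one _
    have hYc : Y ≤ ∏ j ∈ L, c j := Finset.prod_le_prod (fun j _ => (violProb_pos _).le) hy'
    have hqY : q * Y < 1 := (mul_le_of_le_one_right hq0 hY1).trans_lt hq1
    have h2 := abs_clauseMsg_sub_le_one (mul_nonneg hq0 hY0) hqY hxl hyl
    have e1 : q * (violProb (x l) * ∏ j ∈ L, violProb (x j)) =
        q * violProb (x l) * ∏ j ∈ L, violProb (x j) := by ring
    have e2 : q * (violProb (y l) * Y) = q * Y * violProb (y l) := by ring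
    have e3 : q * violProb (x l) * Y = q * Y * violProb (x l) := by ring
    rw [e1, e2]
    rw [e3] at h1
    refine (abs_sub_le _ _ _).trans ((add_le_add h1 h2).trans ?_)
    have hs : 0 ≤ ∑ j ∈ L, |x j - y j| := Finset.sum_nonneg fun j _ => abs_nonneg _
    have h3 : q * violProb (x l) * (∏ j ∈ L, c j) * ∑ j ∈ L, |x j - y j| ≤
        q * c l * (∏ j ∈ L, c j) * ∑ j ∈ L, |x j - y j| :=
      mul_le_mul_of_nonneg_right (mul_le_mul_of_nonneg_right
        (mul_le_mul_of_nonneg_left hxl hq0) hc') hs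
    have h4 : q * Y * c l * |x l - y l| ≤ q * (∏ j ∈ L, c j) * c l * |x l - y l| :=
      mul_le_mul_of_nonneg_right (mul_le_mul_of_nonneg_right
        (mul_le_mul_of_nonneg_left hYc hq0) hc) (abs_nonneg _)
    refine (add_le_add h3 h4).trans (le_of_eq ?_)
    ring

theorem tanh_half_log {A A' : ℝ} (hA : 0 < A) (hA' : 0 < A') :
    violProb (1 / 2 * (Real.log A' - Real.log A)) = A / (A + A') := by
  rw [violProb_eq, show 2 * (1 / 2 * (Real.log A' - Real.log A)) = Real.log (A' / A) by
    rw [Real.log_div hA'.ne' hA.ne']; ring, Real.exp_log (by positivity)]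
  field_simp

end LogisticBounds

/-! ### Exact recursions for the Gibbs measure -/

section Gibbs
open Finset BigOperators

variable {k N M : ℕ}

/-- The Gibbs weight `1 - θ = e^{-β}` of a violated clause. -/
noncomputable def clauseFactor (θ : ℝ) (c : SatClause k N) (x : Fin N → Bool) : ℝ :=
  if ∀ l ∈ c.1, x l.1 ≠ l.2 then 1 - θ else 1

theorem clauseFactor_pos {θ : ℝ} (hθ : θ < 1) (c : SatClause k N) (x : Fin N → Bool) :
    0 < clauseFactor θ c x := by
  unfold clauseFactor; split_ifs <;> linarith

theorem clauseFactor_le_one {θ : ℝ} (hθ : 0 ≤ θ) (c : SatClause k N) (x : Fin N → Bool) :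
    clauseFactor θ c x ≤ 1 := by
  unfold clauseFactor; split_ifs <;> linarith

/-- The partition function of the clauses in `U` over the assignments that make all the literals in
`P` false. -/
noncomputable def partialZ (θ : ℝ) (F : SatFormula k N M) (U : Finset (Fin M))
    (P : Finset (SatLiteral N)) : ℝ :=
  ∑ x : Fin N → Bool with ∀ l ∈ P, x l.1 ≠ l.2, ∏ b ∈ U, clauseFactor θ (F b) x

theorem partialZ_pos {θ : ℝ} (hθ : θ < 1) (F : SatFormula k N M) (U : Finset (Fin M))
    {P : Finset (SatLiteral N)} (hP : ∀ l ∈ P, negLit l ∉ P) : 0 < partialZ θ F U P := by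
  refine sum_pos (fun x _ => prod_pos fun b _ => clauseFactor_pos hθ _ _)
    ⟨fun i => if (i, true) ∈ P then false else true, ?_⟩
  rw [mem_filter]
  refine ⟨mem_univ _, ?_⟩
  rintro ⟨i, s⟩ hl
  cases s
  · have : (i, true) ∉ P := by simpa [negLit] using hP _ hl
    simp [this]
  · simp [hl]

theorem partialZ_nonneg {θ : ℝ} (hθ : θ < 1) (F : SatFormula k N M) (U : Finset (Fin M))
    (P : Finset (SatLiteral N)) : 0 ≤ partialZ θ F U P :=
  sum_nonneg fun _ _ => prod_nonneg fun _ _ => (clauseFactor_pos hθ _ _).le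

theorem partialZ_mono {θ : ℝ} (hθ : θ < 1) (F : SatFormula k N M) (U : Finset (Fin M))
    {P P' : Finset (SatLiteral N)} (h : P ⊆ P') : partialZ θ F U P' ≤ partialZ θ F U P :=
  sum_le_sum_of_subset_of_nonneg (fun x hx => by
    rw [mem_filter] at hx ⊢
    exact ⟨hx.1, fun l hl => hx.2 l (h hl)⟩)
    fun _ _ _ => prod_nonneg fun _ _ => (clauseFactor_pos hθ _ _).le

theorem partialZ_anti {θ : ℝ} (hθ0 : 0 ≤ θ) (hθ : θ < 1) (F : SatFormula k N M)
    {U U' : Finset (Fin M)} (h : U ⊆ U') (P : Finset (SatLiteral N)) :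
    partialZ θ F U' P ≤ partialZ θ F U P := by
  refine sum_le_sum fun x _ => ?_
  rw [← prod_sdiff h]
  exact mul_le_of_le_one_left (prod_nonneg fun _ _ => (clauseFactor_pos hθ _ _).le)
    (prod_le_one (fun _ _ => (clauseFactor_pos hθ _ _).le) fun _ _ => clauseFactor_le_one hθ0 _ _)

/-- The factor of a clause is 1 - θ times the indicator that all its literals are false, and this
indicator merely enlarges the set of literals forced to be false. -/
theorem partialZ_insert_clause (θ : ℝ) (F : SatFormula k N M) {U : Finset (Fin M)} {b : Fin M}
    (hb : b ∉ U) (P : Finset (SatLiteral N)) :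
    partialZ θ F (insert b U) P = partialZ θ F U P - θ * partialZ θ F U (P ∪ (F b).1) := by
  unfold partialZ
  have h : univ.filter (fun x : Fin N → Bool => ∀ l ∈ P ∪ (F b).1, x l.1 ≠ l.2) =
      (univ.filter (fun x : Fin N → Bool => ∀ l ∈ P, x l.1 ≠ l.2)).filter
        (fun x => ∀ l ∈ (F b).1, x l.1 ≠ l.2) := by
    ext x
    simp only [mem_filter, mem_univ, true_and, mem_union]
    constructor
    · exact fun h => ⟨fun l hl => h l (Or.inl hl), fun l hl => h l (Or.inr hl)⟩
    · exact fun h l hl => hl.elim (h.1 l) (h.2 l)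
  rw [h, sum_filter (fun x : Fin N → Bool => ∀ l ∈ (F b).1, x l.1 ≠ l.2)
    (fun x => ∏ b ∈ U, clauseFactor θ (F b) x), mul_sum, ← sum_sub_distrib]
  refine sum_congr rfl fun x _ => ?_
  rw [prod_insert hb, clauseFactor]
  split_ifs <;> ring

theorem partialZ_split (θ : ℝ) (F : SatFormula k N M) (U : Finset (Fin M))
    (P : Finset (SatLiteral N)) (l : SatLiteral N) :
    partialZ θ F U P = partialZ θ F U (insert l P) + partialZ θ F U (insert (negLit l) P) := by
  unfold partialZ
  rw [← sum_filter_add_sum_filter_not _ (fun x : Fin N → Bool => x l.1 ≠ l.2)]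
  congr 1
  · refine sum_congr ?_ fun _ _ => rfl
    ext x
    simp only [mem_filter, mem_univ, true_and, mem_insert, forall_eq_or_imp]
    tauto
  · refine sum_congr ?_ fun _ _ => rfl
    ext x
    simp only [mem_filter, mem_univ, true_and, mem_insert, forall_eq_or_imp]
    rw [show x (negLit l).1 ≠ (negLit l).2 ↔ ¬ (x l.1 ≠ l.2) by
      rw [ne_snd_iff_eq_negLit_snd x (negLit l), negLit_negLit, not_not]]
    tauto

theorem partialZ_union_satisfied (θ : ℝ) (F : SatFormula k N M) (U B : Finset (Fin M))
    {P : Finset (SatLiteral N)} {l : SatLiteral N} (hl : l ∈ P)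
    (hB : ∀ b ∈ B, negLit l ∈ (F b).1) : partialZ θ F (U ∪ B) P = partialZ θ F U P := by
  refine sum_congr rfl fun x hx => ?_
  have hxl := (mem_filter.mp hx).2 l hl
  refine (prod_subset subset_union_left fun b hb hbU => ?_).symm
  have hbB := hB b ((mem_union.mp hb).resolve_left hbU)
  rw [clauseFactor, if_neg]
  intro h
  exact h _ hbB ((ne_snd_iff_eq_negLit_snd x l).mp hxl)

/-- Flipping the variable of `l` is a bijection between the two sets of assignments, and no clause
in `U` sees that variable. -/
theorem partialZ_flip (θ : ℝ) (F : SatFormula k N M) (U : Finset (Fin M))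
    (P : Finset (SatLiteral N)) (l : SatLiteral N) (hU : ∀ b ∈ U, l.1 ∉ clauseVars (F b))
    (hP : ∀ l' ∈ P, l'.1 ≠ l.1) :
    partialZ θ F U (insert l P) = partialZ θ F U (insert (negLit l) P) := by
  have hflip : ∀ (x : Fin N → Bool) (l' : SatLiteral N), l'.1 ≠ l.1 →
      Function.update x l.1 (!x l.1) l'.1 = x l'.1 := fun x l' h => Function.update_of_ne h _ _
  have hinv : ∀ x : Fin N → Bool, Function.update (Function.update x l.1 (!x l.1)) l.1
      (!Function.update x l.1 (!x l.1) l.1) = x := by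
    intro x
    ext i
    by_cases h : i = l.1
    · subst h; simp
    · simp [h]
  have hmaps : ∀ (l₀ l₁ : SatLiteral N), l₀.1 = l.1 → l₁ = negLit l₀ → ∀ x : Fin N → Bool,
      (∀ l' ∈ insert l₀ P, x l'.1 ≠ l'.2) →
      ∀ l' ∈ insert l₁ P, Function.update x l.1 (!x l.1) l'.1 ≠ l'.2 := by
    rintro l₀ _ h0 rfl x hx l' hl'
    rcases mem_insert.mp hl' with rfl | h
    · have := hx l₀ (mem_insert_self _ _)
      simp only [negLit_fst, h0, Function.update_self]
      rw [h0] at this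
      simp only [negLit]
      cases hh : x l.1 <;> cases hh' : l₀.2 <;> simp_all
    · rw [hflip x l' (hP l' h)]
      exact hx l' (mem_insert_of_mem h)
  unfold partialZ
  refine sum_nbij' (fun x => Function.update x l.1 (!x l.1))
    (fun x => Function.update x l.1 (!x l.1)) ?_ ?_ (fun x _ => hinv x) (fun x _ => hinv x) ?_
  · intro x hx
    rw [mem_filter] at hx ⊢
    exact ⟨mem_univ _, hmaps l (negLit l) rfl rfl x hx.2⟩
  · intro x hx
    rw [mem_filter] at hx ⊢
    exact ⟨mem_univ _, hmaps (negLit l) l rfl (negLit_negLit l).symm x hx.2⟩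
  · intro x _
    refine prod_congr rfl fun b hb => ?_
    unfold clauseFactor
    have : (∀ l' ∈ (F b).1, Function.update x l.1 (!x l.1) l'.1 ≠ l'.2) ↔
        ∀ l' ∈ (F b).1, x l'.1 ≠ l'.2 := by
      refine forall₂_congr fun l' hl' => ?_
      rw [hflip x l' fun h => hU b hb (h ▸ fst_mem_clauseVars hl')]
    simp only [this]

/-- The exact message of the clause `b` in the presence of the clauses in `U`. -/
noncomputable def gibbsMsg (θ : ℝ) (F : SatFormula k N M) (U : Finset (Fin M))
    (P : Finset (SatLiteral N)) (b : Fin M) : ℝ :=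
  -(1 / 2) * Real.log (1 - θ * (partialZ θ F U (P ∪ (F b).1) / partialZ θ F U P))

/-- Half of the log-likelihood ratio of `l` being true. -/
noncomputable def gibbsField (θ : ℝ) (F : SatFormula k N M) (U : Finset (Fin M))
    (P : Finset (SatLiteral N)) (l : SatLiteral N) : ℝ :=
  1 / 2 * (Real.log (partialZ θ F U (insert (negLit l) P)) -
    Real.log (partialZ θ F U (insert l P)))

theorem ratio_mem_Icc {θ : ℝ} (hθ : θ < 1) (F : SatFormula k N M) (U : Finset (Fin M))
    {P P' : Finset (SatLiteral N)} (h : P ⊆ P') :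
    partialZ θ F U P' / partialZ θ F U P ∈ Set.Icc (0 : ℝ) 1 :=
  ⟨div_nonneg (partialZ_nonneg hθ _ _ _) (partialZ_nonneg hθ _ _ _),
    div_le_one_of_le₀ (partialZ_mono hθ F U h) (partialZ_nonneg hθ _ _ _)⟩

theorem msg_mem_Icc {θ r : ℝ} (hθ0 : 0 ≤ θ) (hθ : θ < 1) (hr : r ∈ Set.Icc (0 : ℝ) 1) :
    -(1 / 2) * Real.log (1 - θ * r) ∈ Set.Icc 0 (-(1 / 2) * Real.log (1 - θ)) := by
  obtain ⟨h0, h1⟩ := hr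
  have h2 : θ * r ≤ θ := mul_le_of_le_one_right hθ0 h1
  have h3 : 0 ≤ θ * r := mul_nonneg hθ0 h0
  have h4 := Real.log_nonpos (show 0 ≤ 1 - θ * r by linarith) (by linarith)
  have h5 := Real.log_le_log (show 0 < 1 - θ by linarith) (show 1 - θ ≤ 1 - θ * r by linarith)
  constructor <;> linarith

/-- When the clauses of `B` are added one at a time, each ratio of partition functions is an exact
message in the presence of those added before. The hypothesis is therefore required for every
intermediate set `U'`, not for a single environment. -/
theorem abs_log_partialZ_union_sub_le {θ : ℝ} (hθ0 : 0 ≤ θ) (hθ : θ < 1) (F : SatFormula k N M)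
    (U B : Finset (Fin M)) (hUB : Disjoint U B) {P : Finset (SatLiteral N)}
    (hP : ∀ l ∈ P, negLit l ∉ P) (y d : Fin M → ℝ)
    (h : ∀ b ∈ B, ∀ U', U ⊆ U' → b ∉ U' → |gibbsMsg θ F U' P b - y b| ≤ d b) :
    |-(1 / 2) * (Real.log (partialZ θ F (U ∪ B) P) - Real.log (partialZ θ F U P)) -
      ∑ b ∈ B, y b| ≤ ∑ b ∈ B, d b := by
  induction B using Finset.induction_on with
  | empty => simp
  | insert b B hb ih =>
    rw [disjoint_insert_right] at hUB
    have ih' := ih hUB.2 fun b' hb' => h b' (mem_insert_of_mem hb')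
    have hbU : b ∉ U ∪ B := by
      rw [mem_union]
      exact fun h => h.elim hUB.1 hb
    have h1 := h b (mem_insert_self _ _) (U ∪ B) subset_union_left hbU
    have hZ := partialZ_pos hθ F (U ∪ B) hP
    have hr := ratio_mem_Icc hθ F (U ∪ B) (subset_union_left (s₁ := P) (s₂ := (F b).1))
    set r := partialZ θ F (U ∪ B) (P ∪ (F b).1) / partialZ θ F (U ∪ B) P with hr'
    have hpos : 0 < 1 - θ * r := by
      have := mul_le_of_le_one_right hθ0 hr.2
      linarith
    have h2 : Real.log (partialZ θ F (U ∪ insert b B) P) =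
        Real.log (partialZ θ F (U ∪ B) P) + Real.log (1 - θ * r) := by
      rw [union_insert, partialZ_insert_clause θ F hbU, ← Real.log_mul hZ.ne' hpos.ne', hr']
      congr 1
      field_simp
    rw [sum_insert hb, sum_insert hb, h2]
    have h3 : gibbsMsg θ F (U ∪ B) P b = -(1 / 2) * Real.log (1 - θ * r) := rfl
    rw [h3] at h1
    refine le_trans (le_of_eq ?_) ((abs_add_le _ _).trans (add_le_add h1 ih'))
    congr 1
    ring

theorem consistent_insert {P : Finset (SatLiteral N)} {l : SatLiteral N}
    (hP : ∀ l ∈ P, negLit l ∉ P) (hl : ∀ l' ∈ P, l'.1 ≠ l.1) :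
    ∀ l' ∈ insert l P, negLit l' ∉ insert l P := by
  intro l' hl' h
  rcases mem_insert.mp hl' with rfl | h1 <;> rcases mem_insert.mp h with h2 | h2
  · exact negLit_ne _ h2
  · exact hl _ h2 rfl
  · exact hl _ h1 (by rw [← h2]; rfl)
  · exact hP _ h1 h2

/-- The exact recursion for fields in terms of messages, in the form of a comparison. -/
theorem abs_gibbsField_sub_le {θ : ℝ} (hθ0 : 0 ≤ θ) (hθ : θ < 1) (F : SatFormula k N M)
    (U : Finset (Fin M)) {P : Finset (SatLiteral N)} (hP : ∀ l ∈ P, negLit l ∉ P)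
    (l : SatLiteral N) (hl : ∀ l' ∈ P, l'.1 ≠ l.1) (y d : Fin M → SatLiteral N → ℝ)
    (h : ∀ m, m.1 = l.1 → ∀ b ∈ U, m ∈ (F b).1 → ∀ U',
      (∀ b' ∈ U, l.1 ∉ clauseVars (F b') → b' ∈ U') → b ∉ U' →
        |gibbsMsg θ F U' (insert m P) b - y b m| ≤ d b m) :
    |gibbsField θ F U P l - (∑ b ∈ U with l ∈ (F b).1, y b l -
      ∑ b ∈ U with negLit l ∈ (F b).1, y b (negLit l))| ≤
      ∑ b ∈ U with l ∈ (F b).1, d b l + ∑ b ∈ U with negLit l ∈ (F b).1, d b (negLit l) := by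
  -- Once `m` is forced to be false, the clauses containing its negation are satisfied and
  -- disappear. Only those containing `m` separate `U` from `U₀`, and `partialZ_flip` cancels the
  -- two contributions of `U₀`.
  set U₀ := U.filter fun b => l.1 ∉ clauseVars (F b) with hU₀
  have key : ∀ m : SatLiteral N, m.1 = l.1 →
      |-(1 / 2) * (Real.log (partialZ θ F U (insert m P)) -
        Real.log (partialZ θ F U₀ (insert m P))) - ∑ b ∈ U with m ∈ (F b).1, y b m| ≤
        ∑ b ∈ U with m ∈ (F b).1, d b m := by
    intro m hm
    have hcons := consistent_insert hP (l := m) (by simpa only [hm] using hl)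
    have hdisj : Disjoint U₀ (U.filter fun b => m ∈ (F b).1) := by
      refine disjoint_left.mpr fun b hb hb' => (mem_filter.mp hb).2 ?_
      rw [← hm]
      exact fst_mem_clauseVars (mem_filter.mp hb').2
    have hU : U = (U₀ ∪ U.filter fun b => m ∈ (F b).1) ∪ U.filter fun b => negLit m ∈ (F b).1 := by
      ext b
      simp only [hU₀, mem_union, mem_filter, mem_clauseVars]
      constructor
      · intro hb
        by_cases h1 : ∃ l' ∈ (F b).1, l'.1 = l.1
        · obtain ⟨l', hl', h2⟩ := h1
          rcases eq_or_eq_negLit (h2.trans hm.symm) with rfl | rfl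
          · exact Or.inl (Or.inr ⟨hb, hl'⟩)
          · exact Or.inr ⟨hb, hl'⟩
        · exact Or.inl (Or.inl ⟨hb, h1⟩)
      · rintro ((h | h) | h) <;> exact h.1
    have hZ : partialZ θ F U (insert m P) =
        partialZ θ F (U₀ ∪ U.filter fun b => m ∈ (F b).1) (insert m P) := by
      conv_lhs => rw [hU]
      exact partialZ_union_satisfied θ F _ _ (mem_insert_self m P)
        fun b hb => (mem_filter.mp hb).2
    rw [hZ]
    refine abs_log_partialZ_union_sub_le hθ0 hθ F U₀ _ hdisj hcons (fun b => y b m)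
      (fun b => d b m) fun b hb U' hU' hbU' => ?_
    rw [mem_filter] at hb
    exact h m hm b hb.1 hb.2 U' (fun b' hb' hv => hU' (mem_filter.mpr ⟨hb', hv⟩)) hbU'
  have h1 := key l rfl
  have h2 := key (negLit l) rfl
  rw [← partialZ_flip θ F U₀ P l (fun b hb => (mem_filter.mp hb).2) hl] at h2
  refine le_trans (le_of_eq ?_) ((abs_sub _ _).trans (add_le_add h1 h2))
  unfold gibbsField
  congr 1
  ring

/-- If the negation does not occur, then all clauses on the variable of `l` are satisfied by making
`l` true, whereas making it false leaves them as further penalties. -/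
theorem gibbsField_nonneg {θ : ℝ} (hθ0 : 0 ≤ θ) (hθ : θ < 1) (F : SatFormula k N M)
    (U : Finset (Fin M)) {P : Finset (SatLiteral N)} (hP : ∀ l ∈ P, negLit l ∉ P)
    (l : SatLiteral N) (hl : ∀ l' ∈ P, l'.1 ≠ l.1) (h : ∀ b ∈ U, negLit l ∉ (F b).1) :
    0 ≤ gibbsField θ F U P l := by
  set U₀ := U.filter fun b => l.1 ∉ clauseVars (F b) with hU₀
  have hU : U = U₀ ∪ U.filter fun b => l ∈ (F b).1 := by
    ext b
    simp only [hU₀, mem_union, mem_filter, mem_clauseVars]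
    constructor
    · intro hb
      by_cases h1 : ∃ l' ∈ (F b).1, l'.1 = l.1
      · obtain ⟨l', hl', h2⟩ := h1
        rcases eq_or_eq_negLit h2 with rfl | rfl
        · exact Or.inr ⟨hb, hl'⟩
        · exact absurd hl' (h b hb)
      · exact Or.inl ⟨hb, h1⟩
    · rintro (h | h) <;> exact h.1
  have h1 : partialZ θ F U (insert (negLit l) P) = partialZ θ F U₀ (insert (negLit l) P) := by
    conv_lhs => rw [hU]
    exact partialZ_union_satisfied θ F _ _ (mem_insert_self _ P)
      fun b hb => by rw [negLit_negLit]; exact (mem_filter.mp hb).2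
  rw [gibbsField, h1, ← partialZ_flip θ F U₀ P l (fun b hb => (mem_filter.mp hb).2) hl]
  have h2 := partialZ_anti hθ0 hθ F (filter_subset _ U : U₀ ⊆ U) (insert l P)
  have h3 := Real.log_le_log (partialZ_pos hθ F U (consistent_insert hP hl)) h2
  linarith

/-- The left side is the conditional probability that `l` is false; the field is half of its
log-odds. -/
theorem partialZ_insert_div {θ : ℝ} (hθ : θ < 1) (F : SatFormula k N M)
    (U : Finset (Fin M)) {P : Finset (SatLiteral N)} (hP : ∀ l ∈ P, negLit l ∉ P)
    (l : SatLiteral N) (hl : ∀ l' ∈ P, l'.1 ≠ l.1) :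
    partialZ θ F U (insert l P) / partialZ θ F U P = violProb (gibbsField θ F U P l) := by
  rw [gibbsField, tanh_half_log (partialZ_pos hθ F U (consistent_insert hP hl))
    (partialZ_pos hθ F U (consistent_insert (l := negLit l) hP hl)), ← partialZ_split]

/-- The chain rule for the probability that all the literals in `L` are false. -/
theorem exists_partialZ_union_div_eq {θ : ℝ} (hθ : θ < 1) (F : SatFormula k N M)
    (U : Finset (Fin M)) {P : Finset (SatLiteral N)} (L : Finset (SatLiteral N))
    (hP : ∀ l ∈ P ∪ L, negLit l ∉ P ∪ L) (hPL : ∀ l ∈ L, ∀ l' ∈ P, l'.1 ≠ l.1)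
    (hL : Set.InjOn Prod.fst (L : Set (SatLiteral N))) :
    ∃ Q : SatLiteral N → Finset (SatLiteral N),
      (∀ l ∈ L, P ⊆ Q l ∧ Q l ⊆ P ∪ L.erase l) ∧
      partialZ θ F U (P ∪ L) / partialZ θ F U P =
        ∏ l ∈ L, violProb (gibbsField θ F U (Q l) l) := by
  induction L using Finset.induction_on with
  | empty =>
    have : partialZ θ F U P ≠ 0 := (partialZ_pos hθ F U (by simpa using hP)).ne'
    exact ⟨fun _ => P, by simp, by simp [this]⟩
  | insert l L hlL ih =>
    have hsub : P ∪ L ⊆ P ∪ insert l L := union_subset_union_right (subset_insert _ _)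
    have hPL' : ∀ l' ∈ P ∪ L, negLit l' ∉ P ∪ L := fun l' hl' h =>
      hP l' (hsub hl') (hsub h)
    obtain ⟨Q, hQ1, hQ2⟩ := ih hPL' (fun l' hl' => hPL l' (mem_insert_of_mem hl'))
      (hL.mono (coe_subset.mpr (subset_insert _ _)))
    have hl : ∀ l' ∈ P ∪ L, l'.1 ≠ l.1 := by
      intro l' hl' h
      rcases mem_union.mp hl' with h1 | h1
      · exact hPL l (mem_insert_self _ _) l' h1 h
      · have : l' = l := hL (mem_insert_of_mem h1) (mem_insert_self _ _) h
        exact hlL (this ▸ h1)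
    refine ⟨Function.update Q l (P ∪ L), ?_, ?_⟩
    · intro l' hl'
      by_cases h : l' = l
      · subst h
        rw [Function.update_self, erase_insert hlL]
        exact ⟨subset_union_left, Subset.rfl⟩
      · rw [Function.update_of_ne h]
        have := hQ1 l' (mem_of_mem_insert_of_ne hl' h)
        exact ⟨this.1, this.2.trans (union_subset_union_right
          (erase_subset_erase _ (subset_insert _ _)))⟩
    · rw [prod_insert hlL, Function.update_self, ← partialZ_insert_div hθ F U hPL' l hl,
        union_insert]
      rw [prod_congr rfl fun l' hl' => by
        rw [Function.update_of_ne (show l' ≠ l from fun h => hlL (h ▸ hl'))], ← hQ2]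
      have := (partialZ_pos hθ F U hPL').ne'
      rw [div_mul_div_cancel₀ this]

end Gibbs

/-! ### Exact messages against belief propagation messages -/

section Comparison
open Finset BigOperators

variable {k N M : ℕ}

theorem one_sub_exp_neg_mem {β : ℝ} (hβ : 0 ≤ β) :
    0 ≤ 1 - Real.exp (-β) ∧ 1 - Real.exp (-β) < 1 := by
  have := Real.exp_le_one_iff.mpr (neg_nonpos.mpr hβ)
  have := Real.exp_pos (-β)
  constructor <;> linarith

theorem bpClauseMsg_eq (β : ℝ) (F : SatFormula k N M) (h : Fin M → SatLiteral N → ℝ) (a : Fin M)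
    {l : SatLiteral N} (hl : l ∈ (F a).1) :
    bpClauseMsg β F h a l = -(1 / 2) *
      Real.log (1 - (1 - Real.exp (-β)) * ∏ j ∈ (F a).1.erase l, violProb (h a j)) := by
  unfold bpClauseMsg violProb
  rw [prod_div_distrib, prod_const, card_erase_of_mem hl, (F a).2.1]
  congr 3
  ring

theorem prod_violProb_mem_Icc {κ : Type*} (L : Finset κ) (x : κ → ℝ) :
    ∏ l ∈ L, violProb (x l) ∈ Set.Icc (0 : ℝ) 1 :=
  ⟨prod_nonneg fun _ _ => (violProb_pos _).le,
    prod_le_one (fun _ _ => (violProb_pos _).le) fun _ _ => violProb_le_one _⟩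

theorem half_beta_eq (β : ℝ) : -(1 / 2) * Real.log (1 - (1 - Real.exp (-β))) = β / 2 := by
  rw [sub_sub_cancel, Real.log_exp]
  ring

theorem bpClauseMsg_mem_Icc {β : ℝ} (hβ : 0 ≤ β) (F : SatFormula k N M)
    (h : Fin M → SatLiteral N → ℝ) (a : Fin M) {l : SatLiteral N} (hl : l ∈ (F a).1) :
    bpClauseMsg β F h a l ∈ Set.Icc 0 (β / 2) := by
  rw [bpClauseMsg_eq β F h a hl, ← half_beta_eq]
  obtain ⟨h0, h1⟩ := one_sub_exp_neg_mem hβ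
  exact msg_mem_Icc h0 h1 (prod_violProb_mem_Icc _ _)

theorem bpMsg_nonneg {β : ℝ} (hβ : 0 ≤ β) (F : SatFormula k N M) (t : ℕ) (a : Fin M)
    (l : SatLiteral N) (h : ∀ b, negLit l ∉ (F b).1) : 0 ≤ bpMsg β F t a l := by
  cases t with
  | zero => exact le_rfl
  | succ t =>
    have h0 : univ.filter (fun b : Fin M => b ≠ a ∧ (l.1, !l.2) ∈ (F b).1) = ∅ :=
      filter_eq_empty_iff.mpr fun b _ hb => h b hb.2
    simp only [bpMsg, bpStep]
    rw [h0, sum_empty, sub_zero]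
    exact sum_nonneg fun b hb => (bpClauseMsg_mem_Icc hβ F _ b (mem_filter.mp hb).2.2).1

/-- Applied to exact and to belief propagation fields alike: each is nonnegative when the negation
of the literal does not occur, so one weight controls the contraction between the two. -/
theorem violProb_le_purityWeight (F : SatFormula k N M) (l : SatLiteral N) {x : ℝ}
    (h : (∀ b, negLit l ∉ (F b).1) → 0 ≤ x) : violProb x ≤ purityWeight F l := by
  unfold purityWeight
  split_ifs with h1
  · exact violProb_le_one x
  · push Not at h1
    exact violProb_le_half (h h1)

theorem sum_litsOn (F : SatFormula k N M) (b : Fin M) (l : SatLiteral N)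
    (w : Fin M → SatLiteral N → ℝ) :
    ∑ b' ∈ univ.erase b, ∑ m ∈ litsOn (F b') l.1, w b' m =
      ∑ b' : Fin M with b' ≠ b ∧ l ∈ (F b').1, w b' l +
        ∑ b' : Fin M with b' ≠ b ∧ negLit l ∈ (F b').1, w b' (negLit l) := by
  have h : ∀ b' : Fin M, ∑ m ∈ litsOn (F b') l.1, w b' m =
      (if l ∈ (F b').1 then w b' l else 0) +
        if negLit l ∈ (F b').1 then w b' (negLit l) else 0 := by
    intro b'
    have h2 : litsOn (F b') l.1 =
        ({l, negLit l} : Finset (SatLiteral N)).filter (fun m => m ∈ (F b').1) := by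
      ext m
      simp only [mem_litsOn, mem_filter, mem_insert, mem_singleton]
      constructor
      · exact fun h => ⟨eq_or_eq_negLit h.2, h.1⟩
      · rintro ⟨rfl | rfl, h⟩
        exacts [⟨h, rfl⟩, ⟨h, rfl⟩]
    rw [h2, sum_filter, sum_pair (negLit_ne l).symm]
  simp only [h, sum_add_distrib]
  rw [← sum_filter, ← sum_filter]
  congr 1
  · refine sum_congr ?_ fun _ _ => rfl
    ext b'
    simp
  · refine sum_congr ?_ fun _ _ => rfl
    ext b'
    simp

/-- The comparison of the exact message of the clause `b` with the belief propagation message, for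
the clauses around which the walks of length `n` are loose. -/
def MsgComparison (β : ℝ) (F : SatFormula k N M) (n : ℕ) : Prop :=
  ∀ (t : ℕ) (V : Finset (Fin N)) (U : Finset (Fin M)) (P : Finset (SatLiteral N)) (b : Fin M)
    (m : SatLiteral N), IsLoose F n V b m → m ∈ (F b).1 → m ∈ P → (∀ l ∈ P, negLit l ∉ P) →
    (∀ l ∈ P, l.1 ∈ V) → (∀ b', b' ≠ b → Disjoint (clauseVars (F b')) V → b' ∈ U) → b ∉ U →
    |gibbsMsg (1 - Real.exp (-β)) F U P b - bpClauseMsg β F (bpMsg β F (t + n)) b m| ≤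
      β / 2 * walkWeight F n b m

/-- Since `U` contains every clause other than `b` on the variable of `l`, the exact recursion sums
over the same clauses as `bpStep`. Each environment `U'` in that recursion still contains all
clauses away from `V`, because these do not touch `l`; hence the comparison of messages applies to
it. -/
theorem MsgComparison.field {β : ℝ} (hβ : 0 ≤ β) {F : SatFormula k N M} {n : ℕ}
    (ih : MsgComparison β F n) (t : ℕ) (V : Finset (Fin N)) (U : Finset (Fin M))
    (P : Finset (SatLiteral N)) (b : Fin M) (l : SatLiteral N) (hl : l ∈ (F b).1)
    (hlV : l.1 ∈ V) (hbV : clauseVars (F b) ⊆ V)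
    (hlP : ∀ l' ∈ P, l'.1 ≠ l.1) (hP : ∀ l ∈ P, negLit l ∉ P) (hPV : ∀ l ∈ P, l.1 ∈ V)
    (hU : ∀ b', b' ≠ b → Disjoint (clauseVars (F b')) V → b' ∈ U)
    (hUl : ∀ b', b' ≠ b → l.1 ∈ clauseVars (F b') → b' ∈ U) (hbU : b ∉ U)
    (hloose : ∀ b', b' ≠ b → ∀ m ∈ (F b').1, m.1 = l.1 → IsLoose F n V b' m) :
    |gibbsField (1 - Real.exp (-β)) F U P l - bpMsg β F (t + n + 1) b l| ≤
      β / 2 * ∑ b' ∈ univ.erase b, ∑ m ∈ litsOn (F b') l.1, walkWeight F n b' m := by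
  obtain ⟨h0, h1⟩ := one_sub_exp_neg_mem hβ
  have hfil : ∀ m : SatLiteral N, m.1 = l.1 → U.filter (fun b' => m ∈ (F b').1) =
      univ.filter (fun b' => b' ≠ b ∧ m ∈ (F b').1) := by
    intro m hm
    ext b'
    simp only [mem_filter, mem_univ, true_and]
    constructor
    · exact fun h => ⟨fun hb => hbU (hb ▸ h.1), h.2⟩
    · exact fun h => ⟨hUl b' h.1 (hm ▸ fst_mem_clauseVars h.2), h.2⟩
  have key := abs_gibbsField_sub_le h0 h1 F U hP l hlP
    (fun b' m => bpClauseMsg β F (bpMsg β F (t + n)) b' m)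
    (fun b' m => β / 2 * walkWeight F n b' m) ?_
  · rw [hfil l rfl, hfil (negLit l) rfl] at key
    rw [sum_litsOn, mul_add, mul_sum, mul_sum]
    exact key
  · intro m hm b' hb' hmb' U' hU' hbU'
    have hne : b' ≠ b := fun h => hbU (h ▸ hb')
    refine ih t V U' (insert m P) b' m (hloose b' hne m hmb' hm) hmb' (mem_insert_self _ _)
      (consistent_insert hP (by simpa only [hm] using hlP)) ?_ ?_ hbU'
    · intro l' hl'
      rcases mem_insert.mp hl' with rfl | h
      · rw [hm]; exact hlV
      · exact hPV l' h
    · intro b'' _ hd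
      refine hU' b'' (hU b'' ?_ hd) fun h => disjoint_left.mp hd h hlV
      rintro rfl
      exact disjoint_left.mp hd (fst_mem_clauseVars hl) hlV

/-- At depth zero both messages lie in [0, β/2]. In the inductive step the chain rule writes the
ratio of partition functions as a product over the remaining literals of the clause, each with its
own conditioning set `Q l`; the contraction bound then multiplies the errors of the fields by the
purity weights. Belief propagation may have run any `t` extra iterations before the depth in
question. -/
theorem msgComparison {β : ℝ} (hβ : 0 ≤ β) (F : SatFormula k N M) (n : ℕ) :
    MsgComparison β F n := by
  obtain ⟨h0, h1⟩ := one_sub_exp_neg_mem hβ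
  induction n with
  | zero =>
    intro t V U P b m _ hmb _ _ _ _ _
    have e1 := msg_mem_Icc h0 h1 (ratio_mem_Icc h1 F U (subset_union_left (s₁ := P) (s₂ := (F b).1)))
    have e2 := bpClauseMsg_mem_Icc hβ F (bpMsg β F (t + 0)) b hmb
    rw [half_beta_eq] at e1
    change gibbsMsg (1 - Real.exp (-β)) F U P b ∈ _ at e1
    rw [walkWeight, mul_one, abs_le]
    constructor <;> linarith [e1.1, e1.2, e2.1, e2.2]
  | succ n ih =>
    intro t V U P b m hloose hmb hmP hP hPV hU hbU
    have hent := hloose.entry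
    set L := (F b).1.erase m with hL
    have hLV : ∀ l ∈ L, l.1 ∉ V := fun l hl h =>
      (mem_erase.mp hl).1 (hent l (mem_erase.mp hl).2 h)
    have hPL : ∀ l ∈ L, ∀ l' ∈ P, l'.1 ≠ l.1 := fun l hl l' hl' h => hLV l hl (h ▸ hPV l' hl')
    have hunion : P ∪ (F b).1 = P ∪ L := by
      rw [hL, ← insert_erase hmb, union_insert, erase_insert_eq_erase, erase_idem,
        insert_eq_of_mem (mem_union_left _ hmP)]
    have hLinj : Set.InjOn Prod.fst (L : Set (SatLiteral N)) :=
      (F b).2.2.mono (coe_subset.mpr (erase_subset _ _))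
    have hcons : ∀ l ∈ P ∪ L, negLit l ∉ P ∪ L := by
      intro l hl h
      rcases mem_union.mp hl with h1 | h1 <;> rcases mem_union.mp h with h2 | h2
      · exact hP l h1 h2
      · exact hPL _ h2 l h1 rfl
      · exact hPL _ h1 _ h2 rfl
      · exact (F b).negLit_notMem (mem_erase.mp h1).2 (mem_erase.mp h2).2
    obtain ⟨Q, hQ1, hQ2⟩ := exists_partialZ_union_div_eq h1 F U L hcons hPL hLinj
    have hbW : clauseVars (F b) ⊆ V ∪ clauseVars (F b) := subset_union_right
    have hfield : ∀ l ∈ L, |gibbsField (1 - Real.exp (-β)) F U (Q l) l -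
        bpMsg β F (t + n + 1) b l| ≤
        β / 2 * ∑ b' ∈ univ.erase b, ∑ m ∈ litsOn (F b') l.1, walkWeight F n b' m := by
      intro l hl
      have hlF := (mem_erase.mp hl).2
      have hchild : ∀ b', b' ≠ b → ∀ m' ∈ (F b').1, m'.1 = l.1 →
          IsLoose F n (V ∪ clauseVars (F b)) b' m' :=
        hloose.2 l hlF (mem_erase.mp hl).1
      refine ih.field hβ t (V ∪ clauseVars (F b)) U (Q l) b l hlF (hbW (fst_mem_clauseVars hlF))
        hbW ?_ (fun l' hl' h => hcons l' ?_ ?_) ?_ ?_ ?_ hbU hchild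
      · intro l' hl' h
        rcases mem_union.mp ((hQ1 l hl).2 hl') with h2 | h2
        · exact hPL l hl l' h2 h
        · exact (mem_erase.mp h2).1 (hLinj (mem_erase.mp h2).2 hl h)
      · exact (union_subset_union_right (erase_subset _ _)) ((hQ1 l hl).2 hl')
      · exact (union_subset_union_right (erase_subset _ _)) ((hQ1 l hl).2 h)
      · intro l' hl'
        rcases mem_union.mp ((hQ1 l hl).2 hl') with h2 | h2
        · exact mem_union_left _ (hPV l' h2)
        · exact hbW (fst_mem_clauseVars (mem_erase.mp (mem_erase.mp h2).2).2)
      · intro b' hne hd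
        exact hU b' hne (hd.mono_right subset_union_left)
      -- A clause entered through `l` may not touch `V`, by looseness, unless through the entering
      -- literal, whose variable is outside `V`. It is therefore one of the clauses that `U` is
      -- known to contain.
      · intro b' hne hv
        refine hU b' hne (disjoint_left.mpr fun i hi hiV => ?_)
        obtain ⟨m', hm', hml⟩ := mem_clauseVars.mp hv
        obtain ⟨m'', hm'', hmi⟩ := mem_clauseVars.mp hi
        have := (hchild b' hne m' hm' hml).entry m'' hm'' (hmi ▸ mem_union_left _ hiV)
        rw [this, hml] at hmi
        exact hLV l hl (hmi ▸ hiV)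
    have hpur1 : ∀ l ∈ L, violProb (gibbsField (1 - Real.exp (-β)) F U (Q l) l) ≤
        purityWeight F l := by
      intro l hl
      refine violProb_le_purityWeight F l fun hno => ?_
      refine gibbsField_nonneg h0 h1 F U (fun l' hl' h => hcons l' ?_ ?_) l ?_ fun b' _ => hno b'
      · exact (union_subset_union_right (erase_subset _ _)) ((hQ1 l hl).2 hl')
      · exact (union_subset_union_right (erase_subset _ _)) ((hQ1 l hl).2 h)
      · intro l' hl' h
        rcases mem_union.mp ((hQ1 l hl).2 hl') with h2 | h2
        · exact hPL l hl l' h2 h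
        · exact (mem_erase.mp h2).1 (hLinj (mem_erase.mp h2).2 hl h)
    have hpur2 : ∀ l ∈ L, violProb (bpMsg β F (t + n + 1) b l) ≤ purityWeight F l := fun l _ =>
      violProb_le_purityWeight F l fun hno => bpMsg_nonneg hβ F _ b l hno
    rw [gibbsMsg, hunion, hQ2, bpClauseMsg_eq β F _ b hmb, ← add_assoc t n 1]
    refine (abs_clauseMsg_sub_le L (purityWeight F)
      (fun l => gibbsField (1 - Real.exp (-β)) F U (Q l) l)
      (fun l => bpMsg β F (t + n + 1) b l) hpur1 hpur2 h0 h1).trans ?_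
    have hw : 0 ≤ ∏ l ∈ L, purityWeight F l := prod_nonneg fun l _ => purityWeight_nonneg F l
    refine (mul_le_mul (mul_le_of_le_one_left hw h1.le) (sum_le_sum hfield)
      (sum_nonneg fun _ _ => abs_nonneg _) hw).trans (le_of_eq ?_)
    rw [walkWeight, ← mul_sum, ← hL]
    simp only [← mul_sum]
    ring

end Comparison

/-! ### Loose neighbourhoods and the diameter of the factor graph -/

section NonbacktrackingWalks
open Finset BigOperators

variable {k N M : ℕ}

/-- There is a nonbacktracking walk of `p` clauses after `a` that enters its last clause `b`
through the literal `m`. -/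
inductive NBWalk (F : SatFormula k N M) (a : Fin M) : ℕ → Fin M → SatLiteral N → Prop
  | start {l m : SatLiteral N} {b : Fin M} (hl : l ∈ (F a).1) (hb : b ≠ a) (hm : m ∈ (F b).1)
      (h : m.1 = l.1) : NBWalk F a 1 b m
  | step {p : ℕ} {b b' : Fin M} {m l m' : SatLiteral N} (hw : NBWalk F a p b m)
      (hl : l ∈ (F b).1) (hlm : l ≠ m) (hb : b' ≠ b) (hm : m' ∈ (F b').1) (h : m'.1 = l.1) :
      NBWalk F a (p + 1) b' m'

/-- There is a walk of `s` steps from the clause `b` to the clause `a`. -/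
inductive ClauseWalk (F : SatFormula k N M) (a : Fin M) : ℕ → Fin M → Prop
  | refl : ClauseWalk F a 0 a
  | step {s : ℕ} {b g : Fin M} {l m : SatLiteral N} (hl : l ∈ (F b).1) (hm : m ∈ (F g).1)
      (h : m.1 = l.1) (hw : ClauseWalk F a s g) : ClauseWalk F a (s + 1) b

variable {F : SatFormula k N M} {a : Fin M}

theorem NBWalk.exists_isLoose {n p : ℕ} {b : Fin M} {m : SatLiteral N} (hF : IsLooseAt F n a)
    (h : NBWalk F a p b m) (hp : p ≤ n + 1) :
    ∃ V, clauseVars (F a) ⊆ V ∧ IsLoose F (n + 1 - p) V b m := by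
  induction h with
  | start hl hb hm h => exact ⟨_, Subset.rfl, hF _ hl _ hb _ hm h⟩
  | @step p b b' m l m' hw hl hlm hb hm h ih =>
    obtain ⟨V, hV, hL⟩ := ih (by omega)
    rw [show n + 1 - p = (n + 1 - (p + 1)) + 1 by omega] at hL
    exact ⟨_, hV.trans subset_union_left, hL.2 l hl hlm b' hb m' hm h⟩

/-- If the walk returned to `a`, looseness would force every literal of `a` to be the entering one,
against k ≥ 2. -/
theorem NBWalk.ne (hk : 2 ≤ k) {n p : ℕ} {b : Fin M} {m : SatLiteral N} (hF : IsLooseAt F n a)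
    (h : NBWalk F a p b m) (hp : p ≤ n + 1) : b ≠ a := by
  rintro rfl
  obtain ⟨V, hV, hL⟩ := h.exists_isLoose hF hp
  have h1 : (F b).1 ⊆ {m} := fun l hl =>
    mem_singleton.mpr (hL.entry l hl (hV (fst_mem_clauseVars hl)))
  have := card_le_card h1
  rw [(F b).2.1, card_singleton] at this
  omega

/-- In a loose neighbourhood, the end of a nonbacktracking walk of length `p` has distance at least
`p` from its start. -/
theorem NBWalk.not_clauseWalk (hk : 2 ≤ k) {n : ℕ} (hF : IsLooseAt F n a) {s p : ℕ} {b : Fin M}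
    {m : SatLiteral N} (h : NBWalk F a p b m) (hsp : s < p) (hn : p + s ≤ n + 1) :
    ¬ ClauseWalk F a s b := by
  induction s generalizing p b m with
  | zero =>
    intro hw
    cases hw
    exact h.ne hk hF (by omega) rfl
  | succ s ih =>
    intro hw
    cases hw with
    -- The first step towards `a` goes to `g`. If it leaves `b` through a literal other than `m`, it
    -- prolongs the nonbacktracking walk. If it leaves through `m`, then `g` is the predecessor of
    -- `b`, or it can replace `b` as the last clause. In each case the gap between `p` and `s` stays
    -- positive and `p + s` does not grow.
    | @step _ _ g l m' hl hm hml hw =>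
      by_cases hg : g = b
      · subst hg
        exact ih h (by omega) (by omega) hw
      by_cases hlm : l = m
      · subst hlm
        cases h with
        | start => omega
        | @step p b₀ _ m₀ l₀ _ hw₀ hl₀ hlm₀ hb₀ hm₀ h₀ =>
          by_cases hg₀ : g = b₀
          · subst hg₀
            exact ih hw₀ (by omega) (by omega) hw
          · exact ih (hw₀.step hl₀ hlm₀ hg₀ hm (hml.trans h₀)) (by omega) (by omega) hw
      · exact ih (h.step hl hlm hg hm hml) (by omega) (by omega) hw

theorem factorGraph_adj_inl {b : Fin M} {x : Fin N ⊕ Fin M}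
    (h : (factorGraph F).Adj (Sum.inr b) x) : ∃ l ∈ (F b).1, x = Sum.inl l.1 := by
  rw [factorGraph, SimpleGraph.fromRel_adj] at h
  obtain ⟨_, ⟨i, c, s, h1, h2, h3⟩ | ⟨i, c, s, h1, h2, h3⟩⟩ := h
  · cases h1
  · cases h2
    exact ⟨(i, s), h3, h1⟩

theorem factorGraph_adj {b : Fin M} {l : SatLiteral N} (h : l ∈ (F b).1) :
    (factorGraph F).Adj (Sum.inr b) (Sum.inl l.1) := by
  rw [factorGraph, SimpleGraph.fromRel_adj]
  exact ⟨Sum.inr_ne_inl, Or.inr ⟨l.1, b, l.2, rfl, rfl, h⟩⟩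

theorem factorGraph_adj_inr {i : Fin N} {x : Fin N ⊕ Fin M}
    (h : (factorGraph F).Adj (Sum.inl i) x) : ∃ b, ∃ l ∈ (F b).1, x = Sum.inr b ∧ l.1 = i := by
  rw [factorGraph, SimpleGraph.fromRel_adj] at h
  obtain ⟨_, ⟨i, c, s, h1, h2, h3⟩ | ⟨i, c, s, h1, h2, h3⟩⟩ := h
  · cases h1
    exact ⟨c, (_, s), h3, h2, rfl⟩
  · cases h2

/-- The graph is bipartite, so two of its edges make one step between clauses. -/
theorem exists_clauseWalk_of_walk (L : ℕ) : ∀ (b : Fin M)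
    (w : (factorGraph F).Walk (Sum.inr b) (Sum.inr a)), w.length ≤ L →
    ∃ s, 2 * s ≤ L ∧ ClauseWalk F a s b := by
  induction L using Nat.strong_induction_on with
  | _ L ih =>
    intro b w hw
    cases w with
    | nil => exact ⟨0, by omega, ClauseWalk.refl⟩
    | cons h w =>
      obtain ⟨l, hl, rfl⟩ := factorGraph_adj_inl h
      cases w with
      | cons h' w =>
        obtain ⟨g, m, hm, rfl, hml⟩ := factorGraph_adj_inr h'
        simp only [SimpleGraph.Walk.length_cons] at hw
        obtain ⟨s, hs, hcw⟩ := ih (L - 2) (by omega) g w (by omega)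
        exact ⟨s + 1, by omega, ClauseWalk.step hl hm hml hcw⟩

theorem NBWalk.reachable {p : ℕ} {b : Fin M} {m : SatLiteral N} (h : NBWalk F a p b m) :
    (factorGraph F).Reachable (Sum.inr b) (Sum.inr a) := by
  induction h with
  | start hl hb hm h =>
    refine (factorGraph_adj hm).reachable.trans ?_
    rw [h]
    exact (factorGraph_adj hl).reachable.symm
  | step hw hl hlm hb hm h ih =>
    refine (factorGraph_adj hm).reachable.trans ?_
    rw [h]
    exact (factorGraph_adj hl).reachable.symm.trans ih

theorem dist_le_factorDiam (F : SatFormula k N M) (p q : Fin N ⊕ Fin M) :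
    (factorGraph F).dist p q ≤ factorDiam F :=
  le_sup (f := fun p : (Fin N ⊕ Fin M) × (Fin N ⊕ Fin M) => (factorGraph F).dist p.1 p.2)
    (mem_univ (p, q))

theorem factorDiam_pos (hk : 2 ≤ k) (F : SatFormula k N M) (a : Fin M) : 0 < factorDiam F := by
  obtain ⟨l, hl⟩ : (F a).1.Nonempty := card_pos.mp (by rw [(F a).2.1]; omega)
  have h := SimpleGraph.dist_eq_one_iff_adj.mpr (factorGraph_adj hl)
  have := dist_le_factorDiam F (Sum.inr a) (Sum.inl l.1)
  omega

/-- The end of such a walk would be at least as many clause steps from `a` as the diameter, thus at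
twice that graph distance. This contradicts the diameter being the largest distance, as it is
positive. -/
theorem not_nbWalk_factorDiam (hk : 2 ≤ k) {n : ℕ} (hF : IsLooseAt F n a)
    (hn : 2 * factorDiam F ≤ n + 1) (b : Fin M) (m : SatLiteral N) :
    ¬ NBWalk F a (factorDiam F) b m := by
  intro h
  obtain ⟨w, hw⟩ := h.reachable.exists_walk_length_eq_dist
  have h1 := dist_le_factorDiam F (Sum.inr b) (Sum.inr a)
  obtain ⟨s, hs, hcw⟩ := exists_clauseWalk_of_walk (factorDiam F) b w (hw.trans_le h1)
  have := factorDiam_pos hk F a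
  exact h.not_clauseWalk hk hF (by omega) (by omega) hcw

theorem NBWalk.walkWeight_eq_zero {n p : ℕ} {b : Fin M} {m : SatLiteral N}
    (h : NBWalk F a p b m) (hno : ∀ b m, ¬ NBWalk F a (p + n) b m) : walkWeight F n b m = 0 := by
  induction n generalizing p b m with
  | zero => exact absurd h (hno b m)
  | succ n ih =>
    rw [walkWeight]
    refine sum_eq_zero fun l hl => sum_eq_zero fun b' hb' => sum_eq_zero fun m' hm' => ?_
    rw [mem_litsOn] at hm'
    rw [mem_erase] at hl hb'
    rw [ih (h.step hl.2 hl.1 hb'.1 hm'.1 hm'.2) fun b m => by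
      rw [show p + 1 + n = p + (n + 1) by omega]; exact hno b m, mul_zero]

theorem walkWeightAt_eq_zero {n : ℕ} (hno : ∀ b m, ¬ NBWalk F a (n + 1) b m) :
    walkWeightAt F n a = 0 := by
  refine sum_eq_zero fun l hl => sum_eq_zero fun b' hb' => sum_eq_zero fun m' hm' => ?_
  rw [mem_litsOn] at hm'
  exact (NBWalk.start hl (mem_erase.mp hb').1 hm'.1 hm'.2).walkWeight_eq_zero fun b m => by
    rw [add_comm]; exact hno b m

theorem IsLoose.mono {n n' : ℕ} (hn : n' ≤ n) {V : Finset (Fin N)} {b : Fin M}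
    {m : SatLiteral N} (h : IsLoose F n V b m) : IsLoose F n' V b m := by
  induction n' generalizing n V b m with
  | zero => exact h.entry
  | succ n' ih =>
    obtain ⟨j, rfl⟩ := Nat.exists_eq_add_of_le hn
    rw [show n' + 1 + j = (n' + j) + 1 by omega] at h
    exact ⟨h.1, fun l hl hlm b' hb' m' hm' hml =>
      ih (Nat.le_add_right _ _) (h.2 l hl hlm b' hb' m' hm' hml)⟩

theorem IsLooseAt.mono {n n' : ℕ} (hn : n' ≤ n) (h : IsLooseAt F n a) : IsLooseAt F n' a :=
  fun l hl b hb m hm hml => (h l hl b hb m hm hml).mono hn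

end NonbacktrackingWalks

/-! ### The probability that a clause is violated -/

section ClauseViolation
open Finset BigOperators

variable {k N M : ℕ}

/-- The partition function at inverse temperature `β`. -/
noncomputable def gibbsZ (β : ℝ) (F : SatFormula k N M) : ℝ :=
  ∑ x : Fin N → Bool, Real.exp (-β * violations F x)

/-- The Gibbs probability that the clause `a` is violated. -/
noncomputable def gibbsViolation (β : ℝ) (F : SatFormula k N M) (a : Fin M) : ℝ :=
  (∑ x : Fin N → Bool with ∀ l ∈ (F a).1, x l.1 ≠ l.2, Real.exp (-β * violations F x)) /
    gibbsZ β F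

theorem exp_violations (β : ℝ) (F : SatFormula k N M) (x : Fin N → Bool) :
    Real.exp (-β * violations F x) = ∏ b, clauseFactor (1 - Real.exp (-β)) (F b) x := by
  unfold violations clauseFactor
  rw [prod_ite, prod_const_one, mul_one, prod_const, sub_sub_cancel, ← Real.exp_nat_mul, mul_comm]

theorem gibbsZ_pos (β : ℝ) (F : SatFormula k N M) : 0 < gibbsZ β F :=
  sum_pos (fun _ _ => Real.exp_pos _) univ_nonempty

/-- Here r is the probability, with the clause `a` removed, that all its literals are false. The
belief propagation estimate is the same function of a product of `violProb`s, so only the two values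
of r have to be compared. -/
theorem gibbsViolation_eq {β : ℝ} (hβ : 0 ≤ β) (F : SatFormula k N M) (a : Fin M) {r : ℝ}
    (hr : partialZ (1 - Real.exp (-β)) F (univ.erase a) (F a).1 /
      partialZ (1 - Real.exp (-β)) F (univ.erase a) ∅ = r) :
    gibbsViolation β F a = Real.exp (-β) * r / (1 - (1 - Real.exp (-β)) * r) := by
  obtain ⟨h0, h1⟩ := one_sub_exp_neg_mem hβ
  have hZ0 := partialZ_pos h1 F (univ.erase a) (P := ∅) (by simp)
  have hins : insert a (univ.erase a) = univ := insert_erase (mem_univ a)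
  have hZ : gibbsZ β F = partialZ (1 - Real.exp (-β)) F (univ.erase a) ∅ *
      (1 - (1 - Real.exp (-β)) * r) := by
    have e : gibbsZ β F = partialZ (1 - Real.exp (-β)) F univ ∅ := by
      unfold gibbsZ partialZ
      simp only [exp_violations]
      simp
    rw [e]
    conv_lhs => rw [← hins]
    rw [partialZ_insert_clause _ F (notMem_erase a univ), empty_union, ← hr]
    field_simp
  have hnum : ∑ x : Fin N → Bool with ∀ l ∈ (F a).1, x l.1 ≠ l.2,
      Real.exp (-β * violations F x) = Real.exp (-β) *
        (partialZ (1 - Real.exp (-β)) F (univ.erase a) ∅ * r) := by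
    rw [← hr, mul_div_cancel₀ _ hZ0.ne', partialZ, mul_sum]
    refine sum_congr rfl fun x hx => ?_
    rw [exp_violations, ← mul_prod_erase univ _ (mem_univ a), clauseFactor,
      if_pos (mem_filter.mp hx).2, sub_sub_cancel]
  rw [gibbsViolation, hnum, hZ, mul_left_comm, mul_div_mul_left _ _ hZ0.ne']

theorem bpViolation_eq (β : ℝ) (F : SatFormula k N M) (a : Fin M) {r : ℝ}
    (hr : ∏ l ∈ (F a).1, violProb (bpMsg β F (factorDiam F) a l) = r) :
    bpViolation β F a = Real.exp (-β) * r / (1 - (1 - Real.exp (-β)) * r) := by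
  set h := bpMsg β F (factorDiam F) a with hh
  set y₀ : {l // l ∈ (F a).1} → Bool := fun l => !l.1.2 with hy₀
  have hviol : ∀ y : {l // l ∈ (F a).1} → Bool,
      localViolation (F a) y = if y = y₀ then 1 else 0 := by
    intro y
    unfold localViolation
    have : (∀ l : {l // l ∈ (F a).1}, y l ≠ l.1.2) ↔ y = y₀ := by
      rw [funext_iff]
      refine forall_congr' fun l => ?_
      rw [hy₀]
      cases hy : y l <;> cases hl : l.1.2 <;> simp [hl]
    simp only [this]
  set w : ({l // l ∈ (F a).1} → Bool) → ℝ := fun y =>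
    ∏ l : {l // l ∈ (F a).1}, Real.exp (h l.1 * (if y l = l.1.2 then 1 else -1)) with hw
  have hloc : ∀ y, localWeight β (F a) h y =
      w y - (if y = y₀ then (1 - Real.exp (-β)) * w y else 0) := by
    intro y
    unfold localWeight
    rw [Real.exp_add, Real.exp_sum, hviol]
    split_ifs
    · rw [mul_one]
      ring
    · simp [hw]
  have hw₀ : w y₀ = ∏ l ∈ (F a).1, Real.exp (-(h l)) := by
    rw [hw, ← prod_coe_sort (F a).1]
    refine prod_congr rfl fun l _ => ?_
    congr 1
    simp [hy₀]
  have hsum : ∑ y, w y = ∏ l ∈ (F a).1, (Real.exp (h l) + Real.exp (-(h l))) := by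
    rw [hw, ← Fintype.piFinset_univ, ← prod_univ_sum (fun _ => univ)
      (fun (l : {l // l ∈ (F a).1}) s => Real.exp (h l.1 * (if s = l.1.2 then 1 else -1))),
      ← prod_coe_sort (F a).1]
    refine prod_congr rfl fun l _ => ?_
    rw [Fintype.sum_bool]
    cases l.1.2
    · simp [add_comm]
    · simp
  have hS : 0 < ∏ l ∈ (F a).1, (Real.exp (h l) + Real.exp (-(h l))) :=
    prod_pos fun l _ => by positivity
  have hr' : w y₀ = r * ∏ l ∈ (F a).1, (Real.exp (h l) + Real.exp (-(h l))) := by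
    rw [hw₀, ← hr, ← prod_mul_distrib]
    refine prod_congr rfl fun l _ => ?_
    rw [violProb_eq, show Real.exp (2 * h l) = Real.exp (h l) * Real.exp (h l) by
      rw [← Real.exp_add]; ring_nf, Real.exp_neg]
    have := Real.exp_pos (h l)
    field_simp
    ring
  have hden : ∑ y, localWeight β (F a) h y =
      (∏ l ∈ (F a).1, (Real.exp (h l) + Real.exp (-(h l)))) *
        (1 - (1 - Real.exp (-β)) * r) := by
    simp only [hloc]
    rw [sum_sub_distrib, hsum, sum_ite_eq' univ y₀, if_pos (mem_univ _), hr']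
    ring
  have hnum : ∑ y, localViolation (F a) y * localWeight β (F a) h y =
      (∏ l ∈ (F a).1, (Real.exp (h l) + Real.exp (-(h l)))) * (Real.exp (-β) * r) := by
    simp only [hviol, ite_mul, one_mul, zero_mul]
    rw [sum_ite_eq' univ y₀, if_pos (mem_univ _), hloc, if_pos rfl, hr']
    ring
  rw [bpViolation, hnum, hden, mul_div_mul_left _ _ hS.ne']

theorem abs_violProb_sub_le (x y : ℝ) : |violProb x - violProb y| ≤ |x - y| := by
  have := convex_univ.norm_image_sub_le_of_norm_hasDerivWithin_le (f := violProb) (C := 1)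
    (fun z _ => (hasDerivAt_violProb z).hasDerivWithinAt) (fun z _ => by
      have h0 := (violProb_pos z).le
      have h1 := violProb_le_one z
      rw [norm_neg, Real.norm_eq_abs, abs_of_nonneg (by
        have : 0 ≤ 1 - violProb z := by linarith
        positivity)]
      nlinarith [sq_nonneg (2 * violProb z - 1)]) (Set.mem_univ y) (Set.mem_univ x)
  simpa [Real.norm_eq_abs] using this

theorem abs_prod_violProb_sub_le {κ : Type*} (L : Finset κ) (x y : κ → ℝ) :
    |∏ l ∈ L, violProb (x l) - ∏ l ∈ L, violProb (y l)| ≤ ∑ l ∈ L, |x l - y l| := by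
  classical
  induction L using Finset.induction_on with
  | empty => simp
  | insert l L hl ih =>
    rw [prod_insert hl, prod_insert hl, sum_insert hl]
    have h1 := abs_violProb_sub_le (x l) (y l)
    have h2 := prod_violProb_mem_Icc L x
    have h3 := (violProb_pos (y l)).le
    have h4 := violProb_le_one (y l)
    set X := ∏ j ∈ L, violProb (x j)
    set Y := ∏ j ∈ L, violProb (y j)
    have e : violProb (x l) * X - violProb (y l) * Y =
        (violProb (x l) - violProb (y l)) * X + violProb (y l) * (X - Y) := by ring
    rw [e]
    refine (abs_add_le _ _).trans (add_le_add ?_ ?_)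
    · rw [abs_mul, abs_of_nonneg h2.1]
      exact (mul_le_of_le_one_right (abs_nonneg _) h2.2).trans h1
    · rw [abs_mul, abs_of_nonneg h3]
      exact (mul_le_of_le_one_left (abs_nonneg _) h4).trans ih

/-- The difference of the fractions is e^{-β}(r - s) divided by the product of the denominators, and
each denominator is at least e^{-β}. -/
theorem abs_violation_sub_le {β r s : ℝ} (hβ : 0 ≤ β) (hr : r ∈ Set.Icc (0 : ℝ) 1)
    (hs : s ∈ Set.Icc (0 : ℝ) 1) :
    |Real.exp (-β) * r / (1 - (1 - Real.exp (-β)) * r) -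
      Real.exp (-β) * s / (1 - (1 - Real.exp (-β)) * s)| ≤ Real.exp β * |r - s| := by
  obtain ⟨h0, h1⟩ := one_sub_exp_neg_mem hβ
  have he := Real.exp_pos (-β)
  have hbd : ∀ r ∈ Set.Icc (0 : ℝ) 1, Real.exp (-β) ≤ 1 - (1 - Real.exp (-β)) * r := by
    intro r hr
    have := mul_le_of_le_one_right h0 hr.2
    linarith
  have hR := hbd r hr
  have hS := hbd s hs
  set R := 1 - (1 - Real.exp (-β)) * r with hRdef
  set S := 1 - (1 - Real.exp (-β)) * s with hSdef
  have hR0 : 0 < R := he.trans_le hR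
  have hS0 : 0 < S := he.trans_le hS
  have e : Real.exp (-β) * r / R - Real.exp (-β) * s / S =
      Real.exp (-β) * (r - s) / (R * S) := by
    rw [div_sub_div _ _ hR0.ne' hS0.ne']
    congr 1
    rw [hRdef, hSdef]
    ring
  rw [e, abs_div, abs_mul, abs_of_pos he, abs_of_pos (mul_pos hR0 hS0),
    div_le_iff₀ (mul_pos hR0 hS0)]
  have h2 : Real.exp (-β) * Real.exp (-β) ≤ R * S := mul_le_mul hR hS he.le hR0.le
  have h3 : Real.exp β * Real.exp (-β) = 1 := by rw [← Real.exp_add]; simp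
  have h4 : Real.exp (-β) ≤ Real.exp β * (R * S) := by
    calc Real.exp (-β) = Real.exp β * (Real.exp (-β) * Real.exp (-β)) := by
          rw [← mul_assoc, h3, one_mul]
      _ ≤ _ := mul_le_mul_of_nonneg_left h2 (Real.exp_pos β).le
  calc Real.exp (-β) * |r - s| ≤ Real.exp β * (R * S) * |r - s| :=
        mul_le_mul_of_nonneg_right h4 (abs_nonneg _)
    _ = _ := by ring

theorem abs_gibbsViolation_sub_bpViolation_le_of_eq {β : ℝ} (hβ : 0 ≤ β) {F : SatFormula k N M}
    {n t : ℕ} {a : Fin M} (hF : IsLooseAt F n a) (ht : factorDiam F = t + n + 1) :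
    |gibbsViolation β F a - bpViolation β F a| ≤ Real.exp β * (β / 2 * walkWeightAt F n a) := by
  obtain ⟨h0, h1⟩ := one_sub_exp_neg_mem hβ
  have hcons : ∀ l ∈ (∅ : Finset (SatLiteral N)) ∪ (F a).1,
      negLit l ∉ (∅ : Finset (SatLiteral N)) ∪ (F a).1 := by
    intro l hl
    rw [empty_union] at hl ⊢
    exact (F a).negLit_notMem hl
  obtain ⟨Q, hQ1, hQ2⟩ := exists_partialZ_union_div_eq h1 F (univ.erase a) (F a).1 hcons
    (by simp) (F a).2.2
  rw [empty_union] at hQ2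
  rw [gibbsViolation_eq hβ F a hQ2, bpViolation_eq β F a rfl]
  refine (abs_violation_sub_le hβ (prod_violProb_mem_Icc _ _) (prod_violProb_mem_Icc _ _)).trans ?_
  refine mul_le_mul_of_nonneg_left ((abs_prod_violProb_sub_le _ _ _).trans ?_) (Real.exp_pos β).le
  rw [walkWeightAt, mul_sum]
  refine sum_le_sum fun l hl => ?_
  rw [ht]
  have hQ : ∀ l' ∈ Q l, l' ∈ (F a).1 ∧ l' ≠ l := fun l' hl' => by
    have := (hQ1 l hl).2 hl'
    rw [empty_union, mem_erase] at this
    exact ⟨this.2, this.1⟩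
  refine (msgComparison hβ F n).field hβ t (clauseVars (F a)) (univ.erase a) (Q l) a l hl
    (fst_mem_clauseVars hl) Subset.rfl ?_ ?_ ?_ ?_ ?_ (notMem_erase _ _) (hF l hl)
  · exact fun l' hl' h => (hQ l' hl').2 ((F a).eq_of_fst_eq (hQ l' hl').1 hl h)
  · exact fun l' hl' h => (F a).negLit_notMem (hQ l' hl').1 (hQ _ h).1
  · exact fun l' hl' => fst_mem_clauseVars (hQ l' hl').1
  · exact fun b' hb' _ => mem_erase.mpr ⟨hb', mem_univ _⟩
  · exact fun b' hb' _ => mem_erase.mpr ⟨hb', mem_univ _⟩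

/-- If the diameter exceeds n, enough iterations have been made for depth n. Otherwise the depth is
taken to be the diameter minus one: a loose neighbourhood of radius 2n has no walk as long as the
diameter, the weight is zero, and the estimate is exact. -/
theorem abs_gibbsViolation_sub_bpViolation_le (hk : 2 ≤ k) {β : ℝ} (hβ : 0 ≤ β)
    {F : SatFormula k N M} {n : ℕ} {a : Fin M} (hF : IsLooseAt F (2 * n) a) :
    |gibbsViolation β F a - bpViolation β F a| ≤ Real.exp β * (β / 2 * walkWeightAt F n a) := by
  by_cases hn : n + 1 ≤ factorDiam F
  · exact abs_gibbsViolation_sub_bpViolation_le_of_eq hβ (hF.mono (by omega))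
      (t := factorDiam F - (n + 1)) (by omega)
  · have hpos := factorDiam_pos hk F a
    have h := abs_gibbsViolation_sub_bpViolation_le_of_eq hβ
      (hF.mono (show factorDiam F - 1 ≤ 2 * n by omega)) (t := 0) (by omega)
    rw [walkWeightAt_eq_zero (fun b m => by
      rw [show factorDiam F - 1 + 1 = factorDiam F by omega]
      exact not_nbWalk_factorDiam hk hF (by omega) b m), mul_zero, mul_zero] at h
    refine h.trans ?_
    have := walkWeightAt_nonneg F n a
    positivity

end ClauseViolation

/-! ### Integration over the temperature -/

section LogPartition
open Finset BigOperators

variable {k N M : ℕ}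

theorem gibbsViolation_mem_Icc (β : ℝ) (F : SatFormula k N M) (a : Fin M) :
    gibbsViolation β F a ∈ Set.Icc (0 : ℝ) 1 := by
  have hZ := gibbsZ_pos β F
  refine ⟨div_nonneg (sum_nonneg fun _ _ => (Real.exp_pos _).le) hZ.le, ?_⟩
  exact div_le_one_of_le₀ (sum_le_sum_of_subset_of_nonneg (filter_subset _ _)
    fun _ _ _ => (Real.exp_pos _).le) hZ.le

theorem bpViolation_mem_Icc (β : ℝ) (F : SatFormula k N M) (a : Fin M) :
    bpViolation β F a ∈ Set.Icc (0 : ℝ) 1 := by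
  have h01 : ∀ y, 0 ≤ localViolation (F a) y ∧ localViolation (F a) y ≤ 1 := fun y => by
    unfold localViolation
    split_ifs <;> norm_num
  refine ⟨div_nonneg (sum_nonneg fun y _ => mul_nonneg (h01 y).1 (Real.exp_pos _).le)
    (sum_nonneg fun _ _ => (Real.exp_pos _).le), ?_⟩
  exact div_le_one_of_le₀ (sum_le_sum fun y _ =>
    mul_le_of_le_one_left (Real.exp_pos _).le (h01 y).2) (sum_nonneg fun _ _ => (Real.exp_pos _).le)

/-- The Gibbs average of the number of violated clauses. -/
noncomputable def gibbsEnergy (β : ℝ) (F : SatFormula k N M) : ℝ := ∑ a, gibbsViolation β F a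

theorem gibbsEnergy_mul_gibbsZ (β : ℝ) (F : SatFormula k N M) :
    gibbsEnergy β F * gibbsZ β F =
      ∑ x : Fin N → Bool, violations F x * Real.exp (-β * violations F x) := by
  have hZ := gibbsZ_pos β F
  rw [gibbsEnergy, sum_mul]
  simp only [gibbsViolation, div_mul_cancel₀ _ hZ.ne']
  simp only [sum_filter]
  rw [sum_comm]
  refine sum_congr rfl fun x _ => ?_
  rw [← sum_filter, sum_const, nsmul_eq_mul]
  rfl

theorem gibbsEnergy_mem_Icc (β : ℝ) (F : SatFormula k N M) :
    gibbsEnergy β F ∈ Set.Icc (0 : ℝ) M := by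
  refine ⟨sum_nonneg fun a _ => (gibbsViolation_mem_Icc β F a).1, ?_⟩
  refine (sum_le_sum fun a _ => (gibbsViolation_mem_Icc β F a).2).trans ?_
  simp

/-- Convexity of the logarithm of the partition function. -/
theorem log_gibbsZ_sub_le (β γ : ℝ) (F : SatFormula k N M) :
    Real.log (gibbsZ β F) - (γ - β) * gibbsEnergy β F ≤ Real.log (gibbsZ γ F) := by
  have hβ := gibbsZ_pos β F
  set E := gibbsEnergy β F with hE
  have h : Real.exp (-((γ - β) * E)) * gibbsZ β F ≤ gibbsZ γ F := by
    have h1 : gibbsZ β F = ∑ x : Fin N → Bool,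
        Real.exp (-β * violations F x) * (-(γ - β) * (violations F x - E) + 1) := by
      have h2 : ∀ x : Fin N → Bool,
          Real.exp (-β * violations F x) * (-(γ - β) * (violations F x - E) + 1) =
          Real.exp (-β * violations F x) + (γ - β) * (E * Real.exp (-β * violations F x) -
            violations F x * Real.exp (-β * violations F x)) := fun x => by ring
      simp only [h2]
      rw [sum_add_distrib, ← mul_sum, sum_sub_distrib, ← mul_sum, ← gibbsEnergy_mul_gibbsZ, ← hE]
      change _ = gibbsZ β F + (γ - β) * (E * gibbsZ β F - E * gibbsZ β F)
      ring
    conv_lhs => rw [h1]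
    rw [mul_sum]
    refine sum_le_sum fun x _ => ?_
    have e : Real.exp (-γ * violations F x) = Real.exp (-((γ - β) * E)) *
        (Real.exp (-β * violations F x) * Real.exp (-(γ - β) * (violations F x - E))) := by
      rw [← Real.exp_add, ← Real.exp_add]
      congr 1
      ring
    rw [e]
    gcongr
    exact Real.add_one_le_exp _
  have := Real.log_le_log (by positivity) h
  rw [Real.log_mul (Real.exp_pos _).ne' hβ.ne', Real.log_exp] at this
  linarith

theorem gibbsZ_zero (F : SatFormula k N M) : gibbsZ 0 F = 2 ^ N := by
  simp [gibbsZ]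

/-- Convexity encloses each increment of log Z between the energies at the two ends of its interval.
The upper and lower sums share the terms 1, …, n - 1, and each boundary term is between 0 and βM/n.
-/
theorem abs_log_gibbsZ_sub_sum_le {β : ℝ} (hβ : 0 ≤ β) {n : ℕ} (hn : 0 < n)
    (F : SatFormula k N M) :
    |Real.log (gibbsZ β F) - (N * Real.log 2 -
      ∑ i ∈ Ico 1 n, β / n * gibbsEnergy (i * β / n) F)| ≤ β / n * M := by
  have hn' : (0 : ℝ) < n := by exact_mod_cast hn
  set e : ℕ → ℝ := fun i => gibbsEnergy (i * β / n) F with he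
  set L : ℕ → ℝ := fun i => Real.log (gibbsZ (i * β / n) F) with hL
  have hstep : ∀ i : ℕ, ((i + 1 : ℕ) : ℝ) * β / n - i * β / n = β / n := by
    intro i
    push_cast
    ring
  have h1 : ∀ i, -(β / n * e i) ≤ L (i + 1) - L i := by
    intro i
    have := log_gibbsZ_sub_le (i * β / n) ((i + 1 : ℕ) * β / n) F
    rw [hstep] at this
    simp only [hL, he]
    linarith
  have h2 : ∀ i, L (i + 1) - L i ≤ -(β / n * e (i + 1)) := by
    intro i
    have := log_gibbsZ_sub_le ((i + 1 : ℕ) * β / n) (i * β / n) F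
    rw [show (i : ℝ) * β / n - (i + 1 : ℕ) * β / n = -(β / n) by rw [← hstep i]; ring] at this
    simp only [hL, he]
    linarith
  have hLn : L n = Real.log (gibbsZ β F) := by
    simp only [hL]
    rw [mul_div_cancel_left₀ _ hn'.ne']
  have hL0 : L 0 = N * Real.log 2 := by
    simp only [hL]
    rw [Nat.cast_zero, zero_mul, zero_div, gibbsZ_zero, Real.log_pow]
  have s1 : -∑ i ∈ range n, β / n * e i ≤ L n - L 0 := by
    rw [← sum_range_sub, ← sum_neg_distrib]
    exact sum_le_sum fun i _ => h1 i
  have s2 : L n - L 0 ≤ -∑ i ∈ range n, β / n * e (i + 1) := by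
    rw [← sum_range_sub, ← sum_neg_distrib]
    exact sum_le_sum fun i _ => h2 i
  have e1 : ∑ i ∈ range n, β / n * e i = β / n * e 0 + ∑ i ∈ Ico 1 n, β / n * e i := by
    rw [range_eq_Ico, sum_eq_sum_Ico_succ_bot hn]
  have e2 : ∑ i ∈ range n, β / n * e (i + 1) = ∑ i ∈ Ico 1 n, β / n * e i + β / n * e n := by
    rw [range_eq_Ico, sum_Ico_add' (fun i => β / n * e i) 0 n 1, zero_add,
      sum_Ico_succ_top (by omega)]
  have b0 := gibbsEnergy_mem_Icc ((0 : ℕ) * β / n) F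
  have bn := gibbsEnergy_mem_Icc (n * β / n) F
  have hd : 0 ≤ β / n := by positivity
  have c0 : β / n * e 0 ≤ β / n * M := mul_le_mul_of_nonneg_left b0.2 hd
  have c1 : 0 ≤ β / n * e n := mul_nonneg hd bn.1
  have c2 : 0 ≤ β / n * M := by positivity
  rw [← hLn, ← hL0, abs_le]
  constructor <;> linarith

theorem abs_log_gibbsZ_sub_bpLogPartition_le {β : ℝ} (hβ : 0 ≤ β) (hN : 0 < N)
    (F : SatFormula k N M) (err : Fin M → ℝ)
    (herr : ∀ γ ∈ Set.Icc 0 β, ∀ a, |gibbsViolation γ F a - bpViolation γ F a| ≤ err a) :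
    |Real.log (gibbsZ β F) - bpLogPartition β F| ≤ β / N ^ 2 * M + β * ∑ a, err a := by
  have hN' : (0 : ℝ) < (N : ℝ) ^ 2 := by positivity
  have h := abs_log_gibbsZ_sub_sum_le hβ (n := N ^ 2) (by positivity) F
  push_cast at h
  have herr0 : 0 ≤ ∑ a, err a := sum_nonneg fun a _ =>
    (abs_nonneg _).trans (herr 0 ⟨le_rfl, hβ⟩ a)
  have h2 : |∑ i ∈ Ico 1 (N ^ 2), β / (N : ℝ) ^ 2 * bpEnergy (i * β / (N : ℝ) ^ 2) F -
      ∑ i ∈ Ico 1 (N ^ 2), β / (N : ℝ) ^ 2 * gibbsEnergy (i * β / (N : ℝ) ^ 2) F| ≤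
      β * ∑ a, err a := by
    rw [← sum_sub_distrib]
    refine (abs_sum_le_sum_abs _ _).trans ?_
    have hterm : ∀ i ∈ Ico 1 (N ^ 2), |β / (N : ℝ) ^ 2 * bpEnergy (i * β / (N : ℝ) ^ 2) F -
        β / (N : ℝ) ^ 2 * gibbsEnergy (i * β / (N : ℝ) ^ 2) F| ≤
        β / (N : ℝ) ^ 2 * ∑ a, err a := by
      intro i hi
      rw [mem_Ico] at hi
      have hi' : (i : ℝ) ≤ (N : ℝ) ^ 2 := by exact_mod_cast hi.2.le
      rw [← mul_sub, abs_mul, abs_of_nonneg (by positivity : 0 ≤ β / (N : ℝ) ^ 2)]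
      refine mul_le_mul_of_nonneg_left ?_ (by positivity)
      rw [bpEnergy, gibbsEnergy, ← sum_sub_distrib]
      refine (abs_sum_le_sum_abs _ _).trans (sum_le_sum fun a _ => ?_)
      rw [abs_sub_comm]
      refine herr _ ⟨by positivity, ?_⟩ a
      rw [div_le_iff₀ hN', mul_comm β]
      exact mul_le_mul_of_nonneg_right hi' hβ
    refine (sum_le_sum hterm).trans ?_
    rw [sum_const, Nat.card_Ico, nsmul_eq_mul]
    have : ((N ^ 2 - 1 : ℕ) : ℝ) ≤ (N : ℝ) ^ 2 := by exact_mod_cast Nat.sub_le _ _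
    calc ((N ^ 2 - 1 : ℕ) : ℝ) * (β / (N : ℝ) ^ 2 * ∑ a, err a)
        ≤ (N : ℝ) ^ 2 * (β / (N : ℝ) ^ 2 * ∑ a, err a) := by gcongr
      _ = β * ∑ a, err a := by field_simp
  rw [bpLogPartition]
  rw [abs_le] at h h2 ⊢
  constructor <;> linarith [h.1, h.2, h2.1, h2.2]

/-- Needed when ε is bounded below; `β` may then be negative, so no comparison with the Gibbs
measure is used. -/
theorem abs_bpLogPartition_le (β : ℝ) (hN : 0 < N) (F : SatFormula k N M) :
    |bpLogPartition β F| ≤ N * Real.log 2 + |β| * M := by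
  have hN' : (0 : ℝ) < (N : ℝ) ^ 2 := by positivity
  have hlog := Real.log_pos (by norm_num : (1 : ℝ) < 2)
  have hb : ∀ γ, |bpEnergy γ F| ≤ M := by
    intro γ
    rw [bpEnergy, abs_of_nonneg (sum_nonneg fun a _ => (bpViolation_mem_Icc γ F a).1)]
    refine (sum_le_sum fun a _ => (bpViolation_mem_Icc γ F a).2).trans ?_
    simp
  rw [bpLogPartition]
  refine (abs_sub _ _).trans ?_
  rw [abs_of_nonneg (by positivity : 0 ≤ N * Real.log 2)]
  gcongr
  refine (abs_sum_le_sum_abs _ _).trans ?_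
  have hterm : ∀ i ∈ Ico 1 (N ^ 2),
      |β / (N : ℝ) ^ 2 * bpEnergy (i * β / (N : ℝ) ^ 2) F| ≤ |β| / (N : ℝ) ^ 2 * M := by
    intro i _
    rw [abs_mul, abs_div, abs_of_pos hN']
    exact mul_le_mul_of_nonneg_left (hb _) (by positivity)
  refine (sum_le_sum hterm).trans ?_
  rw [sum_const, Nat.card_Ico, nsmul_eq_mul]
  have : ((N ^ 2 - 1 : ℕ) : ℝ) ≤ (N : ℝ) ^ 2 := by exact_mod_cast Nat.sub_le _ _
  calc ((N ^ 2 - 1 : ℕ) : ℝ) * (|β| / (N : ℝ) ^ 2 * M)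
      ≤ (N : ℝ) ^ 2 * (|β| / (N : ℝ) ^ 2 * M) := by gcongr
    _ = |β| * M := by field_simp

end LogPartition

/-! ### Events of probability tending to one -/

section HighProbability
open Finset BigOperators

open Classical in
theorem formulaProb_eq (k N M : ℕ) (P : SatFormula k N M → Prop) :
    formulaProb k N M P = ((univ.filter P).card : ℝ) / Fintype.card (SatFormula k N M) := by
  rw [formulaProb, Nat.card_eq_fintype_card, Nat.card_eq_fintype_card, Fintype.card_subtype]

theorem formulaProb_nonneg (k N M : ℕ) (P : SatFormula k N M → Prop) :
    0 ≤ formulaProb k N M P := by unfold formulaProb; positivity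

theorem formulaProb_mono {k N M : ℕ} {P Q : SatFormula k N M → Prop} (h : ∀ F, P F → Q F) :
    formulaProb k N M P ≤ formulaProb k N M Q := by
  classical
  rw [formulaProb_eq, formulaProb_eq]
  gcongr
  exact h _

theorem formulaProb_or_le {k N M : ℕ} (P Q : SatFormula k N M → Prop) :
    formulaProb k N M (fun F => P F ∨ Q F) ≤ formulaProb k N M P + formulaProb k N M Q := by
  classical
  rw [formulaProb_eq, formulaProb_eq, formulaProb_eq, ← add_div]
  gcongr
  refine le_trans ?_ (Nat.cast_add _ _).le
  refine Nat.cast_le.mpr ((card_le_card fun F hF => ?_).trans (card_union_le _ _))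
  simpa using hF

theorem formulaProb_not {k N M : ℕ} [Nonempty (SatClause k N)] (P : SatFormula k N M → Prop) :
    formulaProb k N M P = 1 - formulaProb k N M fun F => ¬ P F := by
  classical
  have h : (0 : ℝ) < Fintype.card (SatFormula k N M) := by exact_mod_cast Fintype.card_pos
  rw [formulaProb_eq, formulaProb_eq, eq_sub_iff_add_eq, ← add_div, div_eq_one_iff_eq h.ne']
  rw [← card_univ, ← card_filter_add_card_filter_not (s := univ) P, Nat.cast_add]
  congr! 3
  ext F
  simp

theorem formulaProb_le_expect_div {k N M : ℕ} {P : SatFormula k N M → Prop}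
    {f : SatFormula k N M → ℝ} (hf : ∀ F, 0 ≤ f F) {t : ℝ} (ht : 0 < t)
    (h : ∀ F, P F → t ≤ f F) : formulaProb k N M P ≤ iidExpect univ f / t := by
  classical
  refine (formulaProb_mono h).trans ?_
  rw [formulaProb_eq, iidExpect, Fintype.piFinset_univ]
  exact markov_expect f hf ht

/-- With probability tending to one, the random formula with density `α` has the property `P`. -/
def WithHighProb (k : ℕ) (α : ℝ) (P : ∀ N : ℕ, SatFormula k N ⌊α * N⌋₊ → Prop) : Prop :=
  Tendsto (fun N : ℕ => formulaProb k N ⌊α * N⌋₊ fun F => ¬ P N F) atTop (𝓝 0)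

variable {k : ℕ} {α : ℝ} {P Q : ∀ N : ℕ, SatFormula k N ⌊α * N⌋₊ → Prop}

theorem WithHighProb.mono (hP : WithHighProb k α P) (h : ∀ᶠ N in atTop, ∀ F, P N F → Q N F) :
    WithHighProb k α Q :=
  squeeze_zero' (Eventually.of_forall fun _ => formulaProb_nonneg _ _ _ _)
    (h.mono fun _ h => formulaProb_mono fun F hF hP => hF (h F hP)) hP

theorem WithHighProb.and (hP : WithHighProb k α P) (hQ : WithHighProb k α Q) :
    WithHighProb k α (fun N F => P N F ∧ Q N F) := by
  refine squeeze_zero (fun _ => formulaProb_nonneg _ _ _ _) (fun N => ?_)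
    (by simpa using Tendsto.add hP hQ)
  exact (formulaProb_mono fun F hF => not_and_or.mp hF).trans (formulaProb_or_le _ _)

theorem WithHighProb.tendsto (hP : WithHighProb k α P) :
    Tendsto (fun N : ℕ => formulaProb k N ⌊α * N⌋₊ (P N)) atTop (𝓝 1) := by
  have h : Tendsto (fun N : ℕ => 1 - formulaProb k N ⌊α * N⌋₊ fun F => ¬ P N F) atTop (𝓝 1) := by
    simpa using Tendsto.const_sub 1 hP
  refine h.congr' ((eventually_ge_atTop k).mono fun N hN => ?_)
  have : Nonempty (SatClause k N) := satClause_nonempty hN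
  exact (formulaProb_not _).symm

/-- Markov's inequality: a nonnegative function with expectation `o(N)` is `o(N)` with high
probability. -/
theorem withHighProb_of_expect_le {f : ∀ N : ℕ, ℕ → SatFormula k N ⌊α * N⌋₊ → ℝ}
    (hf : ∀ N n F, 0 ≤ f N n F)
    (h : ∀ ξ > 0, ∃ n, ∀ᶠ N : ℕ in atTop, iidExpect univ (f N n) ≤ ξ * N) {η : ℝ} (hη : 0 < η)
    (hP : ∀ n, ∀ᶠ N : ℕ in atTop, ∀ F, f N n F ≤ η * N → P N F) : WithHighProb k α P := by
  refine tendsto_order.mpr ⟨fun x hx => Eventually.of_forall fun N =>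
    hx.trans_le (formulaProb_nonneg _ _ _ _), fun x hx => ?_⟩
  obtain ⟨n, hn⟩ := h (x * η / 2) (by positivity)
  filter_upwards [hn, hP n, eventually_gt_atTop 0] with N h1 h2 h3
  have h3' : (0 : ℝ) < N := by exact_mod_cast h3
  have h4 := formulaProb_le_expect_div (P := fun F => ¬ P N F) (hf N n)
    (by positivity : 0 < η * N) (fun F hF => (not_le.mp fun h => hF (h2 F h)).le)
  refine h4.trans_lt ?_
  rw [div_lt_iff₀ (by positivity)]
  have : 0 < x * η * N := by positivity
  nlinarith

end HighProbability

/-! ### The error of belief propagation is o(N) -/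

section BeliefPropagationError
open Finset BigOperators

/-- κ vanishes at 0 and is continuous; a value of at least 1 would yield a root not exceeding `α`,
against minimality of the threshold. -/
theorem kappa_lt_one {k : ℕ} (hk : 2 ≤ k) {α : ℝ} (hα0 : 0 ≤ α) (hα : α < alphaStar k) :
    kappa k α < 1 := by
  by_contra! h
  have hcont : Continuous (kappa k) := by unfold kappa; fun_prop
  have h0 : kappa k 0 = 0 := by simp [kappa]
  obtain ⟨γ, hγ, h1⟩ := intermediate_value_Icc hα0 hcont.continuousOn
    (show (1 : ℝ) ∈ Set.Icc (kappa k 0) (kappa k α) from ⟨by rw [h0]; norm_num, h⟩)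
  have hγ0 : 0 < γ := by
    refine lt_of_le_of_ne hγ.1 ?_
    rintro rfl
    rw [h0] at h1
    exact zero_ne_one h1
  exact absurd ((alphaStar_isLeast k hk).2 ⟨hγ0, h1⟩) (by linarith [hγ.2])

theorem kappa_nonneg {k : ℕ} (hk : 2 ≤ k) {α : ℝ} (hα0 : 0 ≤ α) : 0 ≤ kappa k α := by
  have hk2 : (2 : ℝ) ≤ k := by exact_mod_cast hk
  have he : Real.exp (-((k : ℝ) * α / 2)) ≤ 1 := Real.exp_le_one_iff.mpr (by
    have : 0 ≤ (k : ℝ) * α / 2 := by positivity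
    linarith)
  unfold kappa
  have h1 : (0 : ℝ) ≤ k - 1 := by linarith
  have h2 : 0 ≤ 1 - 1 / 4 * Real.exp (-((k : ℝ) * α / 2)) := by linarith
  have h3 : 0 ≤ 1 - 1 / 2 * Real.exp (-((k : ℝ) * α / 2)) := by linarith
  positivity

open Classical in
/-- A bound on the error of belief propagation for the clause `a`. -/
noncomputable def bpError {k N M : ℕ} (β : ℝ) (n : ℕ) (F : SatFormula k N M) (a : Fin M) : ℝ :=
  if IsLooseAt F (2 * n) a then Real.exp β * (β / 2 * walkWeightAt F n a) else 1

theorem bpError_nonneg {k N M : ℕ} {β : ℝ} (hβ : 0 ≤ β) (n : ℕ) (F : SatFormula k N M)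
    (a : Fin M) : 0 ≤ bpError β n F a := by
  unfold bpError
  have := walkWeightAt_nonneg F n a
  split_ifs
  · positivity
  · exact zero_le_one

theorem abs_gibbsViolation_sub_bpViolation_le_bpError {k N M : ℕ} (hk : 2 ≤ k) {β γ : ℝ}
    (hγ : γ ∈ Set.Icc 0 β) (n : ℕ) (F : SatFormula k N M) (a : Fin M) :
    |gibbsViolation γ F a - bpViolation γ F a| ≤ bpError β n F a := by
  unfold bpError
  split_ifs with h
  · refine (abs_gibbsViolation_sub_bpViolation_le hk hγ.1 h).trans ?_
    have := walkWeightAt_nonneg F n a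
    have := hγ.1
    gcongr
    exacts [hγ.2, hγ.2]
  · have h1 := gibbsViolation_mem_Icc γ F a
    have h2 := bpViolation_mem_Icc γ F a
    rw [abs_le]
    constructor <;> linarith [h1.1, h1.2, h2.1, h2.2]

/-- The parameters are chosen in the order n, δ, N: n makes κ(α)^n small against the constants in
`D`, then δ beats the factor `Y` that grows with n, and finally N makes the non-loose clauses
negligible and the purity estimate valid. -/
theorem exists_iidExpect_sum_bpError_le {k : ℕ} (hk : 2 ≤ k) {α : ℝ} (hα0 : 0 ≤ α)
    (hα : α < alphaStar k) {β : ℝ} (hβ : 0 ≤ β) {ξ : ℝ} (hξ : 0 < ξ) :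
    ∃ n, ∀ᶠ N : ℕ in atTop, iidExpect univ (fun F : SatFormula k N ⌊α * N⌋₊ =>
      ∑ a, bpError β n F a) ≤ ξ * N := by
  set μ : ℝ := k * α / 2 with hμ
  set ρ : ℝ := 1 - 1 / 2 * Real.exp (-(k * α / 2)) with hρ
  have hμ0 : 0 ≤ μ := by positivity
  have hρ0 : 0 ≤ ρ := by
    have : Real.exp (-((k : ℝ) * α / 2)) ≤ 1 := Real.exp_le_one_iff.mpr (by linarith)
    rw [hρ]
    linarith
  have hκ : μ * (k - 1) * ρ ^ (k - 2) * (1 + ρ) = kappa k α := by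
    rw [kappa, hρ, hμ]
    ring
  set D : ℝ := α * (Real.exp β * (β / 2) * (2 * k * μ)) with hD
  have hD0 : 0 ≤ D := by positivity
  obtain ⟨n, hn⟩ := exists_pow_lt_of_lt_one (show 0 < ξ / (4 * (D + 1)) by positivity)
    (kappa_lt_one hk hα0 hα)
  set Y : ℝ := (2 * μ * (k - 1)) ^ n with hY
  have hk1 : (0 : ℝ) ≤ k - 1 := by
    have : (2 : ℝ) ≤ k := by exact_mod_cast hk
    linarith
  have hY0 : 0 ≤ Y := by positivity
  set δ : ℝ := ξ / (4 * (D + 1) * (Y + 1)) with hδ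
  have hδ0 : 0 < δ := by positivity
  -- Large enough for the at most n + 2 revealed clauses and for the purity weights of n clauses.
  set K := n + 2 + n * k with hK
  refine ⟨n, ?_⟩
  filter_upwards [eventually_iidExpect_prod_purityWeight_le k hα0 K hδ0, eventually_ge_atTop k,
    eventually_ge_atTop 2, eventually_ge_atTop ⌈2 * α * nonLooseBound k α (2 * n + 1) 0 / ξ⌉₊]
    with N h1 h2 h3 h4
  have : Nonempty (SatClause k N) := satClause_nonempty h2
  have hN0 : (0 : ℝ) < N := by
    have : (2 : ℝ) ≤ N := by exact_mod_cast h3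
    linarith
  have hM : ((⌊α * N⌋₊ : ℕ) : ℝ) ≤ α * N := Nat.floor_le (by positivity)
  have hμM : ((⌊α * N⌋₊ : ℕ) : ℝ) * (k / (2 * N) : ℝ) ≤ μ := by
    calc ((⌊α * N⌋₊ : ℕ) : ℝ) * (k / (2 * N) : ℝ) ≤ α * N * (k / (2 * N)) := by gcongr
      _ = μ := by rw [hμ]; field_simp
  have hloose := looseWeightBound hk (by omega : 0 < N) hμM hρ0 hδ0.le
    (fun τ f J a b c d => h1 τ f J a b c d) n
  set B : ℝ := nonLooseBound k α (2 * n + 1) 0 with hB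
  have hB0 : 0 ≤ B := nonLooseBound_nonneg hα0 _ _
  have hterm : ∀ a ∈ (univ : Finset (Fin ⌊α * N⌋₊)),
      iidExpect univ (fun F : SatFormula k N ⌊α * N⌋₊ => bpError β n F a) ≤
      B / N + Real.exp β * (β / 2) * (2 * k * μ * walkBound k μ ρ δ n 0) := by
    intro a _
    classical
    have e1 := iidExpect_not_isLooseAt_le (k := k) h3 hα0 hM (2 * n) a
    have e2 := iidExpect_looseWeightAt_le hk (by omega : 0 < N) hμM hρ0 hδ0.le hloose
      (by omega) (by omega) a
    refine (iidExpect_mono (ψ := fun F => (if IsLooseAt F (2 * n) a then (0 : ℝ) else 1) +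
      Real.exp β * (β / 2) * (if IsLooseAt F n a then walkWeightAt F n a else 0))
      fun F _ => ?_).trans ?_
    · unfold bpError
      have := walkWeightAt_nonneg F n a
      by_cases h : IsLooseAt F (2 * n) a
      · rw [if_pos h, if_pos h, if_pos (h.mono (by omega))]
        exact le_of_eq (by ring)
      · rw [if_neg h, if_neg h]
        have : 0 ≤ Real.exp β * (β / 2) *
          (if IsLooseAt F n a then walkWeightAt F n a else 0) := by
          split_ifs <;> positivity
        linarith
    · rw [iidExpect_add, iidExpect_const_mul]
      gcongr
  rw [iidExpect_sum]
  refine (sum_le_sum hterm).trans ?_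
  rw [sum_const, card_univ, Fintype.card_fin, nsmul_eq_mul]
  have hw : walkBound k μ ρ δ n 0 = kappa k α ^ n + δ * Y := by
    rw [walkBound, hκ, pow_zero, one_mul]
  have hw0 := walkBound_nonneg hk hμ0 hρ0 hδ0.le n 0
  calc ((⌊α * N⌋₊ : ℕ) : ℝ) * (B / N + Real.exp β * (β / 2) * (2 * k * μ * walkBound k μ ρ δ n 0))
      ≤ α * N * (B / N + Real.exp β * (β / 2) * (2 * k * μ * walkBound k μ ρ δ n 0)) := by
        gcongr
    _ = α * B + D * walkBound k μ ρ δ n 0 * N := by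
        rw [hD]
        field_simp
    _ ≤ ξ / 2 * N + ξ / 2 * N := by
        refine add_le_add ?_ (mul_le_mul_of_nonneg_right ?_ hN0.le)
        · have := Nat.ceil_le.mp h4
          rw [div_le_iff₀ hξ] at this
          linarith
        · rw [hw]
          have e1 : D * kappa k α ^ n ≤ ξ / 4 := by
            rw [lt_div_iff₀ (by positivity)] at hn
            have := pow_nonneg (kappa_nonneg hk hα0) n
            linarith
          have e2 : D * (δ * Y) ≤ ξ / 4 := by
            have : δ * (4 * (D + 1) * (Y + 1)) = ξ := div_mul_cancel₀ _ (by positivity)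
            have h0 : 0 ≤ δ * D := by positivity
            have h1 : 0 ≤ δ * Y := by positivity
            linarith
          linarith
    _ = ξ * N := by ring

/-- Belief propagation computes the logarithm of the partition function to precision `o(N)`. -/
theorem withHighProb_abs_log_gibbsZ_sub_bpLogPartition_le {k : ℕ} (hk : 2 ≤ k) {α : ℝ}
    (hα0 : 0 ≤ α) (hα : α < alphaStar k) {β : ℝ} (hβ : 0 ≤ β) {η : ℝ} (hη : 0 < η) :
    WithHighProb k α fun N F =>
      |Real.log (gibbsZ β F) - bpLogPartition β F| ≤ η * N := by
  refine withHighProb_of_expect_le (f := fun N n F => ∑ a, bpError β n F a)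
    (fun N n F => sum_nonneg fun a _ => bpError_nonneg hβ n F a)
    (fun ξ hξ => exists_iidExpect_sum_bpError_le hk hα0 hα hβ hξ)
    (η := η / (2 * (β + 1))) (by positivity) fun n => ?_
  filter_upwards [eventually_gt_atTop 0, eventually_ge_atTop ⌈2 * β * α / η⌉₊] with N hN h1 F hF
  have hN0 : (0 : ℝ) < N := by exact_mod_cast hN
  have hN1 : (1 : ℝ) ≤ N := by exact_mod_cast hN
  refine (abs_log_gibbsZ_sub_bpLogPartition_le hβ hN F (bpError β n F)
    fun γ hγ a => abs_gibbsViolation_sub_bpViolation_le_bpError hk hγ n F a).trans ?_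
  have hM : ((⌊α * N⌋₊ : ℕ) : ℝ) ≤ α * N := Nat.floor_le (by positivity)
  have e1 : β / (N : ℝ) ^ 2 * (⌊α * N⌋₊ : ℕ) ≤ η / 2 * N := by
    calc β / (N : ℝ) ^ 2 * (⌊α * N⌋₊ : ℕ) ≤ β / (N : ℝ) ^ 2 * (α * N) := by gcongr
      _ = β * α / N := by field_simp
      _ ≤ β * α := div_le_self (by positivity) hN1
      _ ≤ η / 2 * N := by
        have := Nat.ceil_le.mp h1
        rw [div_le_iff₀ hη] at this
        linarith
  have e2 : β * ∑ a, bpError β n F a ≤ η / 2 * N := by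
    calc β * ∑ a, bpError β n F a ≤ (β + 1) * (η / (2 * (β + 1)) * N) := by
          gcongr
          · exact sum_nonneg fun a _ => bpError_nonneg hβ n F a
          · linarith
      _ = η / 2 * N := by field_simp
  linarith

end BeliefPropagationError

/-! ### Repairing assignments by autarkies -/

section Autarkies
open Finset BigOperators

variable {k N M : ℕ}

/-- `x` satisfies the clause `c`. -/
def Satisfies (x : Fin N → Bool) (c : SatClause k N) : Prop := ∃ l ∈ c.1, x l.1 = l.2

instance (x : Fin N → Bool) (c : SatClause k N) : Decidable (Satisfies x c) := by
  unfold Satisfies; infer_instance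

/-- The assignment `x`, changed so that the literals in `S` become true. -/
def makeTrue (S : Finset (SatLiteral N)) (x : Fin N → Bool) : Fin N → Bool := fun i =>
  if (i, true) ∈ S then true else if (i, false) ∈ S then false else x i

/-- `S` is a consistent set of at most `s` literals that satisfies the clause `a` and every clause
in `G` that contains the negation of one of its literals. -/
structure IsAutarky (F : SatFormula k N M) (s : ℕ) (G : Finset (Fin M)) (a : Fin M)
    (S : Finset (SatLiteral N)) : Prop where
  card_le : S.card ≤ s
  consistent : ∀ l ∈ S, negLit l ∉ S
  satisfies : ∃ l ∈ S, l ∈ (F a).1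
  closed : ∀ b ∈ G, ∀ l ∈ S, negLit l ∈ (F b).1 → ∃ l' ∈ S, l' ∈ (F b).1

theorem makeTrue_of_mem {S : Finset (SatLiteral N)} (hS : ∀ l ∈ S, negLit l ∉ S)
    (x : Fin N → Bool) {l : SatLiteral N} (hl : l ∈ S) : makeTrue S x l.1 = l.2 := by
  obtain ⟨i, t⟩ := l
  cases t
  · have h := hS _ hl
    simp only [negLit, Bool.not_false] at h
    simp [makeTrue, h, hl]
  · simp [makeTrue, hl]

theorem makeTrue_of_notMem {S : Finset (SatLiteral N)} (x : Fin N → Bool) {i : Fin N}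
    (hi : i ∉ S.image Prod.fst) : makeTrue S x i = x i := by
  have h : ∀ t, (i, t) ∉ S := fun t h => hi (mem_image_of_mem Prod.fst h)
  simp [makeTrue, h]

/-- A preimage of `y` agrees with `y` away from the variables of `S`, so it is determined by its
values there. -/
theorem card_makeTrue_fiber_le (S : Finset (SatLiteral N)) (X : Finset (Fin N → Bool))
    (y : Fin N → Bool) : (X.filter fun x => makeTrue S x = y).card ≤ 2 ^ S.card := by
  have h : (X.filter fun x => makeTrue S x = y).card ≤
      Fintype.card ({i // i ∈ S.image Prod.fst} → Bool) := by
    rw [← card_univ]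
    refine card_le_card_of_injOn (fun x i => x i) (fun _ _ => mem_univ _) ?_
    intro x hx x' hx' h
    simp only [coe_filter, Set.mem_ofPred_eq] at hx hx'
    ext i
    by_cases hi : i ∈ S.image Prod.fst
    · rw [show x i = x' i from congrFun h ⟨i, hi⟩]
    · rw [← makeTrue_of_notMem x hi, ← makeTrue_of_notMem x' hi, hx.2, hx'.2]
  refine h.trans ?_
  rw [Fintype.card_fun, Fintype.card_bool, Fintype.card_coe]
  exact Nat.pow_le_pow_right (by norm_num) card_image_le

theorem IsAutarky.satisfies_makeTrue {F : SatFormula k N M} {s : ℕ} {G : Finset (Fin M)}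
    {a : Fin M} {S : Finset (SatLiteral N)} (h : IsAutarky F s G a S) (x : Fin N → Bool) :
    Satisfies (makeTrue S x) (F a) := by
  obtain ⟨l, hl, hla⟩ := h.satisfies
  exact ⟨l, hla, makeTrue_of_mem h.consistent x hl⟩

/-- If the literal that satisfied the clause is on a variable of `S`, then it is either in `S` or
the negation of a member, and in the latter case closedness supplies another true literal. -/
theorem IsAutarky.satisfies_of_mem {F : SatFormula k N M} {s : ℕ} {G : Finset (Fin M)}
    {a b : Fin M} {S : Finset (SatLiteral N)} (h : IsAutarky F s G a S) (hb : b ∈ G)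
    {x : Fin N → Bool} (hx : Satisfies x (F b)) : Satisfies (makeTrue S x) (F b) := by
  obtain ⟨l, hl, hxl⟩ := hx
  by_cases hS : l.1 ∈ S.image Prod.fst
  · obtain ⟨m, hm, hml⟩ := mem_image.mp hS
    have : ∃ l' ∈ S, l' ∈ (F b).1 := by
      rcases eq_or_eq_negLit hml with rfl | rfl
      · exact ⟨m, hm, hl⟩
      · exact h.closed b hb _ hm (by rwa [negLit_negLit])
    obtain ⟨l', hl', hlb⟩ := this
    exact ⟨l', hlb, makeTrue_of_mem h.consistent x hl'⟩
  · exact ⟨l, hl, by rw [makeTrue_of_notMem x hS, hxl]⟩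

/-- The number of the clauses in `G` that are violated by `x`. -/
def violationsIn (F : SatFormula k N M) (G : Finset (Fin M)) (x : Fin N → Bool) : ℕ :=
  (G.filter fun a => ¬ Satisfies x (F a)).card

theorem violations_eq (F : SatFormula k N M) (x : Fin N → Bool) :
    violations F x = violationsIn F univ x := by
  unfold violations violationsIn
  congr 1
  ext a
  simp only [Satisfies, mem_filter, mem_univ, true_and, not_exists, not_and, ne_eq]

theorem violationsIn_mono (F : SatFormula k N M) {G G' : Finset (Fin M)} (h : G ⊆ G')
    (x : Fin N → Bool) : violationsIn F G x ≤ violationsIn F G' x :=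
  card_le_card (filter_subset_filter _ h)

theorem IsAutarky.violationsIn_makeTrue_le {F : SatFormula k N M} {s : ℕ} {G : Finset (Fin M)}
    {a : Fin M} {S : Finset (SatLiteral N)} (h : IsAutarky F s G a S) {G' : Finset (Fin M)}
    (hG : G' ⊆ G) (x : Fin N → Bool) : violationsIn F G' (makeTrue S x) ≤ violationsIn F G' x := by
  refine card_le_card fun b hb => ?_
  rw [mem_filter] at hb ⊢
  exact ⟨hb.1, fun hx => hb.2 (h.satisfies_of_mem (hG hb.1) hx)⟩

/-- Every clause in `G` has a small autarky for the subformula `G`. -/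
def IsRepairable (F : SatFormula k N M) (s : ℕ) (G : Finset (Fin M)) : Prop :=
  ∀ a ∈ G, ∃ S, IsAutarky F s G a S

-- The penalties of the clauses in `U` are replaced by hard constraints, one clause at a time.
-- Assignments that violate the new clause `a` are sent by `makeTrue` to ones satisfying it: this
-- gains e^{-β}, breaks no clause of `G`, in particular no earlier constraint, and is at most 2^s to
-- one.
open Classical in
theorem IsRepairable.sum_le {F : SatFormula k N M} {s : ℕ} {G : Finset (Fin M)}
    (h : IsRepairable F s G) {β : ℝ} (hβ : 0 ≤ β) {U : Finset (Fin M)} (hU : U ⊆ G) :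
    ∑ x : Fin N → Bool, Real.exp (-β * violationsIn F G x) ≤
      (1 + Real.exp (-β) * 2 ^ s) ^ U.card *
        ∑ x : Fin N → Bool with ∀ a ∈ U, Satisfies x (F a),
          Real.exp (-β * violationsIn F (G \ U) x) := by
  induction U using Finset.induction_on with
  | empty => simp
  | insert a U ha ih =>
    have haG := hU (mem_insert_self a U)
    have hUG := (subset_insert a U).trans hU
    refine (ih hUG).trans ?_
    rw [card_insert_of_notMem ha, pow_succ, mul_assoc]
    refine mul_le_mul_of_nonneg_left ?_ (by positivity)
    obtain ⟨S, hS⟩ := h a haG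
    have haGU : a ∈ G \ U := mem_sdiff.mpr ⟨haG, ha⟩
    have hsd : G \ insert a U = (G \ U).erase a := by
      ext b
      simp only [Finset.mem_sdiff, mem_insert, mem_erase]
      tauto
    set X := univ.filter fun x : Fin N → Bool => ∀ a ∈ U, Satisfies x (F a) with hX
    set X' := univ.filter fun x : Fin N → Bool => ∀ b ∈ insert a U, Satisfies x (F b) with hX'
    set g : (Fin N → Bool) → ℝ := fun x => Real.exp (-β * violationsIn F (G \ insert a U) x)
      with hg
    have hX1 : X.filter (fun x => Satisfies x (F a)) = X' := by
      ext x
      simp only [hX, hX', mem_filter, mem_univ, true_and, forall_mem_insert]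
      tauto
    rw [← sum_filter_add_sum_filter_not X (fun x => Satisfies x (F a)), hX1, add_mul, one_mul]
    refine add_le_add (sum_le_sum fun x hx => ?_) ?_
    · have hxa : Satisfies x (F a) := by
        rw [← hX1, mem_filter] at hx
        exact hx.2
      have : violationsIn F (G \ U) x = violationsIn F (G \ insert a U) x := by
        unfold violationsIn
        rw [hsd, filter_erase, erase_eq_of_notMem]
        simp [hxa]
      rw [this]
    · have h1 : ∀ x ∈ X.filter (fun x => ¬ Satisfies x (F a)),
          Real.exp (-β * violationsIn F (G \ U) x) ≤ Real.exp (-β) * g (makeTrue S x) := by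
        intro x hx
        have hxa := (mem_filter.mp hx).2
        have e1 : violationsIn F (G \ U) x = violationsIn F (G \ insert a U) x + 1 := by
          unfold violationsIn
          rw [hsd, filter_erase, card_erase_add_one]
          exact mem_filter.mpr ⟨haGU, hxa⟩
        have e2 := hS.violationsIn_makeTrue_le (G' := G \ insert a U) sdiff_subset x
        rw [hg, ← Real.exp_add, e1]
        refine Real.exp_le_exp.mpr ?_
        push_cast
        have : β * violationsIn F (G \ insert a U) (makeTrue S x) ≤
            β * violationsIn F (G \ insert a U) x :=
          mul_le_mul_of_nonneg_left (by exact_mod_cast e2) hβ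
        linarith
      have hmaps : ∀ x ∈ X.filter (fun x => ¬ Satisfies x (F a)), makeTrue S x ∈ X' := by
        intro x hx
        simp only [hX, mem_filter, mem_univ, true_and] at hx
        simp only [hX', mem_filter, mem_univ, true_and, forall_mem_insert]
        exact ⟨hS.satisfies_makeTrue x, fun b hb =>
          hS.satisfies_of_mem (hUG hb) (hx.1 b hb)⟩
      refine (sum_le_sum h1).trans ?_
      rw [← mul_sum, mul_assoc]
      refine mul_le_mul_of_nonneg_left ?_ (Real.exp_pos _).le
      rw [← sum_fiberwise_of_maps_to hmaps, mul_sum]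
      refine sum_le_sum fun y _ => ?_
      rw [sum_congr rfl fun x hx => by rw [(mem_filter.mp hx).2], sum_const, nsmul_eq_mul]
      refine mul_le_mul_of_nonneg_right ?_ (Real.exp_pos _).le
      have := (card_makeTrue_fiber_le S (X.filter (fun x => ¬ Satisfies x (F a))) y).trans
        (Nat.pow_le_pow_right (by norm_num) hS.card_le)
      exact_mod_cast this

/-- With `U = G` no penalty remains, and the assignments counted can violate only clauses outside
`G`. -/
theorem IsRepairable.gibbsZ_le {F : SatFormula k N M} {s : ℕ} {G : Finset (Fin M)}
    (h : IsRepairable F s G) {β : ℝ} (hβ : 0 ≤ β) {ζ : ℝ} (hζ : (Gᶜ.card : ℝ) ≤ ζ) :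
    gibbsZ β F ≤ (1 + Real.exp (-β) * 2 ^ s) ^ M * numAlmostSat ζ F := by
  classical
  have h1 : gibbsZ β F ≤ ∑ x : Fin N → Bool, Real.exp (-β * violationsIn F G x) := by
    refine sum_le_sum fun x _ => Real.exp_le_exp.mpr ?_
    rw [violations_eq, neg_mul, neg_mul, neg_le_neg_iff]
    exact mul_le_mul_of_nonneg_left (by exact_mod_cast violationsIn_mono F (subset_univ G) x) hβ
  refine (h1.trans (h.sum_le hβ Subset.rfl)).trans ?_
  have hq : 1 ≤ 1 + Real.exp (-β) * 2 ^ s := by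
    have : 0 < Real.exp (-β) * 2 ^ s := by positivity
    linarith
  refine mul_le_mul (pow_le_pow_right₀ hq ((card_le_univ G).trans (by simp))) ?_
    (sum_nonneg fun _ _ => (Real.exp_pos _).le) (by positivity)
  have h2 : ∀ x, violationsIn F (G \ G) x = 0 := fun x => by simp [violationsIn]
  simp only [h2, Nat.cast_zero, mul_zero, Real.exp_zero, sum_const, nsmul_eq_mul, mul_one]
  rw [numAlmostSat, Nat.cast_le]
  refine card_le_card fun x hx => ?_
  rw [mem_filter] at hx ⊢
  refine ⟨mem_univ _, le_trans ?_ hζ⟩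
  rw [Nat.cast_le, violations_eq]
  refine card_le_card fun a ha => ?_
  rw [mem_compl]
  exact fun haG => (mem_filter.mp ha).2 (hx.2 a haG)

theorem numAlmostSat_le (β : ℝ) (hβ : 0 ≤ β) (F : SatFormula k N M) (ζ : ℝ) :
    numAlmostSat ζ F * Real.exp (-(β * ζ)) ≤ gibbsZ β F := by
  rw [numAlmostSat, ← nsmul_eq_mul, ← sum_const, gibbsZ]
  refine (sum_le_sum fun x hx => ?_).trans (sum_le_sum_of_subset_of_nonneg
    (filter_subset _ _) fun x _ _ => (Real.exp_pos _).le)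
  refine Real.exp_le_exp.mpr ?_
  rw [neg_mul, neg_le_neg_iff]
  exact mul_le_mul_of_nonneg_left (mem_filter.mp hx).2 hβ

theorem IsRepairable.numAlmostSat_pos_and {F : SatFormula k N M} {s : ℕ} {G : Finset (Fin M)}
    (h : IsRepairable F s G) {β : ℝ} (hβ : 0 ≤ β) {ζ : ℝ} (hζ : (Gᶜ.card : ℝ) ≤ ζ) :
    0 < numAlmostSat ζ F ∧ |Real.log (numAlmostSat ζ F) - Real.log (gibbsZ β F)| ≤
      M * (Real.exp (-β) * 2 ^ s) + β * ζ := by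
  have h1 := h.gibbsZ_le hβ hζ
  have hZ := gibbsZ_pos β F
  have hpos : 0 < numAlmostSat ζ F := by
    by_contra h0
    rw [Nat.eq_zero_of_not_pos h0, Nat.cast_zero, mul_zero] at h1
    linarith
  have hpos' : (0 : ℝ) < numAlmostSat ζ F := by exact_mod_cast hpos
  have hζ0 : 0 ≤ ζ := le_trans (Nat.cast_nonneg _) hζ
  refine ⟨hpos, ?_⟩
  have h2 := Real.log_le_log hZ h1
  rw [Real.log_mul (by positivity) hpos'.ne', Real.log_pow] at h2
  have h3 := Real.log_le_log (by positivity) (numAlmostSat_le β hβ F ζ)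
  rw [Real.log_mul hpos'.ne' (by positivity), Real.log_exp] at h3
  have h4 : Real.log (1 + Real.exp (-β) * 2 ^ s) ≤ Real.exp (-β) * 2 ^ s := by
    have := Real.log_le_sub_one_of_pos
      (show 0 < 1 + Real.exp (-β) * 2 ^ s by positivity)
    linarith
  have h5 : (M : ℝ) * Real.log (1 + Real.exp (-β) * 2 ^ s) ≤ M * (Real.exp (-β) * 2 ^ s) :=
    mul_le_mul_of_nonneg_left h4 (Nat.cast_nonneg _)
  have h6 : 0 ≤ β * ζ := by positivity
  have h7 : 0 ≤ (M : ℝ) * (Real.exp (-β) * 2 ^ s) := by positivity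
  rw [abs_le]
  constructor <;> linarith

/-- The smallest number of clauses whose deletion makes the formula repairable. -/
noncomputable def defect (s : ℕ) (F : SatFormula k N M) : ℕ :=
  sInf {m | ∃ G, IsRepairable F s G ∧ Gᶜ.card = m}

theorem exists_isRepairable_card_eq_defect (s : ℕ) (F : SatFormula k N M) :
    ∃ G, IsRepairable F s G ∧ Gᶜ.card = defect s F :=
  Nat.sInf_mem (s := {m | ∃ G, IsRepairable F s G ∧ Gᶜ.card = m}) ⟨_, ∅, by simp [IsRepairable], rfl⟩

theorem IsRepairable.defect_le {s : ℕ} {F : SatFormula k N M} {G : Finset (Fin M)}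
    (h : IsRepairable F s G) : defect s F ≤ Gᶜ.card := Nat.sInf_le ⟨G, h, rfl⟩

/-- Deleting the altered clause as well keeps the rest repairable, because autarkies persist when
other clauses are removed. -/
theorem defect_update_le (s : ℕ) (F : SatFormula k N M) (b : Fin M) (c : SatClause k N) :
    defect s (Function.update F b c) ≤ defect s F + 1 := by
  obtain ⟨G, hG, hc⟩ := exists_isRepairable_card_eq_defect s F
  have hF : ∀ a ∈ G.erase b, Function.update F b c a = F a := fun a ha =>
    Function.update_of_ne (mem_erase.mp ha).1 _ _
  have h : IsRepairable (Function.update F b c) s (G.erase b) := by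
    intro a ha
    obtain ⟨S, hS⟩ := hG a (mem_erase.mp ha).2
    refine ⟨S, hS.card_le, hS.consistent, by rw [hF a ha]; exact hS.satisfies, fun d hd => ?_⟩
    rw [hF d hd]
    exact hS.closed d (mem_erase.mp hd).2
  refine h.defect_le.trans ?_
  rw [← hc, compl_erase]
  exact card_insert_le _ _

theorem abs_defect_update_sub_le (s : ℕ) (F : SatFormula k N M) (b : Fin M) (c : SatClause k N) :
    |(defect s (Function.update F b c) : ℝ) - defect s F| ≤ 1 := by
  have h1 := defect_update_le s F b c
  have h2 := defect_update_le s (Function.update F b c) b (F b)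
  rw [Function.update_idem, Function.update_eq_self] at h2
  have h1' : (defect s (Function.update F b c) : ℝ) ≤ defect s F + 1 := by exact_mod_cast h1
  have h2' : (defect s F : ℝ) ≤ defect s (Function.update F b c) + 1 := by exact_mod_cast h2
  rw [abs_le]
  constructor <;> linarith

-- The clauses that have an autarky for the whole formula form a repairable subformula, the same
-- autarkies serving for it.
open Classical in
theorem defect_le_sum (s : ℕ) (F : SatFormula k N M) :
    (defect s F : ℝ) ≤ ∑ a, if ∃ S, IsAutarky F s univ a S then 0 else 1 := by
  have h : IsRepairable F s (univ.filter fun a => ∃ S, IsAutarky F s univ a S) := by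
    intro a ha
    obtain ⟨S, hS⟩ := (mem_filter.mp ha).2
    exact ⟨S, hS.card_le, hS.consistent, hS.satisfies, fun b _ => hS.closed b (mem_univ b)⟩
  have h2 := h.defect_le
  have e : (∑ a, if ∃ S, IsAutarky F s univ a S then (0 : ℝ) else 1) =
      ((univ.filter fun a => ∃ S, IsAutarky F s univ a S)ᶜ.card : ℝ) := by
    rw [compl_filter, ← sum_boole]
    exact sum_congr rfl fun a _ => by split_ifs <;> simp_all
  rw [e]
  exact_mod_cast h2

/-- The expectation is of order N, so Markov's inequality would not give probability tending to one.
By bounded differences the variance is at most M = O(N), and Markov's inequality is applied to the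
squared deviation divided by N. -/
theorem withHighProb_defect_le {k : ℕ} {α : ℝ} (hα : 0 ≤ α) {s : ℕ} {ε : ℝ} (hε : 0 < ε)
    (h : ∀ᶠ N : ℕ in atTop, iidExpect univ
      (fun F : SatFormula k N ⌊α * N⌋₊ => (defect s F : ℝ)) ≤ ε / 2 * N) :
    WithHighProb k α fun N F => (defect s F : ℝ) ≤ N * ε := by
  refine withHighProb_of_expect_le (f := fun N _ F => ((defect s F : ℝ) - iidExpect univ
      (fun F : SatFormula k N ⌊α * N⌋₊ => (defect s F : ℝ))) ^ 2 / N)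
    (fun N _ F => by positivity) (fun ξ hξ => ⟨0, ?_⟩) (η := (ε / 2) ^ 2) (by positivity)
    fun _ => ?_
  · filter_upwards [eventually_ge_atTop k, eventually_gt_atTop 0, eventually_ge_atTop ⌈α / ξ⌉₊]
      with N h1 h2 h3
    have : Nonempty (SatClause k N) := satClause_nonempty h1
    have hN : (0 : ℝ) < N := by exact_mod_cast h2
    have hv := variance_le_of_bounded_differences
      (fun F : SatFormula k N ⌊α * N⌋₊ => (defect s F : ℝ))
      (fun F b c => abs_defect_update_sub_le s F b c)
    simp only [div_eq_inv_mul]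
    rw [iidExpect_const_mul]
    simp only [iidExpect, Fintype.piFinset_univ]
    rw [← div_eq_inv_mul, div_le_iff₀ hN]
    refine hv.trans ((Nat.floor_le (by positivity)).trans ?_)
    gcongr
    have := Nat.ceil_le.mp h3
    rw [div_le_iff₀ hξ] at this
    linarith
  · filter_upwards [h, eventually_gt_atTop 0] with N h1 h2 F hF
    have hN : (0 : ℝ) < N := by exact_mod_cast h2
    rw [div_le_iff₀ hN] at hF
    have := abs_le_of_sq_le_sq (a := (defect s F : ℝ) - iidExpect univ
      (fun F : SatFormula k N ⌊α * N⌋₊ => (defect s F : ℝ))) (b := ε / 2 * N)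
      (by linarith) (by positivity)
    linarith [le_abs_self ((defect s F : ℝ) - iidExpect univ
      (fun F : SatFormula k N ⌊α * N⌋₊ => (defect s F : ℝ)))]

end Autarkies

/-! ### An exploration that constructs autarkies -/

section Exploration
open Finset BigOperators

variable {k N M : ℕ}

/-- The clauses outside of `τ` that contain the negation of `l`. -/
def hits (F : SatFormula k N M) (τ : Finset (Fin M)) (l : SatLiteral N) : Finset (Fin M) :=
  univ.filter fun b => b ∉ τ ∧ negLit l ∈ (F b).1

theorem mem_hits {F : SatFormula k N M} {τ : Finset (Fin M)} {l : SatLiteral N} {b : Fin M} :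
    b ∈ hits F τ l ↔ b ∉ τ ∧ negLit l ∈ (F b).1 := by simp [hits]

/-- The literals of the clause `b` other than `m`, each with the clause `b`. -/
noncomputable def exits (F : SatFormula k N M) (m : SatLiteral N) (b : Fin M) :
    List (Fin M × SatLiteral N) := ((F b).1.erase m).toList.map fun l => (b, l)

theorem mem_exits {F : SatFormula k N M} {m : SatLiteral N} {b : Fin M}
    {e : Fin M × SatLiteral N} :
    e ∈ exits F m b ↔ e.1 = b ∧ e.2 ∈ (F b).1 ∧ e.2 ≠ m := by
  obtain ⟨b', l⟩ := e
  simp only [exits, List.mem_map, mem_toList, mem_erase, Prod.mk.injEq]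
  constructor
  · rintro ⟨l', h, rfl, rfl⟩
    exact ⟨rfl, h.2, h.1⟩
  · rintro ⟨rfl, h1, h2⟩
    exact ⟨l, ⟨h2, h1⟩, rfl, rfl⟩

/-- Every clause of the list `Q` (a list of literals that remain to be tried) can be repaired within
`n` steps. The literals of a clause are made true in turn: a literal is kept if no further clause
contains its negation; the last literal is kept in any case, and the clauses that contain its
negation have to be repaired too. The clauses in `τ` have been seen before. -/
noncomputable def Explore (F : SatFormula k N M) :
    ℕ → Finset (Fin M) → List (List (Fin M × SatLiteral N)) → Prop
  | _, _, [] => True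
  | 0, _, _ :: _ => False
  | _ + 1, _, [] :: _ => False
  | n + 1, τ, [e] :: Q => Explore F n (τ ∪ hits F τ e.2)
      ((hits F τ e.2).toList.map (exits F (negLit e.2)) ++ Q)
  | n + 1, τ, (e :: e' :: I) :: Q =>
      if hits F τ e.2 = ∅ then Explore F n (τ ∪ hits F τ e.2) Q
      else Explore F n (τ ∪ hits F τ e.2) ((e' :: I) :: Q)

variable {F : SatFormula k N M} {a : Fin M}

theorem NBWalk.clauseWalk {p : ℕ} {b : Fin M} {m : SatLiteral N} (h : NBWalk F a p b m) :
    ClauseWalk F a p b := by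
  induction h with
  | start hl hb hm h => exact ClauseWalk.step hm hl h.symm ClauseWalk.refl
  | step hw hl hlm hb hm h ih => exact ClauseWalk.step hm hl h.symm ih

/-- A nonbacktracking walk of `p` clauses after `a` ends at `b` and can leave it through `l`. -/
def IsExit (F : SatFormula k N M) (a : Fin M) (p : ℕ) (b : Fin M) (l : SatLiteral N) : Prop :=
  (p = 0 ∧ b = a ∧ l ∈ (F a).1) ∨ ∃ m, NBWalk F a p b m ∧ l ∈ (F b).1 ∧ l ≠ m

theorem IsExit.mem {p : ℕ} {b : Fin M} {l : SatLiteral N} (h : IsExit F a p b l) :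
    l ∈ (F b).1 := by
  rcases h with ⟨_, rfl, h⟩ | ⟨m, _, h, _⟩ <;> exact h

theorem IsExit.clauseWalk {p : ℕ} {b : Fin M} {l : SatLiteral N} (h : IsExit F a p b l) :
    ClauseWalk F a p b := by
  rcases h with ⟨rfl, rfl, _⟩ | ⟨m, h, _⟩
  · exact ClauseWalk.refl
  · exact h.clauseWalk

theorem IsExit.nbWalk {p : ℕ} {b b' : Fin M} {l m' : SatLiteral N} (h : IsExit F a p b l)
    (hb : b' ≠ b) (hm : m' ∈ (F b').1) (hml : m'.1 = l.1) : NBWalk F a (p + 1) b' m' := by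
  rcases h with ⟨rfl, rfl, h⟩ | ⟨m, h, hl, hlm⟩
  · exact NBWalk.start h hb hm hml
  · exact h.step hl hlm hb hm hml

/-- In a loose neighbourhood, a clause is entered from at most one exit. -/
theorem IsExit.eq_of_negLit_mem (hk : 2 ≤ k) {d : ℕ} (hF : IsLooseAt F (2 * d + 1) a)
    {p q : ℕ} {b c g : Fin M} {l m : SatLiteral N} (h : IsExit F a p b l) (hp : p ≤ d)
    (h' : IsExit F a q c m) (hq : q ≤ d) (hgb : g ≠ b) (hgc : g ≠ c)
    (hgl : negLit l ∈ (F g).1) (hgm : negLit m ∈ (F g).1) : b = c ∧ l = m := by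
  have hw := h.nbWalk hgb hgl rfl
  have hw' := h'.nbWalk hgc hgm rfl
  have e1 : p = q := by
    rcases lt_trichotomy p q with hlt | rfl | hlt
    · exact absurd hw.clauseWalk (hw'.not_clauseWalk hk hF (by omega) (by omega))
    · rfl
    · exact absurd hw'.clauseWalk (hw.not_clauseWalk hk hF (by omega) (by omega))
  subst e1
  -- If the entering literals differed, the walk through `b` could continue from `g` to `c`,
  -- reaching it after p + 2 clauses although it is within p steps of `a`.
  have e2 : l = m := by
    by_contra hne
    have hne' : negLit m ≠ negLit l := fun e => hne (negLit_injective e).symm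
    exact (hw.step hgm hne' hgc.symm h'.mem rfl).not_clauseWalk hk hF (by omega) (by omega)
      h'.clauseWalk
  subst e2
  refine ⟨?_, rfl⟩
  by_contra hne
  exact (h.nbWalk (Ne.symm hne) h'.mem rfl).not_clauseWalk hk hF (by omega) (by omega)
    h'.clauseWalk

/-- The state of the exploration from `a`: `P` is the list of the exits that have not been tried,
and each clause in `τ` other than `a` has been reached through an exit that has been tried. -/
structure ExploreInv (F : SatFormula k N M) (a : Fin M) (d : ℕ) (τ : Finset (Fin M))
    (P : List (Fin M × SatLiteral N)) : Prop where
  nodup : P.Nodup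
  pending : ∀ e ∈ P, e.1 ∈ τ ∧ ∃ p ≤ d, IsExit F a p e.1 e.2
  parent : ∀ b ∈ τ, b = a ∨ ∃ e : Fin M × SatLiteral N, e.1 ∈ τ ∧ e ∉ P ∧
    (∃ p ≤ d, IsExit F a p e.1 e.2) ∧ b ≠ e.1 ∧ negLit e.2 ∈ (F b).1

/-- A seen clause other than `a` was entered from an exit already tried, and in a loose
neighbourhood it can be entered from no other. So no seen clause opposes a literal still to be
tried, and keeping that literal undoes nothing. -/
theorem ExploreInv.negLit_notMem (hk : 2 ≤ k) {d : ℕ} (hF : IsLooseAt F (2 * d + 1) a)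
    {τ : Finset (Fin M)} {e : Fin M × SatLiteral N} {P : List (Fin M × SatLiteral N)}
    (h : ExploreInv F a d τ (e :: P)) {b : Fin M} (hb : b ∈ τ) : negLit e.2 ∉ (F b).1 := by
  intro hbe
  obtain ⟨_, p, hp, hexit⟩ := h.pending e List.mem_cons_self
  have hne : b ≠ e.1 := by
    rintro rfl
    exact (F _).negLit_notMem hexit.mem hbe
  rcases h.parent b hb with rfl | ⟨e', _, he', ⟨q, hq, hexit'⟩, hne', hbe'⟩
  · exact (hexit.nbWalk hne hbe rfl).ne hk hF (by omega) rfl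
  · obtain ⟨e1, e2⟩ := hexit.eq_of_negLit_mem hk hF hp hexit' hq hne hne' hbe hbe'
    exact he' (Prod.ext e1 e2 ▸ List.mem_cons_self)

/-- New exits sit in clauses outside `τ`, which keeps them distinct from pending and parent exits.
The walk length grows by at most one per step, whence d + 1. -/
theorem ExploreInv.step {d : ℕ} {τ : Finset (Fin M)} {e : Fin M × SatLiteral N}
    {P P' X : List (Fin M × SatLiteral N)} (h : ExploreInv F a d τ (e :: P))
    (hP : P'.Sublist P) (hX : X.Nodup)
    (hXe : ∀ x ∈ X, x.1 ∈ hits F τ e.2 ∧ x.2 ∈ (F x.1).1 ∧ x.2 ≠ negLit e.2) :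
    ExploreInv F a (d + 1) (τ ∪ hits F τ e.2) (X ++ P') := by
  obtain ⟨heτ, p, hp, hexit⟩ := h.pending e List.mem_cons_self
  have hXτ : ∀ x ∈ X, x.1 ∉ τ := fun x hx => (mem_hits.mp (hXe x hx).1).1
  have hnd := List.nodup_cons.mp h.nodup
  refine ⟨?_, ?_, ?_⟩
  · refine List.Nodup.append hX (hnd.2.sublist hP) fun x hx hx' => hXτ x hx ?_
    exact (h.pending x (List.mem_cons_of_mem _ (hP.subset hx'))).1
  · intro x hx
    rcases List.mem_append.mp hx with hx | hx
    · obtain ⟨h1, h2, h3⟩ := hXe x hx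
      refine ⟨mem_union_right _ h1, p + 1, by omega, Or.inr ⟨negLit e.2, ?_, h2, h3⟩⟩
      exact hexit.nbWalk (fun hx' => hXτ x hx (hx' ▸ heτ)) (mem_hits.mp h1).2 rfl
    · obtain ⟨h1, q, hq, h2⟩ := h.pending x (List.mem_cons_of_mem _ (hP.subset hx))
      exact ⟨mem_union_left _ h1, q, by omega, h2⟩
  · intro b hb
    rcases mem_union.mp hb with hb | hb
    · rcases h.parent b hb with rfl | ⟨e', h1, h2, ⟨q, hq, h3⟩, h4⟩
      · exact Or.inl rfl
      · refine Or.inr ⟨e', mem_union_left _ h1, fun hmem => ?_, ⟨q, by omega, h3⟩, h4⟩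
        rcases List.mem_append.mp hmem with hmem | hmem
        · exact hXτ e' hmem h1
        · exact h2 (List.mem_cons_of_mem _ (hP.subset hmem))
    · obtain ⟨h1, h2⟩ := mem_hits.mp hb
      refine Or.inr ⟨e, mem_union_left _ heτ, fun hmem => ?_, ⟨p, by omega, hexit⟩,
        fun hbe => h1 (hbe ▸ heτ), h2⟩
      rcases List.mem_append.mp hmem with hmem | hmem
      · exact hXτ e hmem heτ
      · exact hnd.1 (hP.subset hmem)

theorem nodup_flatten_exits (F : SatFormula k N M) (m : SatLiteral N) (H : Finset (Fin M)) :
    (H.toList.map (exits F m)).flatten.Nodup := by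
  refine List.nodup_flatten.mpr ⟨fun I hI => ?_, ?_⟩
  · obtain ⟨b, _, rfl⟩ := List.mem_map.mp hI
    exact (nodup_toList _).map fun x y h => (Prod.mk.inj h).2
  · rw [List.pairwise_map]
    refine (nodup_toList H).imp fun {b c} hne x hx hx' => hne ?_
    rw [← (mem_exits.mp hx).1, ← (mem_exits.mp hx').1]

/-- A set of literals that repairs the clauses in `Q`. -/
structure IsRepair (F : SatFormula k N M) (n : ℕ) (τ : Finset (Fin M))
    (Q : List (List (Fin M × SatLiteral N))) (S : Finset (SatLiteral N)) : Prop where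
  card_le : S.card ≤ n
  consistent : ∀ l ∈ S, negLit l ∉ S
  satisfies : ∀ I ∈ Q, ∃ e ∈ I, e.2 ∈ S
  notMem : ∀ l ∈ S, ∀ b ∈ τ, negLit l ∉ (F b).1
  closed : ∀ b, ∀ l ∈ S, negLit l ∈ (F b).1 → ∃ l' ∈ S, l' ∈ (F b).1

/-- The clauses that contain the negation of the new literal are exactly the hits, and each was put
in the queue with its other literals, so `S` satisfies it. -/
theorem IsRepair.insert {n : ℕ} {τ : Finset (Fin M)} {Q : List (List (Fin M × SatLiteral N))}
    {e : Fin M × SatLiteral N} {I : List (Fin M × SatLiteral N)} {S : Finset (SatLiteral N)}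
    (h : IsRepair F n (τ ∪ hits F τ e.2) ((hits F τ e.2).toList.map (exits F (negLit e.2)) ++ Q) S)
    (heτ : e.1 ∈ τ) (he : e.2 ∈ (F e.1).1) (hno : ∀ b ∈ τ, negLit e.2 ∉ (F b).1) :
    IsRepair F (n + 1) τ ((e :: I) :: Q) (insert e.2 S) := by
  have hneg : negLit e.2 ∉ S := fun hS =>
    h.notMem _ hS e.1 (mem_union_left _ heτ) (by rwa [negLit_negLit])
  refine ⟨(card_insert_le _ _).trans (Nat.succ_le_succ h.card_le), ?_, ?_, ?_, ?_⟩
  · intro l hl hl'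
    rcases mem_insert.mp hl with rfl | hl <;> rcases mem_insert.mp hl' with hl' | hl'
    · exact negLit_ne _ hl'
    · exact hneg hl'
    · exact hneg (by rwa [← hl', negLit_negLit])
    · exact h.consistent l hl hl'
  · intro J hJ
    rcases List.mem_cons.mp hJ with rfl | hJ
    · exact ⟨e, List.mem_cons_self, mem_insert_self _ _⟩
    · obtain ⟨x, hx, hxS⟩ := h.satisfies J (List.mem_append_right _ hJ)
      exact ⟨x, hx, mem_insert_of_mem hxS⟩
  · intro l hl b hb
    rcases mem_insert.mp hl with rfl | hl
    · exact hno b hb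
    · exact h.notMem l hl b (mem_union_left _ hb)
  · intro b l hl hlb
    rcases mem_insert.mp hl with rfl | hl
    · have hbH : b ∈ hits F τ e.2 := mem_hits.mpr ⟨fun hb => hno b hb hlb, hlb⟩
      obtain ⟨x, hx, hxS⟩ := h.satisfies (exits F (negLit e.2) b)
        (List.mem_append_left _ (List.mem_map_of_mem (mem_toList.mpr hbH)))
      exact ⟨x.2, mem_insert_of_mem hxS, (mem_exits.mp hx).2.1⟩
    · obtain ⟨l', h1, h2⟩ := h.closed b l hl hlb
      exact ⟨l', mem_insert_of_mem h1, h2⟩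

/-- The constraint d + n ≤ D keeps all walks within the depth where looseness is known. A literal
that is tried and rejected has its hits marked as seen all the same: these are not repaired, as that
literal is never made true. -/
theorem Explore.exists_isRepair (hk : 2 ≤ k) {D : ℕ} (hF : IsLooseAt F (2 * D + 1) a) {n : ℕ}
    {τ : Finset (Fin M)} {Q : List (List (Fin M × SatLiteral N))} {d : ℕ} (hd : d + n ≤ D)
    (hQ : Explore F n τ Q) (h : ExploreInv F a d τ Q.flatten) : ∃ S, IsRepair F n τ Q S := by
  induction n generalizing τ Q d with
  | zero =>
    cases Q with
    | nil => exact ⟨∅, by simp, by simp, by simp, by simp, by simp⟩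
    | cons I Q => simp [Explore] at hQ
  | succ n ih =>
    match Q, hQ, h with
    | [], _, _ => exact ⟨∅, by simp, by simp, by simp, by simp, by simp⟩
    | [] :: Q, hQ, _ => simp [Explore] at hQ
    | [e] :: Q, hQ, h =>
      rw [Explore] at hQ
      rw [List.flatten_cons, List.singleton_append] at h
      obtain ⟨heτ, p, hp, hexit⟩ := h.pending e List.mem_cons_self
      obtain ⟨S, hS⟩ := ih (d := d + 1) (by omega) hQ (by
        rw [List.flatten_append]
        refine h.step (List.Sublist.refl _) (nodup_flatten_exits F _ _) fun x hx => ?_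
        obtain ⟨I, hI, hxI⟩ := List.mem_flatten.mp hx
        obtain ⟨b, hb, rfl⟩ := List.mem_map.mp hI
        obtain ⟨h1, h2, h3⟩ := mem_exits.mp hxI
        exact ⟨h1 ▸ mem_toList.mp hb, h1 ▸ h2, h3⟩)
      exact ⟨_, hS.insert heτ hexit.mem fun b hb =>
        h.negLit_notMem hk (hF.mono (by omega)) hb⟩
    | (e :: e' :: I) :: Q, hQ, h =>
      rw [Explore] at hQ
      rw [List.flatten_cons, List.cons_append] at h
      obtain ⟨heτ, p, hp, hexit⟩ := h.pending e List.mem_cons_self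
      split_ifs at hQ with hH
      · obtain ⟨S, hS⟩ := ih (d := d + 1) (by omega) hQ
          (h.step (X := []) (List.sublist_append_right _ _) List.nodup_nil (by simp))
        refine ⟨_, IsRepair.insert (S := S) ?_ heτ hexit.mem fun b hb =>
          h.negLit_notMem hk (hF.mono (by omega)) hb⟩
        simpa [hH] using hS
      · obtain ⟨S, hS⟩ := ih (d := d + 1) (by omega) hQ
          (h.step (X := []) (List.Sublist.refl _) List.nodup_nil (by simp))
        refine ⟨S, hS.card_le.trans (Nat.le_succ n), hS.consistent, fun J hJ => ?_,
          fun l hl b hb => hS.notMem l hl b (mem_union_left _ hb), hS.closed⟩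
        rcases List.mem_cons.mp hJ with rfl | hJ
        · obtain ⟨x, hx, hxS⟩ := hS.satisfies _ List.mem_cons_self
          exact ⟨x, List.mem_cons_of_mem _ hx, hxS⟩
        · exact hS.satisfies J (List.mem_cons_of_mem _ hJ)

/-- All the literals of the clause `a`. -/
noncomputable def rootExits (F : SatFormula k N M) (a : Fin M) : List (Fin M × SatLiteral N) :=
  (F a).1.toList.map fun l => (a, l)

theorem exists_isAutarky_of_explore (hk : 2 ≤ k) {n : ℕ} (hF : IsLooseAt F (2 * n + 1) a)
    (h : Explore F n {a} [rootExits F a]) : ∃ S, IsAutarky F n univ a S := by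
  have hmem : ∀ e, e ∈ rootExits F a → e.1 = a ∧ e.2 ∈ (F a).1 := by
    intro e he
    obtain ⟨l, hl, rfl⟩ := List.mem_map.mp he
    exact ⟨rfl, mem_toList.mp hl⟩
  obtain ⟨S, hS⟩ := h.exists_isRepair hk hF (d := 0) (by omega) (by
    rw [List.flatten_singleton]
    refine ⟨(nodup_toList _).map fun x y h => (Prod.mk.inj h).2, fun e he => ?_, fun b hb =>
      Or.inl (mem_singleton.mp hb)⟩
    obtain ⟨h1, h2⟩ := hmem e he
    exact ⟨mem_singleton.mpr h1, 0, le_rfl, Or.inl ⟨rfl, h1, h1 ▸ h2⟩⟩)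
  refine ⟨S, hS.card_le, hS.consistent, ?_, fun b _ => hS.closed b⟩
  obtain ⟨e, he, heS⟩ := hS.satisfies _ List.mem_cons_self
  exact ⟨e.2, heS, (hmem e he).2⟩

end Exploration

/-! ### Exponential decay of the failure probability of the exploration -/

section ExplorationProbability
open Finset BigOperators

variable {k N M : ℕ}

open Classical in
/-- The clauses that contain none of the literals in `D`. -/
noncomputable def avoiding (k : ℕ) (D : Finset (SatLiteral N)) : Finset (SatClause k N) :=
  univ.filter fun c => ∀ l ∈ D, l ∉ c.1

open Classical in
/-- The probability that a random clause which contains none of the literals in `D` contains `l`. -/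
noncomputable def condMemProb (k : ℕ) (D : Finset (SatLiteral N)) (l : SatLiteral N) : ℝ :=
  𝔼 c ∈ avoiding k D, if l ∈ c.1 then (1 : ℝ) else 0

open Classical in
theorem avoiding_insert (D : Finset (SatLiteral N)) (l : SatLiteral N) :
    (avoiding k D).filter (fun c => ¬ l ∈ c.1) = avoiding k (insert l D) := by
  ext c
  simp only [avoiding, mem_filter, mem_univ, true_and, forall_mem_insert]
  tauto

theorem condMemProb_mem_Icc (D : Finset (SatLiteral N)) (l : SatLiteral N) :
    condMemProb k D l ∈ Set.Icc (0 : ℝ) 1 := by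
  classical
  refine ⟨expect_nonneg fun c _ => by split_ifs <;> norm_num, ?_⟩
  rcases (avoiding k D).eq_empty_or_nonempty with h | h
  · simp [condMemProb, h]
  · exact expect_le h fun c _ => by split_ifs <;> norm_num

theorem card_avoiding (D : Finset (SatLiteral N)) :
    ((avoiding k D).card : ℝ) / Fintype.card (SatClause k N) =
      𝔼 c : SatClause k N, avoids D c := by
  classical
  rw [Fintype.expect_eq_sum_div_card]
  congr 1
  unfold avoids avoiding
  rw [sum_boole]

/-- Conditioning on an event of probability at least 1 - |D|k/(2N) raises the probability of another
event at most by the inverse of that number. -/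
theorem condMemProb_le (hN : 0 < N) [Nonempty (SatClause k N)] (D : Finset (SatLiteral N))
    (l : SatLiteral N) (h : 0 < 1 - D.card * (k / (2 * N) : ℝ)) :
    (avoiding k D).Nonempty ∧
      condMemProb k D l ≤ k / (2 * N) / (1 - D.card * (k / (2 * N) : ℝ)) := by
  classical
  have h1 := le_expect_avoids hN D (k := k)
  rw [← card_avoiding] at h1
  have hΩ : (0 : ℝ) < Fintype.card (SatClause k N) := by exact_mod_cast Fintype.card_pos
  have hpos : (0 : ℝ) < (avoiding k D).card := by
    have := h.trans_le h1
    rwa [div_pos_iff_of_pos_right hΩ] at this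
  refine ⟨card_pos.mp (by exact_mod_cast hpos), ?_⟩
  rw [condMemProb, expect_eq_sum_div_card]
  have h2 : ∑ c ∈ avoiding k D, (if l ∈ c.1 then (1 : ℝ) else 0) ≤
      k / (2 * N) * Fintype.card (SatClause k N) := by
    rw [← expect_mem hN l, Fintype.expect_eq_sum_div_card, div_mul_cancel₀ _ hΩ.ne']
    exact sum_le_sum_of_subset_of_nonneg (subset_univ _) fun c _ _ => by split_ifs <;> norm_num
  rw [div_le_div_iff₀ hpos h]
  rw [le_div_iff₀ hΩ] at h1
  calc (∑ c ∈ avoiding k D, (if l ∈ c.1 then (1 : ℝ) else 0)) * (1 - D.card * (k / (2 * N) : ℝ))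
      ≤ k / (2 * N) * Fintype.card (SatClause k N) * (1 - D.card * (k / (2 * N) : ℝ)) := by
        gcongr
    _ = k / (2 * N) * ((1 - D.card * (k / (2 * N) : ℝ)) * Fintype.card (SatClause k N)) := by ring
    _ ≤ _ := by gcongr

/-- The number of hits is binomial. The generating function is used at a value z ≥ 1 to bound growth
of the queue, and at z = 0 for the probability of no hit. -/
theorem iidExpect_pow_card_hits (D : Finset (SatLiteral N)) (hD : (avoiding k D).Nonempty)
    (τ : Finset (Fin M)) (l : SatLiteral N) (z : ℝ) :
    iidExpect (avoiding k D) (fun G : SatFormula k N M => z ^ (hits G τ l).card) =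
      (1 + (z - 1) * condMemProb k D (negLit l)) ^ (univ \ τ).card := by
  classical
  have h1 : ∀ G : SatFormula k N M, z ^ (hits G τ l).card =
      ∏ b, (if b ∉ τ ∧ negLit l ∈ (G b).1 then z else 1) := by
    intro G
    rw [prod_ite, prod_const_one, mul_one, prod_const]
    rfl
  simp only [h1]
  rw [iidExpect_prod (avoiding k D) (fun b c => if b ∉ τ ∧ negLit l ∈ c.1 then z else 1),
    ← prod_const, ← prod_subset (sdiff_subset (s := univ) (t := τ))]
  · refine prod_congr rfl fun b hb => ?_
    have hb' : b ∉ τ := (Finset.mem_sdiff.mp hb).2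
    have h2 : ∀ c : SatClause k N, (if b ∉ τ ∧ negLit l ∈ c.1 then z else 1) =
        1 + (z - 1) * (if negLit l ∈ c.1 then (1 : ℝ) else 0) := by
      intro c
      by_cases hc : negLit l ∈ c.1 <;> simp [hb', hc]
    simp only [h2]
    rw [expect_add_distrib, expect_const hD, ← mul_expect, condMemProb]
  · intro b _ hb
    have hb' : b ∈ τ := by
      by_contra h
      exact hb (Finset.mem_sdiff.mpr ⟨mem_univ _, h⟩)
    simp [hb', expect_const hD]

/-- The weights by which the failure of the exploration is bounded: `failWeight (r + 1)` is the
weight of a clause with `r + 1` literals to be tried. -/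
noncomputable def failWeight (g μ q z : ℝ) : ℕ → ℝ
  | 0 => 1
  | 1 => g * Real.exp (μ * (z - 1))
  | r + 2 => g * (q + (1 - q) * failWeight g μ q z (r + 1))

theorem one_le_failWeight {g μ q z : ℝ} (hg : 1 ≤ g) (hμ : 0 ≤ μ) (hq : q ≤ 1) (hz : 1 ≤ z)
    (r : ℕ) : 1 ≤ failWeight g μ q z r := by
  induction r with
  | zero => exact le_rfl
  | succ r ih =>
    cases r with
    | zero =>
      rw [zero_add, failWeight]
      have : 1 ≤ Real.exp (μ * (z - 1)) :=
        Real.one_le_exp (mul_nonneg hμ (by linarith))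
      nlinarith
    | succ r =>
      rw [failWeight]
      exact one_le_mul_of_one_le_of_one_le hg (by nlinarith)

/-- The known clauses in `τ` do not influence the exploration. -/
theorem hits_piecewise (τ : Finset (Fin M)) (f G G' : SatFormula k N M) (l : SatLiteral N)
    (hG' : ∀ b, negLit l ∉ (G' b).1) :
    hits ((τ ∪ hits G τ l).piecewise (τ.piecewise f G) G') τ l = hits G τ l := by
  ext b
  rw [mem_hits, mem_hits]
  refine and_congr_right fun hb => ?_
  by_cases hbH : negLit l ∈ (G b).1
  · have : b ∈ τ ∪ hits G τ l := mem_union_right _ (mem_hits.mpr ⟨hb, hbH⟩)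
    rw [piecewise_eq_of_mem _ _ _ this, piecewise_eq_of_notMem _ _ _ hb]
  · have : b ∉ τ ∪ hits G τ l := fun h => (mem_union.mp h).elim hb fun h => hbH (mem_hits.mp h).2
    rw [piecewise_eq_of_notMem _ _ _ this]
    exact iff_of_false (hG' b) hbH

-- A supermartingale bound: the product of the weights of the lists in the queue shrinks in mean by
-- a factor `g⁻¹` per step, and it is at least one while the exploration lasts. After the hits of a
-- literal have been revealed, the unseen clauses are uniform among those that avoid its negation
-- too, so the conditioning set `D` grows by one element per step.
open Classical in
theorem iidExpect_not_explore_le (hk : 2 ≤ k) {K : ℕ} {g μ q z : ℝ} (hg : 1 ≤ g) (hμ : 0 ≤ μ)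
    (hq : q ≤ 1) (hz : 1 ≤ z) (hw : failWeight g μ q z (k - 1) ≤ z)
    (hne : ∀ D : Finset (SatLiteral N), D.card ≤ K → (avoiding k D).Nonempty)
    (hp : ∀ (D : Finset (SatLiteral N)) l, D.card ≤ K → M * condMemProb k D l ≤ μ)
    (hpq : ∀ (D : Finset (SatLiteral N)) l, D.card ≤ K → q ≤ (1 - condMemProb k D l) ^ M)
    (n : ℕ) (τ : Finset (Fin M)) (f : SatFormula k N M) (D : Finset (SatLiteral N))
    (Q : List (List (Fin M × SatLiteral N))) (hD : D.card + n ≤ K) (hQ : [] ∉ Q) :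
    iidExpect (avoiding k D) (fun G => if Explore (τ.piecewise f G) n τ Q then (0 : ℝ) else 1) ≤
      (g⁻¹) ^ n * (Q.map fun I => failWeight g μ q z I.length).prod := by
  have hg0 : 0 < g := by linarith
  have hw1 := fun r => one_le_failWeight hg hμ hq hz r
  have hprod : ∀ Q : List (List (Fin M × SatLiteral N)),
      1 ≤ (Q.map fun I => failWeight g μ q z I.length).prod := fun Q => by
    induction Q with
    | nil => simp
    | cons I Q ih =>
      rw [List.map_cons, List.prod_cons]
      nlinarith [hw1 I.length]
  induction n generalizing τ f D Q with
  | zero =>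
    rw [pow_zero, one_mul]
    refine iidExpect_le_const (hne D (by omega)) fun G _ => le_trans ?_ (hprod Q)
    split_ifs <;> norm_num
  | succ n ih =>
    match Q, hQ with
    | [], _ =>
      refine iidExpect_le_const (hne D (by omega)) fun G _ => ?_
      rw [Explore, if_pos trivial]
      have := hprod []
      positivity
    | [] :: Q, hQ => exact absurd List.mem_cons_self hQ
    | [e] :: Q, hQ =>
      have hQ' : [] ∉ Q := fun h => hQ (List.mem_cons_of_mem _ h)
      set l := e.2 with hl
      have hneD := hne D (by omega)
      have hcard : (insert (negLit l) D).card ≤ D.card + 1 := card_insert_le _ _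
      have hne' : ((avoiding k D).filter fun c => ¬ negLit l ∈ c.1).Nonempty := by
        rw [avoiding_insert]
        exact hne _ (by omega)
      rw [iidExpect_piecewise_reveal_pred (avoiding k D) (fun c => negLit l ∈ c.1) hne' τ f
        (fun F => if Explore F (n + 1) τ ([e] :: Q) then (0 : ℝ) else 1), avoiding_insert]
      -- The last literal is kept, so each hit enters the queue with k - 1 literals, of weight at
      -- most `z`; on average this gives at most e^{μ(z-1)}.
      have hbound : ∀ G : SatFormula k N M, iidExpect (avoiding k (insert (negLit l) D))
          (fun G' => if Explore ((τ ∪ univ.filter (fun b => b ∉ τ ∧ negLit l ∈ (G b).1)).piecewise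
            (τ.piecewise f G) G') (n + 1) τ ([e] :: Q) then (0 : ℝ) else 1) ≤
          (g⁻¹) ^ n * (Q.map fun I => failWeight g μ q z I.length).prod *
            z ^ (hits G τ l).card := by
        intro G
        refine le_trans (le_of_eq ?_) ((ih (τ ∪ hits G τ l) (τ.piecewise f G)
          (insert (negLit l) D) ((hits G τ l).toList.map (exits G (negLit l)) ++ Q) (by omega)
          ?_).trans ?_)
        · refine iidExpect_congr fun G' hG' => ?_
          change (if Explore ((τ ∪ hits G τ l).piecewise (τ.piecewise f G) G') (n + 1) τ ([e] :: Q)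
            then (0 : ℝ) else 1) = _
          have hG'' : ∀ b, negLit l ∉ (G' b).1 := fun b =>
            (mem_filter.mp (hG' b)).2 _ (mem_insert_self _ _)
          have hmap : (hits G τ l).toList.map
              (exits ((τ ∪ hits G τ l).piecewise (τ.piecewise f G) G') (negLit l)) =
              (hits G τ l).toList.map (exits G (negLit l)) := by
            refine List.map_congr_left fun b hb => ?_
            rw [mem_toList] at hb
            have hbτ := (mem_hits.mp hb).1
            rw [exits, exits, piecewise_eq_of_mem _ _ _ (mem_union_right _ hb),
              piecewise_eq_of_notMem _ _ _ hbτ]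
          rw [Explore, ← hl, hits_piecewise τ f G G' l hG'', hmap]
        · intro h
          rcases List.mem_append.mp h with h | h
          · obtain ⟨b, hb, hbe⟩ := List.mem_map.mp h
            have := congrArg List.length hbe
            rw [exits, List.length_map, length_toList,
              card_erase_of_mem (mem_hits.mp (mem_toList.mp hb)).2, (G b).2.1] at this
            simp at this
            omega
          · exact hQ' h
        · rw [List.map_append, List.prod_append, List.map_map, mul_assoc,
            mul_comm (List.prod _) (z ^ _)]
          have hle : ((hits G τ l).toList.map
              ((fun I => failWeight g μ q z I.length) ∘ exits G (negLit l))).prod ≤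
              z ^ (hits G τ l).card := by
            rw [prod_map_toList]
            refine (prod_le_prod (fun b _ => zero_le_one.trans (hw1 _)) fun b hb => ?_).trans
              (prod_const z).le
            rw [exits, List.length_map, length_toList,
              card_erase_of_mem (mem_hits.mp hb).2, (G b).2.1]
            exact hw
          refine mul_le_mul_of_nonneg_left (mul_le_mul_of_nonneg_right hle ?_) (by positivity)
          linarith [hprod Q]
      refine (iidExpect_mono fun G _ => hbound G).trans ?_
      rw [iidExpect_const_mul, iidExpect_pow_card_hits D hneD, List.map_cons, List.prod_cons,
        List.length_singleton, failWeight]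
      have hp0 := (condMemProb_mem_Icc (k := k) D (negLit l)).1
      have hz' : 0 ≤ (z - 1) * condMemProb k D (negLit l) := mul_nonneg (by linarith) hp0
      have hexp : (1 + (z - 1) * condMemProb k D (negLit l)) ^ (univ \ τ).card ≤
          Real.exp (μ * (z - 1)) := by
        calc (1 + (z - 1) * condMemProb k D (negLit l)) ^ (univ \ τ).card
            ≤ (1 + (z - 1) * condMemProb k D (negLit l)) ^ M :=
              pow_le_pow_right₀ (by linarith) ((card_le_univ _).trans (by simp))
          _ ≤ Real.exp ((z - 1) * condMemProb k D (negLit l)) ^ M := by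
              refine pow_le_pow_left₀ (by linarith) ?_ _
              linarith [Real.add_one_le_exp ((z - 1) * condMemProb k D (negLit l))]
          _ = Real.exp (M * condMemProb k D (negLit l) * (z - 1)) := by
              rw [← Real.exp_nat_mul]
              congr 1
              ring
          _ ≤ Real.exp (μ * (z - 1)) := by
              refine Real.exp_le_exp.mpr (mul_le_mul_of_nonneg_right ?_ (by linarith))
              exact hp D _ (by omega)
      have hpos := hprod Q
      calc (g⁻¹) ^ n * (Q.map fun I => failWeight g μ q z I.length).prod *
            (1 + (z - 1) * condMemProb k D (negLit l)) ^ (univ \ τ).card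
          ≤ (g⁻¹) ^ n * (Q.map fun I => failWeight g μ q z I.length).prod *
            Real.exp (μ * (z - 1)) := by gcongr
        _ = _ := by
            rw [pow_succ]
            field_simp
    | (e :: e' :: I) :: Q, hQ =>
      have hQ' : [] ∉ Q := fun h => hQ (List.mem_cons_of_mem _ h)
      set l := e.2 with hl
      have hneD := hne D (by omega)
      have hcard : (insert (negLit l) D).card ≤ D.card + 1 := card_insert_le _ _
      have hne' : ((avoiding k D).filter fun c => ¬ negLit l ∈ c.1).Nonempty := by
        rw [avoiding_insert]
        exact hne _ (by omega)
      rw [iidExpect_piecewise_reveal_pred (avoiding k D) (fun c => negLit l ∈ c.1) hne' τ f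
        (fun F => if Explore F (n + 1) τ ((e :: e' :: I) :: Q) then (0 : ℝ) else 1),
        avoiding_insert]
      set w := failWeight g μ q z (I.length + 1) with hwdef
      set R := (Q.map fun I => failWeight g μ q z I.length).prod with hR
      -- The power of zero is the indicator of no hit: the list is then done, with weight 1, and
      -- otherwise it goes on one literal shorter, with weight `w`.
      have hbound : ∀ G : SatFormula k N M, iidExpect (avoiding k (insert (negLit l) D))
          (fun G' => if Explore ((τ ∪ univ.filter (fun b => b ∉ τ ∧ negLit l ∈ (G b).1)).piecewise
            (τ.piecewise f G) G') (n + 1) τ ((e :: e' :: I) :: Q) then (0 : ℝ) else 1) ≤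
          (g⁻¹) ^ n * R * (w + -(w - 1) * 0 ^ (hits G τ l).card) := by
        intro G
        have hrw : ∀ G', (∀ b, G' b ∈ avoiding k (insert (negLit l) D)) →
            hits ((τ ∪ hits G τ l).piecewise (τ.piecewise f G) G') τ l = hits G τ l :=
          fun G' hG' => hits_piecewise τ f G G' l fun b =>
            (mem_filter.mp (hG' b)).2 _ (mem_insert_self _ _)
        by_cases hH : hits G τ l = ∅
        · refine le_trans (le_of_eq ?_) ((ih (τ ∪ hits G τ l) (τ.piecewise f G)
            (insert (negLit l) D) Q (by omega) hQ').trans ?_)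
          · refine iidExpect_congr fun G' hG' => ?_
            change (if Explore ((τ ∪ hits G τ l).piecewise (τ.piecewise f G) G') (n + 1) τ
              ((e :: e' :: I) :: Q) then (0 : ℝ) else 1) = _
            rw [Explore, ← hl, hrw G' hG', if_pos hH]
          · rw [hH, card_empty, pow_zero]
            exact le_of_eq (by ring)
        · refine le_trans (le_of_eq ?_) ((ih (τ ∪ hits G τ l) (τ.piecewise f G)
            (insert (negLit l) D) ((e' :: I) :: Q) (by omega) ?_).trans ?_)
          · refine iidExpect_congr fun G' hG' => ?_
            change (if Explore ((τ ∪ hits G τ l).piecewise (τ.piecewise f G) G') (n + 1) τ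
              ((e :: e' :: I) :: Q) then (0 : ℝ) else 1) = _
            rw [Explore, ← hl, hrw G' hG', if_neg hH]
          · intro h
            rcases List.mem_cons.mp h with h | h
            · exact absurd h (by simp)
            · exact hQ' h
          · rw [zero_pow (card_ne_zero.mpr (nonempty_iff_ne_empty.mpr hH)), List.map_cons,
              List.prod_cons, List.length_cons]
            exact le_of_eq (by ring)
      refine (iidExpect_mono fun G _ => hbound G).trans ?_
      rw [iidExpect_const_mul, iidExpect_add, iidExpect_const_mul, iidExpect_const hneD,
        iidExpect_pow_card_hits D hneD, List.map_cons, List.prod_cons,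
        List.length_cons, List.length_cons, failWeight, ← hwdef, ← hR]
      obtain ⟨hp0, hp1⟩ := condMemProb_mem_Icc (k := k) D (negLit l)
      have hqp : q ≤ (1 + (0 - 1) * condMemProb k D (negLit l)) ^ (univ \ τ).card := by
        refine (hpq D (negLit l) (by omega)).trans ?_
        rw [zero_sub, neg_one_mul, ← sub_eq_add_neg]
        exact pow_le_pow_of_le_one (by linarith) (by linarith) ((card_le_univ _).trans (by simp))
      have hpos : 1 ≤ R := hprod Q
      have hw1' : 0 ≤ w - 1 := by linarith [hw1 (I.length + 1)]
      calc (g⁻¹) ^ n * R * (w + -(w - 1) *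
            (1 + (0 - 1) * condMemProb k D (negLit l)) ^ (univ \ τ).card)
          ≤ (g⁻¹) ^ n * R * (q + (1 - q) * w) := by
            refine mul_le_mul_of_nonneg_left ?_ (by positivity)
            nlinarith [mul_le_mul_of_nonneg_left hqp hw1']
        _ = _ := by
            rw [pow_succ]
            field_simp

open Classical in
theorem iidExpect_not_explore_root_le (hk : 2 ≤ k) [Nonempty (SatClause k N)] {K : ℕ}
    {g μ q z : ℝ} (hg : 1 ≤ g) (hμ : 0 ≤ μ)
    (hq : q ≤ 1) (hz : 1 ≤ z) (hw : failWeight g μ q z (k - 1) ≤ z)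
    (hne : ∀ D : Finset (SatLiteral N), D.card ≤ K → (avoiding k D).Nonempty)
    (hp : ∀ (D : Finset (SatLiteral N)) l, D.card ≤ K → M * condMemProb k D l ≤ μ)
    (hpq : ∀ (D : Finset (SatLiteral N)) l, D.card ≤ K → q ≤ (1 - condMemProb k D l) ^ M)
    (n : ℕ) (hn : n ≤ K) (a : Fin M) :
    iidExpect univ (fun F : SatFormula k N M =>
      if Explore F n {a} [rootExits F a] then (0 : ℝ) else 1) ≤
      (g⁻¹) ^ n * failWeight g μ q z k := by
  obtain ⟨f⟩ : Nonempty (SatFormula k N M) := inferInstance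
  have h := iidExpect_piecewise_reveal univ univ_nonempty (notMem_empty a) f
    (fun F : SatFormula k N M => if Explore F n {a} [rootExits F a] then (0 : ℝ) else 1)
  simp only [piecewise_empty] at h
  rw [h]
  refine expect_le univ_nonempty fun c _ => ?_
  have hroot : ∀ G, rootExits (({a} : Finset (Fin M)).piecewise (Function.update f a c) G) a =
      c.1.toList.map fun l => (a, l) := fun G => by simp [rootExits]
  have huniv : avoiding k (∅ : Finset (SatLiteral N)) = univ := by simp [avoiding]
  have hmain := iidExpect_not_explore_le hk hg hμ hq hz hw hne hp hpq n {a}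
    (Function.update f a c) ∅ [c.1.toList.map fun l => (a, l)] (by simpa using hn) (by
      intro h
      have := congrArg List.length (List.mem_singleton.mp h)
      rw [List.length_map, length_toList, c.2.1] at this
      simp at this
      omega)
  rw [List.map_singleton, List.prod_singleton, List.length_map, length_toList, c.2.1, huniv]
    at hmain
  refine le_trans (le_of_eq (iidExpect_congr fun G _ => ?_)) hmain
  rw [← hroot G]
  rfl

end ExplorationProbability

/-! ### Choice of the weights, and the expected defect -/

section ExplorationParameters
open Finset BigOperators

theorem continuous_failWeight (μ z : ℝ) (r : ℕ) :
    Continuous fun s : ℝ => failWeight (1 + s) (μ + s) (Real.exp (-μ) - s) z r := by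
  induction r with
  | zero => simpa only [failWeight] using continuous_const
  | succ r ih =>
    cases r with
    | zero =>
      simp only [failWeight]
      fun_prop
    | succ r =>
      simp only [failWeight]
      fun_prop

theorem failWeight_one_eq (μ q z : ℝ) (r : ℕ) :
    failWeight 1 μ q z (r + 1) = 1 + (1 - q) ^ r * (Real.exp (μ * (z - 1)) - 1) := by
  induction r with
  | zero =>
    simp only [failWeight]
    ring
  | succ r ih =>
    rw [failWeight, ih]
    ring

/-- If the mean number of clauses to be repaired after a clause is less than one, then the weights
can be chosen such that the failure probability of the exploration decays exponentially. -/
theorem exists_failWeight_le {k : ℕ} (hk : 2 ≤ k) {μ : ℝ} (hμ : 0 ≤ μ)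
    (h : μ * (1 - Real.exp (-μ)) ^ (k - 2) < 1) :
    ∃ z s : ℝ, 1 ≤ z ∧ 0 < s ∧
      failWeight (1 + s) (μ + s) (Real.exp (-μ) - s) z (k - 1) ≤ z := by
  set c := (1 - Real.exp (-μ)) ^ (k - 2) with hc
  have hc0 : 0 ≤ c := pow_nonneg (by
    have : Real.exp (-μ) ≤ 1 := Real.exp_le_one_iff.mpr (by linarith)
    linarith) _
  -- With z = 1 + t and no slack, the required inequality is c(e^{μt} - 1) ≤ t. As e^{μt} - 1 ≤
  -- μte^{μt}, it holds strictly for small t > 0, and continuity then leaves room for a slack s > 0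
  -- in all parameters.
  have hcont : Continuous fun t : ℝ => μ * c * Real.exp (μ * t) := by fun_prop
  have h0 : ∀ᶠ t in 𝓝[>] (0 : ℝ), μ * c * Real.exp (μ * t) < 1 := by
    refine (hcont.tendsto 0).eventually_lt_const ?_ |>.filter_mono nhdsWithin_le_nhds
    simpa using h
  obtain ⟨t, ht1, ht0⟩ := (h0.and self_mem_nhdsWithin).exists
  have ht0 : 0 < t := ht0
  have hz : failWeight (1 + 0) (μ + 0) (Real.exp (-μ) - 0) (1 + t) (k - 1) < 1 + t := by
    rw [add_zero, add_zero, sub_zero, show k - 1 = (k - 2) + 1 by omega, failWeight_one_eq, ← hc,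
      add_sub_cancel_left]
    have e1 : Real.exp (μ * t) - 1 ≤ μ * t * Real.exp (μ * t) := by
      have h1 := Real.add_one_le_exp (-(μ * t))
      have h2 : Real.exp (-(μ * t)) * Real.exp (μ * t) = 1 := by rw [← Real.exp_add]; simp
      have h3 := mul_le_mul_of_nonneg_right h1 (Real.exp_pos (μ * t)).le
      rw [h2] at h3
      linarith
    have e2 := mul_le_mul_of_nonneg_left e1 hc0
    have e3 := mul_lt_mul_of_pos_right ht1 ht0
    have e4 : c * (μ * t * Real.exp (μ * t)) = μ * c * Real.exp (μ * t) * t := by ring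
    linarith
  have h1 : ∀ᶠ s in 𝓝[>] (0 : ℝ),
      failWeight (1 + s) (μ + s) (Real.exp (-μ) - s) (1 + t) (k - 1) < 1 + t :=
    (((continuous_failWeight μ (1 + t) (k - 1)).tendsto 0).eventually_lt_const hz).filter_mono
      nhdsWithin_le_nhds
  obtain ⟨s, hs1, hs0⟩ := (h1.and self_mem_nhdsWithin).exists
  exact ⟨1 + t, s, by linarith, hs0, hs1.le⟩

/-- All bounds are continuous functions of y = k/(2N) near 0, uniform over `D` because only |D| ≤ K
enters, and αN·y = kα/2 exactly. -/
theorem eventually_condMemProb (k : ℕ) {α : ℝ} (hα : 0 ≤ α) (K : ℕ) {s : ℝ} (hs : 0 < s) :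
    ∀ᶠ N : ℕ in atTop, ∀ D : Finset (SatLiteral N), D.card ≤ K →
      (avoiding k D).Nonempty ∧ ∀ l, (⌊α * N⌋₊ : ℝ) * condMemProb k D l ≤ k * α / 2 + s ∧
        Real.exp (-(k * α / 2)) - s ≤ (1 - condMemProb k D l) ^ ⌊α * N⌋₊ := by
  set μ : ℝ := k * α / 2 with hμ
  have hμ0 : 0 ≤ μ := by positivity
  have hy : Tendsto (fun N : ℕ => (k : ℝ) / (2 * N)) atTop (𝓝 0) := by
    have := tendsto_const_div_atTop_nhds_zero_nat ((k : ℝ) / 2)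
    simpa only [div_div] using this
  have c1 : ContinuousAt (fun y : ℝ => 1 - K * y) 0 := by fun_prop
  have e1 : ∀ᶠ y : ℝ in 𝓝 0, 0 < 1 - K * y :=
    continuousAt_const.eventually_lt c1 (by simp)
  have c2 : ContinuousAt (fun y : ℝ => y / (1 - K * y)) 0 := by
    refine ContinuousAt.div continuousAt_id c1 (by simp)
  have e2 : ∀ᶠ y : ℝ in 𝓝 0, y / (1 - K * y) < 1 :=
    c2.eventually_lt continuousAt_const (by simp)
  have c3 : ContinuousAt (fun y : ℝ => μ / (1 - K * y)) 0 :=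
    ContinuousAt.div continuousAt_const c1 (by simp)
  have e3 : ∀ᶠ y : ℝ in 𝓝 0, μ / (1 - K * y) < μ + s :=
    c3.eventually_lt continuousAt_const (by simpa using hs)
  have c4 : ContinuousAt
      (fun y : ℝ => Real.exp (-(μ / (1 - K * y) / (1 - y / (1 - K * y))))) 0 := by
    refine ContinuousAt.rexp (ContinuousAt.neg (c3.div (continuousAt_const.sub c2) (by simp)))
  have e4 : ∀ᶠ y : ℝ in 𝓝 0, Real.exp (-μ) - s <
      Real.exp (-(μ / (1 - K * y) / (1 - y / (1 - K * y)))) :=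
    continuousAt_const.eventually_lt c4 (by simpa using hs)
  filter_upwards [hy.eventually (e1.and (e2.and (e3.and e4))), eventually_gt_atTop 0,
    eventually_ge_atTop k] with N hN hN0 hkN D hD
  obtain ⟨h1, h2, h3, h4⟩ := hN
  have hN0' : (0 : ℝ) < N := by exact_mod_cast hN0
  have : Nonempty (SatClause k N) := satClause_nonempty hkN
  set y : ℝ := k / (2 * N) with hydef
  have hy0 : 0 ≤ y := by positivity
  have hD' : (D.card : ℝ) ≤ K := by exact_mod_cast hD
  have hle : 1 - K * y ≤ 1 - D.card * y := by nlinarith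
  have hM : (⌊α * N⌋₊ : ℝ) ≤ α * N := Nat.floor_le (by positivity)
  set x := y / (1 - K * y) with hx
  have hx0 : 0 ≤ x := by positivity
  have hMx : (⌊α * N⌋₊ : ℝ) * x ≤ μ / (1 - K * y) := by
    calc (⌊α * N⌋₊ : ℝ) * x ≤ α * N * x := by gcongr
      _ = μ / (1 - K * y) := by
        rw [hx, ← mul_div_assoc]
        congr 1
        rw [hydef, hμ]
        field_simp
  have hp : ∀ l, condMemProb k D l ≤ x := fun l =>
    (condMemProb_le hN0 D l (h1.trans_le hle)).2.trans
      (div_le_div_of_nonneg_left hy0 h1 hle)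
  refine ⟨(condMemProb_le hN0 D (⟨0, hN0⟩, true) (h1.trans_le hle)).1, fun l => ⟨?_, ?_⟩⟩
  · calc (⌊α * N⌋₊ : ℝ) * condMemProb k D l ≤ ⌊α * N⌋₊ * x := by gcongr; exact hp l
      _ ≤ _ := hMx.trans h3.le
  · have hx1 : 0 < 1 - x := by linarith
    have hexp : Real.exp (-(x / (1 - x))) ≤ 1 - x := by
      have h5 := Real.add_one_le_exp (x / (1 - x))
      have h6 : x / (1 - x) + 1 = (1 - x)⁻¹ := by
        field_simp
        ring
      rw [h6] at h5
      rw [Real.exp_neg]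
      exact inv_le_of_inv_le₀ hx1 h5
    calc Real.exp (-μ) - s ≤ Real.exp (-(μ / (1 - K * y) / (1 - x))) := h4.le
      _ ≤ Real.exp (-((⌊α * N⌋₊ : ℝ) * x / (1 - x))) := by gcongr
      _ = Real.exp (-(x / (1 - x))) ^ ⌊α * N⌋₊ := by
        rw [← Real.exp_nat_mul]
        congr 1
        ring
      _ ≤ (1 - x) ^ ⌊α * N⌋₊ := by gcongr
      _ ≤ (1 - condMemProb k D l) ^ ⌊α * N⌋₊ := by
        refine pow_le_pow_left₀ hx1.le ?_ _
        linarith [hp l]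

/-- The exploration needs a weaker condition than belief propagation does, so the single threshold
serves both. -/
theorem mul_pow_le_kappa {k : ℕ} (hk : 2 ≤ k) {α : ℝ} (hα : 0 ≤ α) :
    k * α / 2 * (1 - Real.exp (-(k * α / 2))) ^ (k - 2) ≤ kappa k α := by
  have hμ : 0 ≤ (k : ℝ) * α / 2 := by positivity
  have hk2 : (2 : ℝ) ≤ k := by exact_mod_cast hk
  rw [kappa]
  set e := Real.exp (-((k : ℝ) * α / 2)) with he
  have he0 : 0 < e := Real.exp_pos _
  have he1 : e ≤ 1 := Real.exp_le_one_iff.mpr (by linarith)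
  have hpow : (1 - e) ^ (k - 2) ≤ (1 - 1 / 2 * e) ^ (k - 2) :=
    pow_le_pow_left₀ (by linarith) (by linarith) _
  refine mul_le_mul ?_ hpow (pow_nonneg (by linarith) _) ?_
  · have h1 : (1 : ℝ) / 2 ≤ (k - 1) * (1 - 1 / 4 * e) := by nlinarith
    calc (k : ℝ) * α / 2 = k * α * (1 / 2) := by ring
      _ ≤ k * α * ((k - 1) * (1 - 1 / 4 * e)) := by gcongr
      _ = _ := by ring
  · have : (0 : ℝ) ≤ k - 1 := by linarith
    have : 0 ≤ 1 - 1 / 4 * e := by linarith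
    positivity

/-- The expected number of clauses without an autarky of at most `n` literals decays exponentially
in `n`. -/
theorem exists_iidExpect_defect_le {k : ℕ} (hk : 2 ≤ k) {α : ℝ} (hα0 : 0 ≤ α)
    (hα : α < alphaStar k) :
    ∃ γ W : ℝ, 0 < γ ∧ γ < 1 ∧ 0 < W ∧ ∀ (n : ℕ) (ε : ℝ), W * γ ^ n < ε →
      ∀ᶠ N : ℕ in atTop, iidExpect univ
        (fun F : SatFormula k N ⌊α * N⌋₊ => (defect n F : ℝ)) ≤ ε * N := by
  classical
  have hμ0 : 0 ≤ (k : ℝ) * α / 2 := by positivity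
  obtain ⟨z, s, hz, hs, hw⟩ := exists_failWeight_le hk hμ0
    ((mul_pow_le_kappa hk hα0).trans_lt (kappa_lt_one hk hα0 hα))
  set μ : ℝ := k * α / 2 with hμ
  set q := Real.exp (-μ) - s with hq
  have hq1 : q ≤ 1 := by
    have : Real.exp (-μ) ≤ 1 := Real.exp_le_one_iff.mpr (by linarith)
    linarith
  set w := failWeight (1 + s) (μ + s) q z k with hwdef
  have hw1 : 1 ≤ w := one_le_failWeight (by linarith) (by linarith) hq1 hz k
  refine ⟨(1 + s)⁻¹, (α + 1) * w, by positivity, inv_lt_one_of_one_lt₀ (by linarith),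
    by positivity, fun n ε hε => ?_⟩
  set B : ℝ := nonLooseBound k α (2 * n + 2) 0 with hB
  have hB0 : 0 ≤ B := nonLooseBound_nonneg hα0 _ _
  set x := w * (1 + s)⁻¹ ^ n with hx
  have hx0 : 0 < x := by positivity
  have hε' : (α + 1) * x < ε := by
    rw [hx, ← mul_assoc]
    exact hε
  filter_upwards [eventually_condMemProb k hα0 n hs, eventually_ge_atTop k, eventually_ge_atTop 2,
    eventually_ge_atTop ⌈α * B / x⌉₊] with N h1 h2 h3 h4
  have : Nonempty (SatClause k N) := satClause_nonempty h2
  have hN0 : (0 : ℝ) < N := by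
    have : (2 : ℝ) ≤ N := by exact_mod_cast h3
    linarith
  have hM : ((⌊α * N⌋₊ : ℕ) : ℝ) ≤ α * N := Nat.floor_le (by positivity)
  have hterm : ∀ a ∈ (univ : Finset (Fin ⌊α * N⌋₊)),
      iidExpect univ (fun F : SatFormula k N ⌊α * N⌋₊ =>
        if ∃ S, IsAutarky F n univ a S then (0 : ℝ) else 1) ≤ B / N + x := by
    intro a _
    have e1 := iidExpect_not_isLooseAt_le (k := k) h3 hα0 hM (2 * n + 1) a
    have e2 := iidExpect_not_explore_root_le (M := ⌊α * N⌋₊) hk (by linarith : 1 ≤ 1 + s)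
      (by linarith : 0 ≤ μ + s) hq1 hz hw (fun D hD => (h1 D hD).1)
      (fun D l hD => ((h1 D hD).2 l).1) (fun D l hD => ((h1 D hD).2 l).2) n le_rfl a
    refine (iidExpect_mono (ψ := fun F => (if IsLooseAt F (2 * n + 1) a then (0 : ℝ) else 1) +
      (if Explore F n {a} [rootExits F a] then (0 : ℝ) else 1)) fun F _ => ?_).trans ?_
    · by_cases hl : IsLooseAt F (2 * n + 1) a
      · by_cases he : Explore F n {a} [rootExits F a]
        · simp [hl, he, exists_isAutarky_of_explore hk hl he]
        · simp only [hl, he, if_true, if_false]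
          split_ifs <;> norm_num
      · simp only [hl, if_false]
        split_ifs <;> norm_num
    · rw [iidExpect_add, hx, mul_comm w]
      exact add_le_add e1 e2
  refine (iidExpect_mono fun F _ => defect_le_sum n F).trans ?_
  rw [iidExpect_sum]
  refine (sum_le_sum hterm).trans ?_
  rw [sum_const, card_univ, Fintype.card_fin, nsmul_eq_mul]
  calc ((⌊α * N⌋₊ : ℕ) : ℝ) * (B / N + x) ≤ α * N * (B / N + x) := by gcongr
    _ = α * B + α * x * N := by field_simp
    _ ≤ x * N + α * x * N := by
      have := Nat.ceil_le.mp h4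
      rw [div_le_iff₀ hx0] at this
      linarith
    _ = (α + 1) * x * N := by ring
    _ ≤ ε * N := by gcongr

end ExplorationParameters

/-! ### Assembly of the two comparisons -/

section MainTheorem
open Finset BigOperators

theorem numAlmostSat_mono {k N M : ℕ} {ζ ζ' : ℝ} (h : ζ ≤ ζ') (F : SatFormula k N M) :
    numAlmostSat ζ F ≤ numAlmostSat ζ' F :=
  card_le_card fun x hx => by
    rw [mem_filter] at hx ⊢
    exact ⟨hx.1, hx.2.trans h⟩

theorem abs_log_numAlmostSat_le {k N M : ℕ} {ζ : ℝ} {F : SatFormula k N M}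
    (h : 0 < numAlmostSat ζ F) : |Real.log (numAlmostSat ζ F)| ≤ N * Real.log 2 := by
  have h1 : (1 : ℝ) ≤ numAlmostSat ζ F := by exact_mod_cast h
  have h2 : (numAlmostSat ζ F : ℝ) ≤ 2 ^ N := by
    have : numAlmostSat ζ F ≤ 2 ^ N := (card_le_univ _).trans (by simp)
    exact_mod_cast this
  rw [abs_of_nonneg (Real.log_nonneg h1), ← Real.log_pow]
  exact Real.log_le_log (by linarith) h2

/-- For ε bounded below but arbitrarily large, |log ε| is absorbed into a constant and a multiple of
ε^a. -/
theorem abs_log_le_add_rpow_div {ε ε₀ a : ℝ} (hε₀ : 0 < ε₀) (hε₀1 : ε₀ ≤ 1) (h : ε₀ ≤ ε)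
    (ha : 0 < a) : |Real.log ε| ≤ Real.log (1 / ε₀) + ε ^ a / a := by
  have hε : 0 < ε := hε₀.trans_le h
  have h1 : 0 ≤ Real.log (1 / ε₀) := Real.log_nonneg (by rw [le_div_iff₀ hε₀]; linarith)
  have h2 : Real.log ε ≤ ε ^ a / a := Real.log_le_rpow_div hε.le ha
  have h3 : Real.log ε₀ ≤ Real.log ε := Real.log_le_log hε₀ h
  have h4 : 0 ≤ ε ^ a / a := by positivity
  rw [one_div, Real.log_inv] at h1 ⊢
  rw [abs_le]
  constructor <;> linarith

/-- The relation between the logarithms of the number of almost satisfying assignments and of the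
partition function, for a small fraction of violated clauses. -/
theorem exists_withHighProb_abs_log_numAlmostSat_sub_le {k : ℕ} (hk : 2 ≤ k) {α : ℝ}
    (hα0 : 0 ≤ α) (hα : α < alphaStar k) :
    ∃ A ε₀ : ℝ, 0 < A ∧ 0 < ε₀ ∧ ε₀ ≤ 1 ∧ ∀ ε : ℝ, 0 < ε → ε ≤ ε₀ →
      WithHighProb k α fun N F => 0 < numAlmostSat (N * ε) F ∧
        |Real.log (numAlmostSat (N * ε) F) - Real.log (gibbsZ (A * Real.log (1 / ε)) F)| ≤
          N * (α * ε ^ (A / 2) + A * Real.log (1 / ε) * ε) := by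
  obtain ⟨γ, W, hγ0, hγ1, hW, hdef⟩ := exists_iidExpect_defect_le hk hα0 hα
  have hlog : Real.log γ < 0 := Real.log_neg hγ0 hγ1
  refine ⟨4 / -Real.log γ, min 1 (γ / (4 * W)), div_pos (by norm_num) (by linarith),
    lt_min one_pos (by positivity), min_le_left _ _, fun ε hε hε₀ => ?_⟩
  -- Chosen so that γ^{β/2} = ε². The number of deleted clauses per variable is then at most Wε²/γ,
  -- up to constants, and ε ≤ γ/(4W) brings it below ε/2.
  set A := 4 / -Real.log γ with hA
  have hA0 : 0 < A := div_pos (by norm_num) (by linarith)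
  have hε1 : ε ≤ 1 := hε₀.trans (min_le_left _ _)
  have hεW : ε ≤ γ / (4 * W) := hε₀.trans (min_le_right _ _)
  set β := A * Real.log (1 / ε) with hβ
  have hβ0 : 0 ≤ β := mul_nonneg hA0.le (Real.log_nonneg (by rw [le_div_iff₀ hε]; linarith))
  have hβexp : ∀ r : ℝ, Real.exp (-(r * β)) = ε ^ (A * r) := by
    intro r
    rw [Real.rpow_def_of_pos hε, hβ, one_div, Real.log_inv]
    congr 1
    ring
  -- The size of the autarkies: large enough for γ^{n+1} ≤ ε², and small enough for 2^n e^{-β} ≤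
  -- e^{-β/2} = ε^{A/2}.
  set n := ⌊β / 2⌋₊ with hn
  have hn1 : (n : ℝ) ≤ β / 2 := Nat.floor_le (by positivity)
  have hn2 : β / 2 < n + 1 := Nat.lt_floor_add_one _
  have hsmall : W * γ ^ n < ε / 2 := by
    have h1 : γ ^ (n + 1) ≤ ε ^ 2 := by
      have h2 : γ ^ (n + 1) = Real.exp (Real.log γ * (n + 1 : ℕ)) := by
        rw [mul_comm, Real.exp_nat_mul, Real.exp_log hγ0]
      have h3 : ε ^ 2 = Real.exp (Real.log γ * (β / 2)) := by
        have h4 : ε ^ 2 = Real.exp (2 * Real.log ε) := by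
          rw [show (2 : ℝ) * Real.log ε = (2 : ℕ) * Real.log ε by norm_num, Real.exp_nat_mul,
            Real.exp_log hε]
        rw [h4, hβ, hA, one_div, Real.log_inv]
        congr 1
        have := hlog.ne
        field_simp
        ring
      rw [h2, h3]
      refine Real.exp_le_exp.mpr (mul_le_mul_of_nonpos_left ?_ hlog.le)
      push_cast
      exact hn2.le
    rw [pow_succ] at h1
    rw [le_div_iff₀ (by positivity)] at hεW
    have h5 : W * γ ^ n * γ ≤ ε / 4 * γ := by
      nlinarith
    have h6 := le_of_mul_le_mul_right h5 hγ0
    linarith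
  refine (withHighProb_defect_le hα0 hε (hdef n (ε / 2) hsmall)).mono
    (Eventually.of_forall fun N F hF => ?_)
  obtain ⟨G, hG, hc⟩ := exists_isRepairable_card_eq_defect n F
  obtain ⟨hpos, h⟩ := hG.numAlmostSat_pos_and hβ0 (ζ := N * ε) (by rw [hc]; exact hF)
  refine ⟨hpos, h.trans ?_⟩
  have hM : ((⌊α * N⌋₊ : ℕ) : ℝ) ≤ α * N := Nat.floor_le (by positivity)
  have hexp : Real.exp (-β) * 2 ^ n ≤ ε ^ (A / 2) := by
    have h2 : (2 : ℝ) ^ n ≤ Real.exp (β / 2) := by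
      calc (2 : ℝ) ^ n ≤ Real.exp 1 ^ n := by
            refine pow_le_pow_left₀ (by norm_num) ?_ _
            linarith [Real.add_one_le_exp (1 : ℝ)]
        _ = Real.exp n := by rw [← Real.exp_nat_mul, mul_one]
        _ ≤ _ := Real.exp_le_exp.mpr hn1
    calc Real.exp (-β) * 2 ^ n ≤ Real.exp (-β) * Real.exp (β / 2) := by gcongr
      _ = Real.exp (-(1 / 2 * β)) := by
        rw [← Real.exp_add]
        congr 1
        ring
      _ = ε ^ (A / 2) := by
        rw [hβexp]
        congr 1
        ring
  calc ((⌊α * N⌋₊ : ℕ) : ℝ) * (Real.exp (-β) * 2 ^ n) + β * (N * ε)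
      ≤ α * N * ε ^ (A / 2) + β * (N * ε) := by gcongr
    _ = _ := by ring

end MainTheorem

theorem theorem4 (k : ℕ) (hk : 2 ≤ k) (α : ℝ) (hα0 : 0 ≤ α) (hα : α < alphaStar k) :
    ∃ A C a : ℝ, 0 < A ∧ 0 < C ∧ 0 < a ∧ ∀ ε : ℝ, 0 < ε →
      Tendsto
        (fun N : ℕ => formulaProb k N ⌊α * (N : ℝ)⌋₊ fun F =>
          0 < numAlmostSat ((N : ℝ) * ε) F ∧
            |Real.log (numAlmostSat ((N : ℝ) * ε) F : ℝ) -
                bpLogPartition (A * Real.log (1 / ε)) F| ≤ (N : ℝ) * C * ε ^ a)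
        atTop (𝓝 1) := by
  obtain ⟨A, ε₀, hA, hε₀, hε₀1, hsmall⟩ :=
    exists_withHighProb_abs_log_numAlmostSat_sub_le hk hα0 hα
  -- The exponent A/2 comes from the repair factor, and 1/2 from ε log(1/ε) ≤ 2ε^{1/2}.
  set a := min (1 / 2) (A / 2) with ha
  have ha0 : 0 < a := lt_min (by norm_num) (by positivity)
  set C₁ := α + 2 * A + 1 with hC₁
  -- This constant serves for ε ≥ ε₀, where ε₀^a ≤ ε^a absorbs the constant terms; `C₁` serves for ε
  -- ≤ ε₀.
  set C₂ := (2 * Real.log 2 + A * α * Real.log (1 / ε₀)) / ε₀ ^ a + A * α / a with hC₂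
  have hlog2 := Real.log_pos (by norm_num : (1 : ℝ) < 2)
  have hlogε₀ : 0 ≤ Real.log (1 / ε₀) := Real.log_nonneg (by rw [le_div_iff₀ hε₀]; linarith)
  have hC₁0 : 0 < C₁ := by positivity
  have hC₂0 : 0 ≤ C₂ := by positivity
  refine ⟨A, C₁ + C₂, a, hA, by positivity, ha0, fun ε hε => ?_⟩
  have hεa : 0 < ε ^ a := by positivity
  refine WithHighProb.tendsto (P := fun N F => 0 < numAlmostSat ((N : ℝ) * ε) F ∧
    |Real.log (numAlmostSat ((N : ℝ) * ε) F : ℝ) -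
      bpLogPartition (A * Real.log (1 / ε)) F| ≤ (N : ℝ) * (C₁ + C₂) * ε ^ a) ?_
  rcases le_total ε ε₀ with h | h
  · have hε1 : ε ≤ 1 := h.trans hε₀1
    have hβ : 0 ≤ A * Real.log (1 / ε) :=
      mul_nonneg hA.le (Real.log_nonneg (by rw [le_div_iff₀ hε]; linarith))
    -- For fixed ε the o(N) error of belief propagation may be taken to be εN.
    refine ((hsmall ε hε h).and
      (withHighProb_abs_log_gibbsZ_sub_bpLogPartition_le hk hα0 hα hβ hε)).mono
      (Eventually.of_forall fun N F hF => ⟨hF.1.1, ?_⟩)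
    refine (abs_sub_le _ (Real.log (gibbsZ (A * Real.log (1 / ε)) F)) _).trans
      ((add_le_add hF.1.2 hF.2).trans ?_)
    have e1 : ε ^ (A / 2) ≤ ε ^ a := Real.rpow_le_rpow_of_exponent_ge hε hε1 (min_le_right _ _)
    have e2 : ε ^ (1 / 2 : ℝ) ≤ ε ^ a := Real.rpow_le_rpow_of_exponent_ge hε hε1 (min_le_left _ _)
    have e3 : ε ≤ ε ^ (1 / 2 : ℝ) := by
      conv_lhs => rw [← Real.rpow_one ε]
      exact Real.rpow_le_rpow_of_exponent_ge hε hε1 (by norm_num)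
    have e4 : Real.log (1 / ε) * ε ≤ 2 * ε ^ (1 / 2 : ℝ) := by
      have h1 : Real.log (1 / ε) ≤ (1 / ε) ^ (1 / 2 : ℝ) / (1 / 2) :=
        Real.log_le_rpow_div (by positivity) (by norm_num)
      have h2 : (1 / ε) ^ (1 / 2 : ℝ) * ε = ε ^ (1 / 2 : ℝ) := by
        rw [one_div, Real.inv_rpow hε.le, ← Real.rpow_neg hε.le]
        nth_rewrite 2 [← Real.rpow_one ε]
        rw [← Real.rpow_add hε]
        norm_num
      have h3 := mul_le_mul_of_nonneg_right h1 hε.le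
      linarith
    have e5 : α * ε ^ (A / 2) + A * Real.log (1 / ε) * ε + ε ≤ C₁ * ε ^ a := by
      have h1 := mul_le_mul_of_nonneg_left e1 hα0
      have h2 := mul_le_mul_of_nonneg_left (e4.trans (mul_le_mul_of_nonneg_left e2 zero_le_two)) hA.le
      rw [hC₁]
      linarith
    calc N * (α * ε ^ (A / 2) + A * Real.log (1 / ε) * ε) + ε * N
        = N * (α * ε ^ (A / 2) + A * Real.log (1 / ε) * ε + ε) := by ring
      _ ≤ N * ((C₁ + C₂) * ε ^ a) := by
        refine mul_le_mul_of_nonneg_left (e5.trans ?_) (Nat.cast_nonneg N)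
        gcongr
        linarith
      _ = _ := by ring
  -- For large ε, positivity of the count is inherited from ε₀ by monotonicity, and both logarithms
  -- are bounded trivially.
  · refine (hsmall ε₀ hε₀ le_rfl).mono ((eventually_gt_atTop 0).mono fun N hN F hF => ?_)
    have hpos : 0 < numAlmostSat (N * ε) F :=
      hF.1.trans_le (numAlmostSat_mono (by gcongr) F)
    refine ⟨hpos, ?_⟩
    have hM : ((⌊α * N⌋₊ : ℕ) : ℝ) ≤ α * N := Nat.floor_le (by positivity)
    have e1 := abs_log_numAlmostSat_le hpos
    have e2 := abs_bpLogPartition_le (A * Real.log (1 / ε)) hN F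
    have e3 := abs_log_le_add_rpow_div hε₀ hε₀1 h ha0
    have e0 : |A * Real.log (1 / ε)| = A * |Real.log ε| := by
      rw [abs_mul, abs_of_pos hA, one_div, Real.log_inv, abs_neg]
    rw [e0] at e2
    have e4 : ε₀ ^ a ≤ ε ^ a := Real.rpow_le_rpow hε₀.le h ha0.le
    have e5 : A * |Real.log ε| * (⌊α * N⌋₊ : ℕ) ≤
        A * (Real.log (1 / ε₀) + ε ^ a / a) * (α * N) := by gcongr
    have e6 : 2 * Real.log 2 + A * α * Real.log (1 / ε₀) ≤
        (2 * Real.log 2 + A * α * Real.log (1 / ε₀)) / ε₀ ^ a * ε ^ a := by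
      rw [div_mul_eq_mul_div, le_div_iff₀ (by positivity)]
      gcongr
    have e7 : 2 * Real.log 2 + A * α * (Real.log (1 / ε₀) + ε ^ a / a) ≤ C₂ * ε ^ a := by
      rw [hC₂, add_mul, mul_add, ← add_assoc]
      refine add_le_add e6 (le_of_eq (by ring))
    refine (abs_sub _ _).trans ((add_le_add e1 e2).trans ?_)
    calc N * Real.log 2 + (N * Real.log 2 + A * |Real.log ε| * (⌊α * N⌋₊ : ℕ))
        ≤ N * Real.log 2 + (N * Real.log 2 +
          A * (Real.log (1 / ε₀) + ε ^ a / a) * (α * N)) := by gcongr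
      _ = N * (2 * Real.log 2 + A * α * (Real.log (1 / ε₀) + ε ^ a / a)) := by ring
      _ ≤ N * ((C₁ + C₂) * ε ^ a) := by
        refine mul_le_mul_of_nonneg_left (e7.trans ?_) (Nat.cast_nonneg N)
        gcongr
        linarith
      _ = _ := by ring
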